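/- For a sequence $c=\{c_{k,\tilde k}\}_{(k,\tilde k)\in\mathbb Z^2}$ put $\|c\|_{l^{2,s}}^2=\sum_{k,\tilde k}(1+|k|+|\tilde k|)^{2s}|c_{k,\tilde k}|^2$ and $\|c\|_{l^1}=\sum_{k,\tilde k}|c_{k,\tilde k}|$. Recall $e^{it\Delta}\delta_y(x)=\frac{e^{i(x-y)^2/(4t)}}{\sqrt{4\pi i t}}$. For $f=\sum_{k,\tilde k} c_{k,\tilde k}\,\delta_{ak+b\tilde k}$ with $c\in l^1$, put $E(f)=\sum_{k,\tilde k} c_{k,\tilde k}\,\delta_{(ak,b\tilde k)}$ on $\mathbb R^2$, so that $\widehat{E(f)}(\xi_1,\xi_2)=\sum_{k,\tilde k} c_{k,\tilde k}e^{-i\xi_1ak-i\xi_2b\tilde k}$, and $\|f\|_{H^{s,diag}_{pF;a,b}}=\|\widehat{E(f)}\|_{H^s}$, where $H^s$ is the periodic Sobolev space on the period cell $(0,\frac{2\pi}{|a|})\times(0,\frac{2\pi}{|b|})$, whose norm is the $l^{2,s}$ norm of the Fourier coefficients. **Theorem.** Let $s>\frac12$, $\frac12<\gamma<1$, and let $a,b\in\mathbb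 R\setminus\{0\}$ with $\frac ab\notin\mathbb Q$. Fix a sign $\pm$. For every $N\ge 0$ there is $\epsilon_0>0$, depending only on $s,\gamma,a,b,\pm,N$, and not on $N$ if $s>1$, such that the following holds for every $\{\alpha_{k,\tilde k}\}_{(k,\tilde k)\in\mathbb Z^2}\subset\mathbb C$ with exactly $N$ nonzero terms and $\|\{\alpha_{k,\tilde k}\}\|_{l^{2,s}}\le\epsilon_0$. (1) Let $M=\sum_{k,\tilde k}|\alpha_{k,\tilde k}|^2$. There exist $T>0$ and a unique distributional solution $u$ on $(0,T)\times\mathbb R$ of $$i\partial_tu+\Delta u\pm\tfrac12\Big(|u|^2-\frac{M}{2\pi t}\Big)u=0$$ (with $u$ and $|u|^2u$ locally integrable) of the form $$u(t)=\sum_{k,\tilde k\in\mathbb Z}e^{\mp i\frac{|\alpha_{k,\tilde k}|^2}{4\pi}\log\sqrt t}\,\big(\alpha_{k,\tilde k}+R_{k,\tilde k}(t)\big)\,e^{it\Delta}\delta_{ak+b\tilde k},$$ with $R\in\mathcal C^1((0,T);l^{2,s})$, $R(t)\in l^1$ for $0<t<T$, and $$\sup_{0<t<T}\Big(t^{-\gamma}\|R(t)\|_{l^{2,s}}+t\,\|\partial_tR(t)\|_{l^{2,s}}\Big)<\infty,\qquad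 \sup_{0<t<T}t^{-\gamma}\|R(t)\|_{l^1}<\infty .$$ (The conditions in $l^1$ follow from the other ones when $s>1$.) (2) Suppose moreover that $N\ge1$ and that the nonzero $\alpha_{k,\tilde k}$ all have the same modulus $r$. Let $M=(N-\frac12)r^2$ and $u(0)=\sum_{k,\tilde k}\alpha_{k,\tilde k}\delta_{ak+b\tilde k}$. There exist $T>0$ and a unique family $u(t)$, $t\in(-T,T)$, of tempered distributions on $\mathbb R$, given by functions for $t\ne0$, such that for all $t\in(-T,T)$ $$u(t)=e^{it\Delta}u(0)\pm ie^{it\Delta}\int_0^te^{-i\tau\Delta}\Big(\Big(|u(\tau)|^2-\frac{M}{2\pi|\tau|}\Big)u(\tau)\Big)\frac{d\tau}2$$ (the integral is weak, and improper at $\tau=0$), such that $e^{-it\Delta}u(t)=\sum_{k,\tilde k}c_{k,\tilde k}(t)\,\delta_{ak+b\tilde k}$ with $c(t)\in l^1$, that $t\mapsto\widehat{E(e^{-it\Delta}u(t))}$ is continuous from $(-T,T)$ to $H^s$ and of class $\mathcal C^1$ on $(-T,T)\setminus\{0\}$, and that for some constant $C$ $$\|e^{-it\Delta}u(t)-u(0)\|_{H^{s,diag}_{pF;a,b}}\le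 C|t|^\gamma,\qquad \|c(t)-\alpha\|_{l^1}\le C|t|^\gamma,\qquad\forall t\in(-T,T).$$ (The $l^1$ conditions follow from the other one when $s>1$.) -/

import Mathlib

open Set Filter Topology MeasureTheory
open scoped SchwartzMap ContDiff ENNReal

noncomputable section

namespace DiracNLS

/-! ### Doubly indexed sequences and weighted `ℓ²` spaces -/

/-- The weight `1 + |k| + |k̃|` on `ℤ × ℤ`. -/
def wt (n : ℤ × ℤ) : ℝ := 1 + |(n.1 : ℝ)| + |(n.2 : ℝ)|

/-- The sequence `c` multiplied by the weight `(1 + |k| + |k̃|)^s`. -/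
def weighted (s : ℝ) (c : ℤ × ℤ → ℂ) (n : ℤ × ℤ) : ℂ := ((wt n ^ s : ℝ) : ℂ) * c n

/-- The norm of `l^{2,s}`; only used for sequences that belong to `l^{2,s}`. -/
def normL2s (s : ℝ) (c : ℤ × ℤ → ℂ) : ℝ := Real.sqrt (∑' n, (wt n ^ s * ‖c n‖) ^ 2)

/-- The unweighted space `ℓ²(ℤ × ℤ)`. The space `l^{2,s}` is isometric to it through `weighted s`. -/
abbrev Ell2 : Type := lp (fun _ : ℤ × ℤ => ℂ) 2

/-- On the set `I`, the family `c` takes its values in `l^{2,s}` and is of class `C^m` as a map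
into that space. -/
def ContDiffL2s (m : ℕ) (s : ℝ) (I : Set ℝ) (c : ℝ → ℤ × ℤ → ℂ) : Prop :=
  ∃ W : ℝ → Ell2, (∀ t ∈ I, ∀ n, W t n = weighted s (c t) n) ∧ ContDiffOn ℝ m W I

/-- The point `a k + b k̃` of the real line. -/
def pt (a b : ℝ) (n : ℤ × ℤ) : ℝ := a * n.1 + b * n.2

/-! ### The first part: distributional solutions given by the ansatz -/

/-- The function `e^{itΔ} δ_y`, that is `x ↦ e^{i (x - y)² / (4t)} / √(4π i t)`, for `t ≠ 0`
(principal square root). -/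
def evolvedDirac (t y x : ℝ) : ℂ :=
  Complex.exp (Complex.I * ((x - y) ^ 2 / (4 * t) : ℝ)) /
    (4 * Real.pi * Complex.I * t : ℂ) ^ (1 / 2 : ℂ)

/-- `u` solves `i ∂ₜ u + ∂ₓ² u + (σ/2) (|u|² - M / (2π t)) u = 0` on `(0,T) × ℝ` in the sense of
distributions. -/
def IsDistribSolution (σ M T : ℝ) (u : ℝ → ℝ → ℂ) : Prop :=
  LocallyIntegrableOn (fun p : ℝ × ℝ => u p.1 p.2) (Ioo 0 T ×ˢ univ) ∧
  LocallyIntegrableOn (fun p : ℝ × ℝ => ((‖u p.1 p.2‖ ^ 2 : ℝ) : ℂ) * u p.1 p.2)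
    (Ioo 0 T ×ˢ univ) ∧
  ∀ φ : ℝ × ℝ → ℂ, ContDiff ℝ ∞ φ → HasCompactSupport φ → tsupport φ ⊆ Ioo 0 T ×ˢ univ →
    ∫ p : ℝ × ℝ, (u p.1 p.2 *
        (-Complex.I * deriv (fun τ => φ (τ, p.2)) p.1 + iteratedDeriv 2 (fun y => φ (p.1, y)) p.2)
      + (σ / 2 : ℝ) * ((‖u p.1 p.2‖ ^ 2 - M / (2 * Real.pi * p.1) : ℝ) : ℂ) * u p.1 p.2 * φ p) = 0

/-- The decay and regularity asked of the remainder `R` on `(0,T)`: it is of class `C¹` with values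
in `l^{2,s}`, and `t^{-γ} ‖R(t)‖_{l^{2,s}} + t ‖∂ₜ R(t)‖_{l^{2,s}}` is bounded. The bound in `ℓ¹`
makes the series over `ℤ × ℤ` converge absolutely; it follows from the other ones when `s > 1`. -/
def IsRemainder (s γ T : ℝ) (R : ℝ → ℤ × ℤ → ℂ) : Prop :=
  ContDiffL2s 1 s (Ioo 0 T) R ∧
  (∀ t ∈ Ioo 0 T, Summable fun n => ‖R t n‖) ∧
  ∃ C : ℝ, ∀ t ∈ Ioo 0 T,
    t ^ (-γ) * normL2s s (R t) + t * normL2s s (fun n => deriv (fun τ => R τ n) t) ≤ C ∧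
    ∑' n, ‖R t n‖ ≤ C * t ^ γ

/-- `u` is of the form
`u(t) = ∑ e^{-σ i |α_{k,k̃}|² / (4π) · log √t} (α_{k,k̃} + R_{k,k̃}(t)) e^{itΔ} δ_{ak + bk̃}`
on `(0,T)`, with an admissible remainder `R`. -/
def HasAnsatz (s γ a b σ T : ℝ) (α : ℤ × ℤ → ℂ) (u : ℝ → ℝ → ℂ) : Prop :=
  ∃ R : ℝ → ℤ × ℤ → ℂ, IsRemainder s γ T R ∧
    ∀ t ∈ Ioo 0 T, ∀ x, u t x =
      ∑' n, Complex.exp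
          (-Complex.I * (σ * (‖α n‖ ^ 2 / (4 * Real.pi) * Real.log (Real.sqrt t)) : ℝ)) *
        (α n + R t n) * evolvedDirac t (pt a b n) x

/-! ### The second part: Duhamel solutions with values in tempered distributions -/

/-- The symbol of `e^{itΔ}`, for the Fourier transform with kernel `e^{-2π i x ξ}`. -/
def schrodingerSymbol (t ξ : ℝ) : ℂ := Complex.exp (-Complex.I * (t * (2 * Real.pi * ξ) ^ 2 : ℝ))

/-- The symbol of `e^{itΔ}` is of temperate growth, so that it defines a Fourier multiplier. -/
theorem hasTemperateGrowth_schrodingerSymbol (t : ℝ) :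
    (schrodingerSymbol t).HasTemperateGrowth := by
  have hE : Function.HasTemperateGrowth (fun x : ℝ => Complex.exp (-Complex.I * x)) := by
    have hd : ∀ n : ℕ, iteratedDeriv n (fun x : ℝ => Complex.exp (-Complex.I * x)) =
        fun x : ℝ => (-Complex.I) ^ n * Complex.exp (-Complex.I * x) := by
      intro n
      induction n with
      | zero => simp
      | succ n ih =>
        rw [iteratedDeriv_succ, ih]
        funext x
        have h1 : HasDerivAt (fun x : ℝ => -Complex.I * (x : ℂ)) (-Complex.I * 1) x :=
          (Complex.ofRealCLM.hasDerivAt (x := x)).const_mul (-Complex.I)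
        rw [(h1.cexp.const_mul ((-Complex.I) ^ n)).deriv]
        ring
    refine ⟨?_, fun n => ⟨0, 1, fun x => ?_⟩⟩
    · exact (contDiff_const.mul Complex.ofRealCLM.contDiff).cexp
    · rw [norm_iteratedFDeriv_eq_norm_iteratedDeriv, hd]
      simp [Complex.norm_exp]
  have hp : Function.HasTemperateGrowth (fun ξ : ℝ => t * (2 * Real.pi * ξ) ^ 2) := by
    have h1 : Function.HasTemperateGrowth (fun ξ : ℝ => 2 * Real.pi * ξ) :=
      (Function.HasTemperateGrowth.const _).mul Function.HasTemperateGrowth.id'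
    exact (Function.HasTemperateGrowth.const t).mul (h1.pow 2)
  exact hE.comp hp

/-- The free Schrödinger group `e^{itΔ}` on tempered distributions. -/
def schrodinger (t : ℝ) : 𝓢'(ℝ, ℂ) →L[ℂ] 𝓢'(ℝ, ℂ) :=
  TemperedDistribution.fourierMultiplierCLM ℂ (schrodingerSymbol t)

/-- The tempered distribution `Λ` is given by the function `f`. -/
def IsRegularDistrib (f : ℝ → ℂ) (Λ : 𝓢'(ℝ, ℂ)) : Prop :=
  ∀ φ : 𝓢(ℝ, ℂ), Integrable (fun x => f x * φ x) ∧ Λ φ = ∫ x, f x * φ x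

/-- `Λ` is the absolutely convergent sum `∑ c_{k,k̃} δ_{ak + bk̃}`. -/
def IsDiracSum (a b : ℝ) (c : ℤ × ℤ → ℂ) (Λ : 𝓢'(ℝ, ℂ)) : Prop :=
  Summable (fun n => ‖c n‖) ∧ ∀ φ : 𝓢(ℝ, ℂ), Λ φ = ∑' n, c n * φ (pt a b n)

/-- `u` satisfies, for all `t ∈ (-T,T)`,
`u(t) = e^{itΔ} u₀ + σ i e^{itΔ} ∫₀ᵗ e^{-iτΔ} ((|u(τ)|² - M / (2π |τ|)) u(τ)) dτ / 2`.
Here `w τ` is the function that represents `u τ` for `τ ≠ 0`, `G τ` is the nonlinearity as a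
tempered distribution, and `J t` is the integral from `0` to `t`, which is improper at `0` and
taken weakly. -/
def IsDuhamelSolution (σ M T : ℝ) (u₀ : 𝓢'(ℝ, ℂ)) (u : ℝ → 𝓢'(ℝ, ℂ)) : Prop :=
  ∃ (w : ℝ → ℝ → ℂ) (G J : ℝ → 𝓢'(ℝ, ℂ)),
    (∀ τ ∈ Ioo (-T) T, τ ≠ 0 → IsRegularDistrib (w τ) (u τ)) ∧
    (∀ τ ∈ Ioo (-T) T, τ ≠ 0 → IsRegularDistrib
      (fun x => ((‖w τ x‖ ^ 2 - M / (2 * Real.pi * |τ|) : ℝ) : ℂ) * w τ x) (G τ)) ∧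
    (∀ t ∈ Ioo (-T) T, ∀ φ : 𝓢(ℝ, ℂ),
      (∀ η ∈ Ioc (0 : ℝ) 1,
        IntervalIntegrable (fun τ => schrodinger (-τ) (G τ) φ) volume (η * t) t) ∧
      Tendsto (fun η : ℝ => ∫ τ in (η * t)..t, schrodinger (-τ) (G τ) φ) (𝓝[>] 0)
        (𝓝 (J t φ))) ∧
    ∀ t ∈ Ioo (-T) T,
      u t = schrodinger t u₀ + (Complex.I * (σ / 2 : ℝ)) • schrodinger t (J t)

/-- The Fourier transform of the lift `E(f) = ∑ c_{k,k̃} δ_{(ak, bk̃)}` to the plane of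
`f = ∑ c_{k,k̃} δ_{ak + bk̃}`, with kernel `e^{-i x·ξ}`. -/
def liftHat (a b : ℝ) (c : ℤ × ℤ → ℂ) (ξ : ℝ × ℝ) : ℂ :=
  ∑' n : ℤ × ℤ, c n * Complex.exp (-Complex.I * (ξ.1 * (a * n.1) + ξ.2 * (b * n.2) : ℝ))

/-- The period cell `(0, 2π/|a|) × (0, 2π/|b|)`. -/
def cell (a b : ℝ) : Set (ℝ × ℝ) := Ioo 0 (2 * Real.pi / |a|) ×ˢ Ioo 0 (2 * Real.pi / |b|)

/-- The Fourier coefficients of a function that is `2π/a`-periodic in the first variable and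
`2π/b`-periodic in the second one. -/
def cellCoeff (a b : ℝ) (g : ℝ × ℝ → ℂ) (n : ℤ × ℤ) : ℂ :=
  ((|a| * |b| / (2 * Real.pi) ^ 2 : ℝ) : ℂ) * ∫ ξ in cell a b,
    g ξ * Complex.exp (Complex.I * (ξ.1 * (a * n.1) + ξ.2 * (b * n.2) : ℝ))

/-- The norm of the periodic Sobolev space `H^s` on the period cell. -/
def normHs (s a b : ℝ) (g : ℝ × ℝ → ℂ) : ℝ := normL2s s (cellCoeff a b g)

/-- On the set `I`, the family `g` of periodic functions takes its values in the periodic Sobolev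
space `H^s` on the period cell and is of class `C^m` as a map into that space. -/
def ContDiffHs (m : ℕ) (s a b : ℝ) (I : Set ℝ) (g : ℝ → ℝ × ℝ → ℂ) : Prop :=
  (∀ t ∈ I, MemLp (g t) 2 (volume.restrict (cell a b))) ∧
  ContDiffL2s m s I fun t => cellCoeff a b (g t)

/-- The profile `e^{-itΔ} u(t)` is a sum of Dirac masses at the points `ak + bk̃`; the Fourier
transform of its lift is a continuous function of `t ∈ (-T,T)` with values in `H^s`, of class `C¹`
for `t ≠ 0`; and its distance to `f₀ = ∑ α_{k,k̃} δ_{ak + bk̃}` in the norm of `H^{s,diag}_{pF;a,b}`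
is at most `C |t|^γ`. The bound in `ℓ¹` follows from that one when `s > 1`. -/
def HasDiagProfile (s γ a b T : ℝ) (α : ℤ × ℤ → ℂ) (u : ℝ → 𝓢'(ℝ, ℂ)) : Prop :=
  ∃ c : ℝ → ℤ × ℤ → ℂ,
    (∀ t ∈ Ioo (-T) T, IsDiracSum a b (c t) (schrodinger (-t) (u t))) ∧
    ContDiffHs 0 s a b (Ioo (-T) T) (fun t => liftHat a b (c t)) ∧
    ContDiffHs 1 s a b (Ioo (-T) T \ {0}) (fun t => liftHat a b (c t)) ∧
    ∃ C : ℝ, ∀ t ∈ Ioo (-T) T,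
      normHs s a b (liftHat a b fun n => c t n - α n) ≤ C * |t| ^ γ ∧
      ∑' n, ‖c t n - α n‖ ≤ C * |t| ^ γ

/-- The initial datum `∑ α_{k,k̃} δ_{ak + bk̃}`, a finite sum. -/
def diracDatum (a b : ℝ) (α : ℤ × ℤ →₀ ℂ) : 𝓢'(ℝ, ℂ) :=
  ∑ n ∈ α.support, α n • TemperedDistribution.delta (pt a b n)

end DiracNLS

end

/-! Write u(t) = ∑ A_n(t) e^{itΔ}δ_{x_n} with x_n = ak + bk̃. By completing the square, the product
of e^{itΔ}δ_{x₁}, the conjugate of e^{itΔ}δ_{x₂} and e^{itΔ}δ_{x₃} is (4π|t|)⁻¹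
exp(i(x₁-x₂)(x₂-x₃)/(2t)) times the evolved Dirac mass at x₁-x₂+x₃ (`evolvedDirac_interaction`). The
points x_n are stable under this operation, so the equation turns into a system of ordinary
differential equations with a 1/t singularity, A_n' = (iσ/(8π|t|)) (∑_{n₁-n₂+n₃=n} phase · A_{n₁}
conj(A_{n₂}) A_{n₃} - 2M A_n), whose right-hand side is `force`.

Since a/b is irrational the x_n are distinct, so the phase is free of 1/t only for n₁ = n₂ or n₂ =
n₃. At A = α these resonances add up to (2∑|α_j|² - |α_n|²) α_n. If M = ∑|α_j|², what is left after
subtracting 2Mα_n is -|α_n|²α_n, which the logarithmic rotation of the ansatz absorbs. If all moduli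
equal r and M = (N - 1/2) r², nothing is left and no rotation is needed.

Existence. The remainder solves R(t) = S(t) + ∫₀ᵗ H(τ, R(τ)) dτ/τ. The source S comes from the
finitely many nonresonant interactions of α. Its integrand has size 1/t but oscillates like
e^{ic/t}, and an integration by parts gives S = O(t) (`exists_oscillatory_primitive`). The map H is
Lipschitz with a constant at most γ/2, and τ^{γ-1} integrates to t^γ/γ, so the equation is a
contraction among functions that are O(t^γ) (`exists_singular_solution`, `exists_weighted_profile`).

Function spaces. The interaction is a convolution, hence bounded on ℓ¹, and also on ℓ¹ with a
submultiplicative weight. The weight (1 + δ|n|)^s (`exists_weight`) is comparable with the weight of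
l^{2,s}, but for small δ it is at most 2 on the finite support of α. So only the ℓ¹ norm of α has to
be small, while the remainder is controlled in l^{2,s} because ℓ¹ embeds in ℓ². Cauchy-Schwarz
bounds the ℓ¹ norm of α by its l^{2,s} norm, uniformly in the number of terms when s > 1
(`exists_threshold`).

Uniqueness. Both notions of solution are shown to force the integrated system on each coefficient.
For distributional solutions, the equation is tested against a function that oscillates like the
conjugate of one wave and is spread over a width L; as L → ∞ the other waves disappear by the
Riemann-Lebesgue lemma (`integral_extracted`, `integral_force_of_isDistribSolution`). For Duhamel
solutions, the profile is tested against shrinking bumps (`integral_force_of_isDuhamelSolution`).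
The difference of two solutions is then O(t^γ) and obeys a linear integral inequality with
coefficient κ/t + O(t^{γ-1}), κ < γ, which makes it vanish (`eq_zero_of_singular_integral`,
`eq_of_force`). -/

open Set Filter Topology MeasureTheory
open scoped SchwartzMap ContDiff ENNReal

noncomputable section

namespace DiracNLS

/-! ### The space `ℓ¹` and its bounded multipliers -/

/-- The index set of the lattice. -/
abbrev Idx : Type := ℤ × ℤ

/-- The space `ℓ¹(ℤ × ℤ)`. -/
abbrev Ell1 : Type := lp (fun _ : Idx => ℂ) 1

theorem memlp_one_iff {c : Idx → ℂ} : Memℓp c 1 ↔ Summable fun n => ‖c n‖ := by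
  rw [memℓp_gen_iff (by simp)]; simp

theorem Ell1.summable (A : Ell1) : Summable fun n => ‖A n‖ := memlp_one_iff.1 A.2

theorem Ell1.norm_eq (A : Ell1) : ‖A‖ = ∑' n, ‖A n‖ := by
  rw [lp.norm_eq_tsum_rpow (by simp)]; simp

theorem Ell1.norm_le {A : Ell1} {C : ℝ} (h : ∀ s : Finset Idx, ∑ n ∈ s, ‖A n‖ ≤ C) : ‖A‖ ≤ C := by
  have hC : 0 ≤ C := by simpa using h ∅
  rw [A.norm_eq]
  exact Real.tsum_le_of_sum_le (fun _ => norm_nonneg _) h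

theorem Ell1.sum_le (A : Ell1) (s : Finset Idx) : ∑ n ∈ s, ‖A n‖ ≤ ‖A‖ := by
  rw [A.norm_eq]
  exact A.summable.sum_le_tsum s fun _ _ => norm_nonneg _

/-- A summable family as an element of `ℓ¹` (and `0` if the family is not summable). -/
def ofFun (c : Idx → ℂ) : Ell1 := open Classical in if h : Memℓp c 1 then ⟨c, h⟩ else 0

theorem ofFun_apply {c : Idx → ℂ} (h : Summable fun n => ‖c n‖) (n : Idx) : ofFun c n = c n := by
  rw [ofFun, dif_pos (memlp_one_iff.2 h)]

theorem norm_ofFun {c : Idx → ℂ} (h : Summable fun n => ‖c n‖) : ‖ofFun c‖ = ∑' n, ‖c n‖ := by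
  rw [Ell1.norm_eq]; exact tsum_congr fun n => by rw [ofFun_apply h]

theorem ofFun_coe (A : Ell1) : ofFun A = A := by
  ext n; exact ofFun_apply A.summable n

theorem Ell1.summable_mul (A : Ell1) {m : Idx → ℂ} {C : ℝ} (hm : ∀ n, ‖m n‖ ≤ C) :
    Summable fun n => ‖m n * A n‖ := by
  refine Summable.of_nonneg_of_le (fun _ => norm_nonneg _) (fun n => ?_) (A.summable.mul_left C)
  rw [norm_mul]
  exact mul_le_mul_of_nonneg_right (hm n) (norm_nonneg _)

/-- Multiplication by a bounded family, as a map of `ℓ¹`. -/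
def mulCLM (m : Idx → ℂ) (C : ℝ) (hm : ∀ n, ‖m n‖ ≤ C) : Ell1 →L[ℂ] Ell1 :=
  LinearMap.mkContinuous
    { toFun := fun A => ofFun fun n => m n * A n
      map_add' := fun A B => by
        ext n
        simp only [lp.coeFn_add, Pi.add_apply]
        have := (A + B).summable_mul hm
        simp only [lp.coeFn_add, Pi.add_apply] at this
        rw [ofFun_apply this, ofFun_apply (A.summable_mul hm), ofFun_apply (B.summable_mul hm)]
        ring
      map_smul' := fun c A => by
        ext n
        have := (c • A).summable_mul hm
        simp only [lp.coeFn_smul, Pi.smul_apply, RingHom.id_apply, smul_eq_mul] at this ⊢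
        rw [ofFun_apply this, ofFun_apply (A.summable_mul hm)]
        ring } C fun A => by
    refine Ell1.norm_le fun s => ?_
    simp only [LinearMap.coe_mk, AddHom.coe_mk]
    calc ∑ n ∈ s, ‖ofFun (fun n => m n * A n) n‖ ≤ ∑ n ∈ s, C * ‖A n‖ := by
          refine Finset.sum_le_sum fun n _ => ?_
          rw [ofFun_apply (A.summable_mul hm), norm_mul]
          exact mul_le_mul_of_nonneg_right (hm n) (norm_nonneg _)
      _ = C * ∑ n ∈ s, ‖A n‖ := by rw [Finset.mul_sum]
      _ ≤ C * ‖A‖ := mul_le_mul_of_nonneg_left (A.sum_le s) ((norm_nonneg _).trans (hm 0))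

theorem mulCLM_apply (m : Idx → ℂ) (C : ℝ) (hm : ∀ n, ‖m n‖ ≤ C) (A : Ell1) (n : Idx) :
    mulCLM m C hm A n = m n * A n := ofFun_apply (A.summable_mul hm) n

theorem norm_mulCLM_le (m : Idx → ℂ) (C : ℝ) (hm : ∀ n, ‖m n‖ ≤ C) (A : Ell1) :
    ‖mulCLM m C hm A‖ ≤ C * ‖A‖ :=
  (mulCLM m C hm).le_of_opNorm_le
    (LinearMap.mkContinuous_norm_le _ ((norm_nonneg _).trans (hm 0)) _) A

/-- The sum of a summable family against a bounded one. -/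
def pairCLM (m : Idx → ℂ) (C : ℝ) (hm : ∀ n, ‖m n‖ ≤ C) : Ell1 →L[ℂ] ℂ :=
  LinearMap.mkContinuous
    { toFun := fun A => ∑' n, m n * A n
      map_add' := fun A B => by
        simp only [lp.coeFn_add, Pi.add_apply, mul_add]
        exact (A.summable_mul hm).of_norm.tsum_add (B.summable_mul hm).of_norm
      map_smul' := fun c A => by
        simp only [lp.coeFn_smul, Pi.smul_apply, RingHom.id_apply, smul_eq_mul]
        rw [← tsum_mul_left]
        exact tsum_congr fun n => by ring } C fun A => by
    simp only [LinearMap.coe_mk, AddHom.coe_mk]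
    refine (norm_tsum_le_tsum_norm (A.summable_mul hm)).trans ?_
    rw [A.norm_eq, ← tsum_mul_left]
    refine (A.summable_mul hm).tsum_le_tsum (fun n => ?_) (A.summable.mul_left C)
    rw [norm_mul]
    exact mul_le_mul_of_nonneg_right (hm n) (norm_nonneg _)

theorem pairCLM_apply (m : Idx → ℂ) (C : ℝ) (hm : ∀ n, ‖m n‖ ≤ C) (A : Ell1) :
    pairCLM m C hm A = ∑' n, m n * A n := rfl

theorem Ell1.memlp_two_mul (A : Ell1) {m : Idx → ℂ} {C : ℝ} (hm : ∀ n, ‖m n‖ ≤ C) :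
    Memℓp (fun n => m n * A n) 2 :=
  (memlp_one_iff.2 (A.summable_mul hm)).of_exponent_ge (by norm_num)

/-- ℓ¹ embeds in ℓ² with norm one, because a sum of squares of nonnegative numbers is at most the
square of their sum. This is how estimates made in ℓ¹ yield estimates in l^{2,s}. -/
theorem norm_two_le {B : Ell2} {c : Idx → ℂ} (hB : ∀ n, B n = c n)
    (hc : Summable fun n => ‖c n‖) : ‖B‖ ≤ ∑' n, ‖c n‖ := by
  have h0 : 0 ≤ ∑' n, ‖c n‖ := tsum_nonneg fun _ => norm_nonneg _
  refine lp.norm_le_of_forall_sum_le (by simp) h0 fun s => ?_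
  have h1 : ∑ n ∈ s, ‖c n‖ ≤ ∑' n, ‖c n‖ := hc.sum_le_tsum s fun _ _ => norm_nonneg _
  simp only [ENNReal.toReal_ofNat, Real.rpow_ofNat, hB]
  calc ∑ n ∈ s, ‖c n‖ ^ 2 ≤ (∑ n ∈ s, ‖c n‖) ^ 2 :=
        Finset.sum_sq_le_sq_sum_of_nonneg fun _ _ => norm_nonneg _
    _ ≤ _ := by gcongr

/-- Multiplication by a bounded family, as a map from `ℓ¹` to `ℓ²`. -/
def mulCLM₂ (m : Idx → ℂ) (C : ℝ) (hm : ∀ n, ‖m n‖ ≤ C) : Ell1 →L[ℂ] Ell2 :=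
  LinearMap.mkContinuous
    { toFun := fun A => ⟨fun n => m n * A n, A.memlp_two_mul hm⟩
      map_add' := fun A B => by
        ext n
        simp only [lp.coeFn_add, Pi.add_apply, mul_add]
      map_smul' := fun c A => by
        ext n
        simp only [lp.coeFn_smul, Pi.smul_apply, RingHom.id_apply, smul_eq_mul]
        ring } C fun A => by
    refine (norm_two_le (c := fun n => m n * A n) (fun n => rfl) (A.summable_mul hm)).trans ?_
    rw [A.norm_eq, ← tsum_mul_left]
    refine (A.summable_mul hm).tsum_le_tsum (fun n => ?_) (A.summable.mul_left C)
    rw [norm_mul]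
    exact mul_le_mul_of_nonneg_right (hm n) (norm_nonneg _)

theorem mulCLM₂_apply (m : Idx → ℂ) (C : ℝ) (hm : ∀ n, ‖m n‖ ≤ C) (A : Ell1) (n : Idx) :
    mulCLM₂ m C hm A n = m n * A n := rfl

theorem norm_mulCLM₂_le (m : Idx → ℂ) (C : ℝ) (hm : ∀ n, ‖m n‖ ≤ C) (A : Ell1) :
    ‖mulCLM₂ m C hm A‖ ≤ C * ‖A‖ :=
  (mulCLM₂ m C hm).le_of_opNorm_le
    (LinearMap.mkContinuous_norm_le _ ((norm_nonneg _).trans (hm 0)) _) A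

/-! ### Trilinear convolutions -/

/-- The convolution `∑_{n₁ - n₂ + n₃ = n} K(n₁, n₂, n₃) A(n₁) conj(B(n₂)) C(n₃)`. -/
def triple (K : Idx → Idx → Idx → ℂ) (A B C : Idx → ℂ) (n : Idx) : ℂ :=
  ∑' p : Idx × Idx, K p.1 p.2 (n - p.1 + p.2) * (A p.1 * star (B p.2) * C (n - p.1 + p.2))

/-- Triples of indices, listed by `n₁ - n₂ + n₃` and the first two entries. -/
def tripleEquiv : Idx × (Idx × Idx) ≃ Idx × (Idx × Idx) where
  toFun q := (q.2.1, q.2.2, q.1 - q.2.1 + q.2.2)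
  invFun q := (q.1 - q.2.1 + q.2.2, q.1, q.2.1)
  left_inv q := by ext <;> simp
  right_inv q := by
    have : q.1 - q.2.1 + q.2.2 - q.1 + q.2.1 = q.2.2 := by abel
    simp only [this]

section triple

variable {A B C : Idx → ℂ} {K : Idx → Idx → Idx → ℂ} {k : ℝ}

theorem summable_cube (hA : Summable fun n => ‖A n‖) (hB : Summable fun n => ‖B n‖)
    (hC : Summable fun n => ‖C n‖) :
    Summable fun q : Idx × (Idx × Idx) => ‖A q.1‖ * (‖B q.2.1‖ * ‖C q.2.2‖) :=
  hA.mul_of_nonneg (hB.mul_of_nonneg hC (fun _ => norm_nonneg _) fun _ => norm_nonneg _)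
    (fun _ => norm_nonneg _) fun _ => by positivity

theorem tsum_cube (hA : Summable fun n => ‖A n‖) (hB : Summable fun n => ‖B n‖)
    (hC : Summable fun n => ‖C n‖) :
    ∑' q : Idx × (Idx × Idx), ‖A q.1‖ * (‖B q.2.1‖ * ‖C q.2.2‖) =
      (∑' n, ‖A n‖) * ((∑' n, ‖B n‖) * ∑' n, ‖C n‖) := by
  have hBC : Summable fun q : Idx × Idx => ‖B q.1‖ * ‖C q.2‖ :=
    hB.mul_of_nonneg hC (fun _ => norm_nonneg _) fun _ => norm_nonneg _
  rw [hB.tsum_mul_tsum hC hBC, hA.tsum_mul_tsum hBC (summable_cube hA hB hC)]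

theorem norm_cube_eq (q : Idx × (Idx × Idx)) :
    ‖K q.1 q.2.1 q.2.2 * (A q.1 * star (B q.2.1) * C q.2.2)‖ =
      ‖K q.1 q.2.1 q.2.2‖ * (‖A q.1‖ * (‖B q.2.1‖ * ‖C q.2.2‖)) := by
  simp only [norm_mul, norm_star]; ring

theorem summable_kernel (hK : ∀ n₁ n₂ n₃, ‖K n₁ n₂ n₃‖ ≤ k) (hA : Summable fun n => ‖A n‖)
    (hB : Summable fun n => ‖B n‖) (hC : Summable fun n => ‖C n‖) :
    Summable fun q : Idx × (Idx × Idx) =>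
      ‖K q.1 q.2.1 q.2.2 * (A q.1 * star (B q.2.1) * C q.2.2)‖ := by
  refine Summable.of_nonneg_of_le (fun _ => norm_nonneg _) (fun q => ?_)
    ((summable_cube hA hB hC).mul_left k)
  rw [norm_cube_eq]
  exact mul_le_mul_of_nonneg_right (hK _ _ _) (by positivity)

/-- The same family, reindexed by `tripleEquiv` so that the output index comes first. The fibre over
n is then the series that defines `triple` at n. -/
theorem summable_kernel' (hK : ∀ n₁ n₂ n₃, ‖K n₁ n₂ n₃‖ ≤ k) (hA : Summable fun n => ‖A n‖)
    (hB : Summable fun n => ‖B n‖) (hC : Summable fun n => ‖C n‖) :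
    Summable fun q : Idx × (Idx × Idx) =>
      ‖K q.2.1 q.2.2 (q.1 - q.2.1 + q.2.2) *
        (A q.2.1 * star (B q.2.2) * C (q.1 - q.2.1 + q.2.2))‖ :=
  (tripleEquiv.summable_iff (f := fun q : Idx × (Idx × Idx) =>
      ‖K q.1 q.2.1 q.2.2 * (A q.1 * star (B q.2.1) * C q.2.2)‖)).2 (summable_kernel hK hA hB hC)

theorem summable_triple_inner (hK : ∀ n₁ n₂ n₃, ‖K n₁ n₂ n₃‖ ≤ k)
    (hA : Summable fun n => ‖A n‖) (hB : Summable fun n => ‖B n‖)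
    (hC : Summable fun n => ‖C n‖) (n : Idx) :
    Summable fun p : Idx × Idx =>
      ‖K p.1 p.2 (n - p.1 + p.2) * (A p.1 * star (B p.2) * C (n - p.1 + p.2))‖ :=
  (summable_kernel' hK hA hB hC).prod_factor n

/-- The modulus of the kernel stays under the sum. The continuity in time needs this: there the
kernel is a difference that tends to zero pointwise but not uniformly. -/
theorem sum_norm_triple_le (hK : ∀ n₁ n₂ n₃, ‖K n₁ n₂ n₃‖ ≤ k)
    (hA : Summable fun n => ‖A n‖) (hB : Summable fun n => ‖B n‖)
    (hC : Summable fun n => ‖C n‖) :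
    (Summable fun n => ‖triple K A B C n‖) ∧ ∑' n, ‖triple K A B C n‖ ≤
      ∑' q : Idx × (Idx × Idx), ‖K q.1 q.2.1 q.2.2‖ * (‖A q.1‖ * (‖B q.2.1‖ * ‖C q.2.2‖)) := by
  have h := summable_kernel' hK hA hB hC
  have h1 := h.prod
  have h2 : ∀ n, ‖triple K A B C n‖ ≤ ∑' p : Idx × Idx,
      ‖K p.1 p.2 (n - p.1 + p.2) * (A p.1 * star (B p.2) * C (n - p.1 + p.2))‖ := fun n =>
    norm_tsum_le_tsum_norm (summable_triple_inner hK hA hB hC n)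
  have h3 : Summable fun n => ‖triple K A B C n‖ :=
    Summable.of_nonneg_of_le (fun _ => norm_nonneg _) h2 h1
  refine ⟨h3, (h3.tsum_le_tsum h2 h1).trans ?_⟩
  rw [← h.tsum_prod]
  simp only [← norm_cube_eq]
  exact (tripleEquiv.tsum_eq (fun q : Idx × (Idx × Idx) =>
    ‖K q.1 q.2.1 q.2.2 * (A q.1 * star (B q.2.1) * C q.2.2)‖)).le

theorem tsum_norm_triple_le (hK : ∀ n₁ n₂ n₃, ‖K n₁ n₂ n₃‖ ≤ k)
    (hA : Summable fun n => ‖A n‖) (hB : Summable fun n => ‖B n‖)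
    (hC : Summable fun n => ‖C n‖) :
    ∑' n, ‖triple K A B C n‖ ≤ k * ((∑' n, ‖A n‖) * ((∑' n, ‖B n‖) * ∑' n, ‖C n‖)) := by
  refine (sum_norm_triple_le hK hA hB hC).2.trans ?_
  rw [← tsum_cube hA hB hC, ← tsum_mul_left]
  refine Summable.tsum_le_tsum (fun q => mul_le_mul_of_nonneg_right (hK _ _ _) (by positivity)) ?_
    ((summable_cube hA hB hC).mul_left k)
  simpa only [← norm_cube_eq] using summable_kernel hK hA hB hC

/-- Fubini undoes the convolution. It serves twice: with g the evolved Dirac masses, to expand the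
cube of a wave, and with g the indicator of one index, to write the convolution of a finite family
as a finite sum. -/
theorem tsum_triple_mul (hK : ∀ n₁ n₂ n₃, ‖K n₁ n₂ n₃‖ ≤ k)
    (hA : Summable fun n => ‖A n‖) (hB : Summable fun n => ‖B n‖)
    (hC : Summable fun n => ‖C n‖) {g : Idx → ℂ} {G : ℝ} (hg : ∀ n, ‖g n‖ ≤ G) :
    ∑' n, triple K A B C n * g n = ∑' q : Idx × (Idx × Idx),
      K q.1 q.2.1 q.2.2 * g (q.1 - q.2.1 + q.2.2) * (A q.1 * star (B q.2.1) * C q.2.2) := by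
  have hK' : ∀ n₁ n₂ n₃, ‖K n₁ n₂ n₃ * g (n₁ - n₂ + n₃)‖ ≤ k * G := fun n₁ n₂ n₃ => by
    rw [norm_mul]
    exact mul_le_mul (hK _ _ _) (hg _) (norm_nonneg _) ((norm_nonneg _).trans (hK 0 0 0))
  have h := (summable_kernel' hK' hA hB hC).of_norm
  rw [← tripleEquiv.tsum_eq]
  refine Eq.trans ?_ (h.tsum_prod).symm
  refine tsum_congr fun n => ?_
  rw [triple, ← tsum_mul_right]
  refine tsum_congr fun p => ?_
  have : p.1 - p.2 + (n - p.1 + p.2) = n := by abel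
  simp only [this]
  ring

theorem triple_sub_kernel {K' : Idx → Idx → Idx → ℂ} (hK : ∀ n₁ n₂ n₃, ‖K n₁ n₂ n₃‖ ≤ k)
    (hK' : ∀ n₁ n₂ n₃, ‖K' n₁ n₂ n₃‖ ≤ k) (hA : Summable fun n => ‖A n‖)
    (hB : Summable fun n => ‖B n‖) (hC : Summable fun n => ‖C n‖) (n : Idx) :
    triple K A B C n - triple K' A B C n =
      triple (fun n₁ n₂ n₃ => K n₁ n₂ n₃ - K' n₁ n₂ n₃) A B C n := by
  rw [triple, triple, triple, ← (summable_triple_inner hK hA hB hC n).of_norm.tsum_sub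
    (summable_triple_inner hK' hA hB hC n).of_norm]
  exact tsum_congr fun p => by ring

/-- Telescoping, one slot at a time. -/
theorem triple_sub_triple {A' : Idx → ℂ} (hK : ∀ n₁ n₂ n₃, ‖K n₁ n₂ n₃‖ ≤ k)
    (hA : Summable fun n => ‖A n‖) (hA' : Summable fun n => ‖A' n‖) (n : Idx) :
    triple K A A A n - triple K A' A' A' n =
      triple K (fun n => A n - A' n) A A n + triple K A' (fun n => A n - A' n) A n +
        triple K A' A' (fun n => A n - A' n) n := by
  have hD : Summable fun n => ‖A n - A' n‖ :=
    Summable.of_nonneg_of_le (fun _ => norm_nonneg _) (fun _ => norm_sub_le _ _) (hA.add hA')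
  simp only [triple]
  rw [← (summable_triple_inner hK hA hA hA n).of_norm.tsum_sub
      (summable_triple_inner hK hA' hA' hA' n).of_norm,
    ← (summable_triple_inner hK hD hA hA n).of_norm.tsum_add
      (summable_triple_inner hK hA' hD hA n).of_norm,
    ← ((summable_triple_inner hK hD hA hA n).of_norm.add
      (summable_triple_inner hK hA' hD hA n).of_norm).tsum_add
      (summable_triple_inner hK hA' hA' hD n).of_norm]
  refine tsum_congr fun p => ?_
  simp only [star_sub]
  ring

/-- The trilinear convolution is locally Lipschitz on `ℓ¹`. -/
theorem sum_norm_triple_sub_le {A' : Idx → ℂ} (hK : ∀ n₁ n₂ n₃, ‖K n₁ n₂ n₃‖ ≤ 1) {a : ℝ}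
    (hA : Summable fun n => ‖A n‖) (hA' : Summable fun n => ‖A' n‖)
    (ha : ∑' n, ‖A n‖ ≤ a) (ha' : ∑' n, ‖A' n‖ ≤ a) (s : Finset Idx) :
    ∑ n ∈ s, ‖triple K A A A n - triple K A' A' A' n‖ ≤ 3 * a ^ 2 * ∑' n, ‖A n - A' n‖ := by
  have hD : Summable fun n => ‖A n - A' n‖ :=
    Summable.of_nonneg_of_le (fun _ => norm_nonneg _) (fun _ => norm_sub_le _ _) (hA.add hA')
  have h1 := sum_norm_triple_le hK hD hA hA
  have h2 := sum_norm_triple_le hK hA' hD hA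
  have h3 := sum_norm_triple_le hK hA' hA' hD
  have b1 := tsum_norm_triple_le hK hD hA hA
  have b2 := tsum_norm_triple_le hK hA' hD hA
  have b3 := tsum_norm_triple_le hK hA' hA' hD
  have s1 := h1.1.sum_le_tsum s fun _ _ => norm_nonneg _
  have s2 := h2.1.sum_le_tsum s fun _ _ => norm_nonneg _
  have s3 := h3.1.sum_le_tsum s fun _ _ => norm_nonneg _
  have hA0 : 0 ≤ ∑' n, ‖A n‖ := tsum_nonneg fun _ => norm_nonneg _
  have hA0' : 0 ≤ ∑' n, ‖A' n‖ := tsum_nonneg fun _ => norm_nonneg _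
  have hD0 : 0 ≤ ∑' n, ‖A n - A' n‖ := tsum_nonneg fun _ => norm_nonneg _
  have hle : ∑ n ∈ s, ‖triple K A A A n - triple K A' A' A' n‖ ≤
      ∑ n ∈ s, ‖triple K (fun n => A n - A' n) A A n‖ +
      ∑ n ∈ s, ‖triple K A' (fun n => A n - A' n) A n‖ +
      ∑ n ∈ s, ‖triple K A' A' (fun n => A n - A' n) n‖ := by
    rw [← Finset.sum_add_distrib, ← Finset.sum_add_distrib]
    refine Finset.sum_le_sum fun n _ => ?_
    rw [triple_sub_triple hK hA hA']
    exact norm_add₃_le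
  have ha0 : 0 ≤ a := hA0.trans ha
  have c1 : (∑' n, ‖A n - A' n‖) * ((∑' n, ‖A n‖) * ∑' n, ‖A n‖) ≤
      (∑' n, ‖A n - A' n‖) * (a * a) := by gcongr
  have c2 : (∑' n, ‖A' n‖) * ((∑' n, ‖A n - A' n‖) * ∑' n, ‖A n‖) ≤
      a * ((∑' n, ‖A n - A' n‖) * a) := by gcongr
  have c3 : (∑' n, ‖A' n‖) * ((∑' n, ‖A' n‖) * ∑' n, ‖A n - A' n‖) ≤
      a * (a * ∑' n, ‖A n - A' n‖) := by gcongr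
  nlinarith

end triple

/-! ### Superpositions of evolved Dirac masses and their cubic interaction -/

theorem pt_interaction (a b : ℝ) (n₁ n₂ n₃ : Idx) :
    pt a b (n₁ - n₂ + n₃) = pt a b n₁ - pt a b n₂ + pt a b n₃ := by
  simp only [pt, Prod.fst_add, Prod.fst_sub, Prod.snd_add, Prod.snd_sub]
  push_cast
  ring

/-- A coincidence of two points makes an integer multiple of a/b an integer. This is how
irrationality enters the proof: distinct indices give distinct points, which excludes all resonances
but the trivial ones and lets single coefficients be recovered from a solution. -/
theorem pt_injective {a b : ℝ} (hb : b ≠ 0) (hab : Irrational (a / b)) :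
    Function.Injective (pt a b) := by
  intro m n h
  simp only [pt] at h
  have h1 : a / b * ((m.1 - n.1 : ℤ) : ℝ) = ((n.2 - m.2 : ℤ) : ℝ) := by
    push_cast
    field_simp
    linarith
  have h2 : m.1 - n.1 = 0 := by
    by_contra h0
    exact (hab.mul_intCast h0).ne_int _ h1
  have h3 : n.2 - m.2 = 0 := by
    rw [h2, Int.cast_zero, mul_zero] at h1
    exact_mod_cast h1.symm
  exact Prod.ext (by omega) (by omega)

/-- The interaction phase of three evolved Dirac masses, as a function of `r = 1 / t`. -/
def phase (a b r : ℝ) (n₁ n₂ n₃ : Idx) : ℂ :=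
  Complex.exp (Complex.I * ((r * ((pt a b n₁ ^ 2 - pt a b n₂ ^ 2 + pt a b n₃ ^ 2 -
    pt a b (n₁ - n₂ + n₃) ^ 2) / 4) : ℝ) : ℂ))

theorem norm_phase_le (a b r : ℝ) (n₁ n₂ n₃ : Idx) : ‖phase a b r n₁ n₂ n₃‖ ≤ 1 := by
  rw [phase, mul_comm, Complex.norm_exp_ofReal_mul_I]

theorem norm_root (t : ℝ) :
    ‖(4 * Real.pi * Complex.I * t : ℂ) ^ (1 / 2 : ℂ)‖ ^ 2 = 4 * Real.pi * |t| := by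
  rw [← norm_pow, ← Complex.cpow_nat_mul]
  simp [abs_of_pos Real.pi_pos]

theorem root_ne_zero {t : ℝ} (ht : t ≠ 0) :
    (4 * Real.pi * Complex.I * t : ℂ) ^ (1 / 2 : ℂ) ≠ 0 := by
  intro h
  have := norm_root t
  rw [h] at this
  simp [ht, Real.pi_ne_zero] at this

theorem norm_evolvedDirac (t y x : ℝ) :
    ‖evolvedDirac t y x‖ = 1 / Real.sqrt (4 * Real.pi * |t|) := by
  rw [evolvedDirac, norm_div, mul_comm Complex.I, Complex.norm_exp_ofReal_mul_I, ← norm_root,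
    Real.sqrt_sq (norm_nonneg _)]

/-- The complex root meets its own conjugate, so only its modulus survives: no branch enters, and
both signs of t are covered. -/
theorem evolvedDirac_mul_star (t y z x : ℝ) : evolvedDirac t y x * star (evolvedDirac t z x) =
    ((1 / (4 * Real.pi * |t|) : ℝ) : ℂ) *
      Complex.exp (Complex.I * (((x - y) ^ 2 - (x - z) ^ 2) / (4 * t) : ℝ)) := by
  have h : ((4 * Real.pi * Complex.I * t : ℂ) ^ (1 / 2 : ℂ)) *
      star ((4 * Real.pi * Complex.I * t : ℂ) ^ (1 / 2 : ℂ)) = ((4 * Real.pi * |t| : ℝ) : ℂ) := by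
    rw [← norm_root, Complex.star_def, Complex.mul_conj, Complex.normSq_eq_norm_sq]
  rw [evolvedDirac, evolvedDirac, star_div₀, div_mul_div_comm, h, Complex.star_def,
    ← Complex.exp_conj, ← Complex.exp_add]
  rw [map_mul, Complex.conj_I, Complex.conj_ofReal, one_div, Complex.ofReal_inv, div_eq_inv_mul]
  congr 2
  push_cast
  ring

/-- The signed sum of the three quadratic phases has leading term x² and linear coefficient
-2(x₁-x₂+x₃). Completing the square leaves a constant, which is the exponent of `phase`. -/
theorem evolvedDirac_interaction (a b t x : ℝ) (n₁ n₂ n₃ : Idx) :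
    evolvedDirac t (pt a b n₁) x * star (evolvedDirac t (pt a b n₂) x) *
      evolvedDirac t (pt a b n₃) x = ((1 / (4 * Real.pi * |t|) : ℝ) : ℂ) *
        (phase a b (1 / t) n₁ n₂ n₃ * evolvedDirac t (pt a b (n₁ - n₂ + n₃)) x) := by
  have h : Complex.exp (Complex.I *
        (((x - pt a b n₁) ^ 2 - (x - pt a b n₂) ^ 2) / (4 * t) : ℝ)) *
      Complex.exp (Complex.I * ((x - pt a b n₃) ^ 2 / (4 * t) : ℝ)) = phase a b (1 / t) n₁ n₂ n₃ *
      Complex.exp (Complex.I * ((x - pt a b (n₁ - n₂ + n₃)) ^ 2 / (4 * t) : ℝ)) := by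
    rw [phase, ← Complex.exp_add, ← Complex.exp_add, pt_interaction]
    congr 1
    push_cast
    ring
  rw [evolvedDirac_mul_star, evolvedDirac, evolvedDirac]
  linear_combination ((1 / (4 * Real.pi * |t|) : ℝ) : ℂ) /
    (4 * Real.pi * Complex.I * t : ℂ) ^ (1 / 2 : ℂ) * h

/-- The function `∑ Aₙ e^{itΔ} δ_{xₙ}`. -/
def wave (a b : ℝ) (A : Idx → ℂ) (t x : ℝ) : ℂ := ∑' n, A n * evolvedDirac t (pt a b n) x

/-- The nonlinear interaction `∑_{n₁ - n₂ + n₃ = n}` of the coefficients. -/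
def cubic (a b r : ℝ) (A : Idx → ℂ) : Idx → ℂ := triple (phase a b r) A A A

theorem summable_mul_evolvedDirac {A : Idx → ℂ} (hA : Summable fun n => ‖A n‖) (a b t x : ℝ) :
    Summable fun n => ‖A n * evolvedDirac t (pt a b n) x‖ := by
  simp only [norm_mul, norm_evolvedDirac]
  exact hA.mul_right _

theorem norm_wave_le {A : Idx → ℂ} (hA : Summable fun n => ‖A n‖) (a b t x : ℝ) :
    ‖wave a b A t x‖ ≤ (∑' n, ‖A n‖) / Real.sqrt (4 * Real.pi * |t|) := by
  refine (norm_tsum_le_tsum_norm (summable_mul_evolvedDirac hA a b t x)).trans (le_of_eq ?_)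
  simp only [norm_mul, norm_evolvedDirac]
  rw [tsum_mul_right, mul_one_div]

theorem summable_cubic {A : Idx → ℂ} (hA : Summable fun n => ‖A n‖) (a b r : ℝ) :
    Summable fun n => ‖cubic a b r A n‖ :=
  (sum_norm_triple_le (norm_phase_le a b r) hA hA hA).1

/-- Absolute convergence allows the product of three series to be expanded over triples, each of
which is again an evolved Dirac mass. -/
theorem cubic_wave {A : Idx → ℂ} (hA : Summable fun n => ‖A n‖) (a b t x : ℝ) :
    ((‖wave a b A t x‖ ^ 2 : ℝ) : ℂ) * wave a b A t x =
      ((1 / (4 * Real.pi * |t|) : ℝ) : ℂ) * wave a b (cubic a b (1 / t) A) t x := by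
  have h1 := summable_mul_evolvedDirac hA a b t x
  have h2 : Summable fun n => ‖star (A n * evolvedDirac t (pt a b n) x)‖ := by simpa using h1
  have hz : ((‖wave a b A t x‖ ^ 2 : ℝ) : ℂ) * wave a b A t x =
      wave a b A t x * (star (wave a b A t x) * wave a b A t x) := by
    rw [← mul_assoc, Complex.star_def, Complex.mul_conj, Complex.normSq_eq_norm_sq]
  rw [hz, wave, tsum_star, tsum_mul_tsum_of_summable_norm h2 h1,
    tsum_mul_tsum_of_summable_norm h1 (h2.mul_norm h1), wave, cubic,
    tsum_triple_mul (norm_phase_le a b (1 / t)) hA hA hA (fun n => (norm_evolvedDirac t _ x).le),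
    ← tsum_mul_left]
  refine tsum_congr fun q => ?_
  have := evolvedDirac_interaction a b t x q.1 q.2.1 q.2.2
  simp only [star_mul']
  linear_combination (A q.1 * star (A q.2.1) * A q.2.2) * this

theorem cubic_sub_le {A A' : Idx → ℂ} {c : ℝ} (a b r : ℝ) (hA : Summable fun n => ‖A n‖)
    (hA' : Summable fun n => ‖A' n‖) (h : ∑' n, ‖A n‖ ≤ c) (h' : ∑' n, ‖A' n‖ ≤ c)
    (s : Finset Idx) :
    ∑ n ∈ s, ‖cubic a b r A n - cubic a b r A' n‖ ≤ 3 * c ^ 2 * ∑' n, ‖A n - A' n‖ :=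
  sum_norm_triple_sub_le (norm_phase_le a b r) hA hA' h h' s

/-- The right-hand side of the equation for the coefficients. -/
def force (a b σ M t : ℝ) (A : Idx → ℂ) (n : Idx) : ℂ :=
  Complex.I * ((σ / (8 * Real.pi * |t|) : ℝ) : ℂ) * (cubic a b (1 / t) A n - 2 * (M : ℂ) * A n)

theorem norm_force_factor {σ : ℝ} (hσ : σ = 1 ∨ σ = -1) (t : ℝ) :
    ‖Complex.I * ((σ / (8 * Real.pi * |t|) : ℝ) : ℂ)‖ = 1 / (8 * Real.pi * |t|) := by
  have h : |σ| = 1 := by rcases hσ with rfl | rfl <;> simp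
  rw [norm_mul, Complex.norm_I, one_mul, Complex.norm_real, Real.norm_eq_abs, abs_div, h,
    abs_of_nonneg (by positivity : 0 ≤ 8 * Real.pi * |t|)]

theorem summable_force {A : Idx → ℂ} (hA : Summable fun n => ‖A n‖) (a b σ M t : ℝ) :
    Summable fun n => ‖force a b σ M t A n‖ := by
  have h : Summable fun n => ‖cubic a b (1 / t) A n - 2 * (M : ℂ) * A n‖ := by
    refine Summable.of_nonneg_of_le (fun _ => norm_nonneg _) (fun _ => norm_sub_le _ _)
      ((summable_cubic hA a b (1 / t)).add ?_)
    simp only [norm_mul]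
    exact hA.mul_left _
  simp only [force, norm_mul] at h ⊢
  exact h.mul_left _

/-- The Lipschitz constant is of order 1/|t|, which is not integrable at 0. What saves both
existence and uniqueness is its small numerator, to be compared with the exponent γ. -/
theorem force_sub_le {σ : ℝ} (hσ : σ = 1 ∨ σ = -1) {A A' : Idx → ℂ} {c M : ℝ} (a b t : ℝ)
    (hA : Summable fun n => ‖A n‖) (hA' : Summable fun n => ‖A' n‖) (h : ∑' n, ‖A n‖ ≤ c)
    (h' : ∑' n, ‖A' n‖ ≤ c) (hM : 0 ≤ M) (s : Finset Idx) :
    ∑ n ∈ s, ‖force a b σ M t A n - force a b σ M t A' n‖ ≤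
      (3 * c ^ 2 + 2 * M) / (8 * Real.pi * |t|) * ∑' n, ‖A n - A' n‖ := by
  have hD : Summable fun n => ‖A n - A' n‖ :=
    Summable.of_nonneg_of_le (fun _ => norm_nonneg _) (fun _ => norm_sub_le _ _) (hA.add hA')
  have h1 := cubic_sub_le a b (1 / t) hA hA' h h' s
  have h2 := hD.sum_le_tsum s fun _ _ => norm_nonneg _
  have h3 : ∀ n, ‖force a b σ M t A n - force a b σ M t A' n‖ ≤ 1 / (8 * Real.pi * |t|) *
      (‖cubic a b (1 / t) A n - cubic a b (1 / t) A' n‖ + 2 * M * ‖A n - A' n‖) := fun n => by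
    rw [force, force, ← mul_sub, norm_mul, norm_force_factor hσ]
    refine mul_le_mul_of_nonneg_left ?_ (by positivity)
    have : cubic a b (1 / t) A n - 2 * (M : ℂ) * A n - (cubic a b (1 / t) A' n - 2 * (M : ℂ) * A' n)
        = (cubic a b (1 / t) A n - cubic a b (1 / t) A' n) - 2 * (M : ℂ) * (A n - A' n) := by ring
    rw [this]
    refine (norm_sub_le _ _).trans (le_of_eq ?_)
    simp [abs_of_nonneg hM]
  refine (Finset.sum_le_sum fun n _ => h3 n).trans ?_
  rw [← Finset.mul_sum, Finset.sum_add_distrib, ← Finset.mul_sum]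
  calc _ ≤ 1 / (8 * Real.pi * |t|) * (3 * c ^ 2 * ∑' n, ‖A n - A' n‖ +
        2 * M * ∑' n, ‖A n - A' n‖) := by gcongr
    _ = _ := by ring

theorem tsum_norm_force_le {σ : ℝ} (hσ : σ = 1 ∨ σ = -1) {A : Idx → ℂ} {c M : ℝ} (a b t : ℝ)
    (hA : Summable fun n => ‖A n‖) (h : ∑' n, ‖A n‖ ≤ c) (hM : 0 ≤ M) :
    ∑' n, ‖force a b σ M t A n‖ ≤ (3 * c ^ 2 + 2 * M) * c / (8 * Real.pi * |t|) := by
  have h0 : ∀ n, force a b σ M t (fun _ => 0) n = 0 := fun n => by simp [force, cubic, triple]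
  have hc : 0 ≤ c := (tsum_nonneg fun _ => norm_nonneg _).trans h
  refine Real.tsum_le_of_sum_le (fun _ => norm_nonneg _) fun s => ?_
  have := force_sub_le hσ (M := M) a b t hA (A' := fun _ => 0) (by simp [summable_zero]) h
    (by simpa using hc) hM s
  simp only [h0, sub_zero] at this
  refine this.trans ?_
  rw [mul_div_right_comm]
  gcongr

/-! ### A singular integral equation in a Banach space -/

section singular

variable {X : Type*} [NormedAddCommGroup X] [NormedSpace ℝ X]

theorem integral_rpow_sub_one {γ t : ℝ} (hγ : 0 < γ) : ∫ τ in (0 : ℝ)..t, τ ^ (γ - 1) = t ^ γ / γ := by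
  rw [integral_rpow (Or.inl (by linarith))]
  simp [Real.zero_rpow hγ.ne']

/-- A function that is continuous on `(0, T]` and bounded by `C τ^{γ - 1}` is integrable. -/
theorem integrableOn_of_le_rpow {X : Type*} [NormedAddCommGroup X] {T γ C : ℝ} (hγ : 0 < γ) {f : ℝ → X}
    (hf : ContinuousOn f (Ioc 0 T)) (hb : ∀ τ ∈ Ioc 0 T, ‖f τ‖ ≤ C * τ ^ (γ - 1)) :
    IntegrableOn f (Ioc 0 T) := by
  have h1 : IntervalIntegrable (fun τ : ℝ => C * τ ^ (γ - 1)) volume 0 T :=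
    (intervalIntegral.intervalIntegrable_rpow' (by linarith)).const_mul C
  refine Integrable.mono' (g := fun τ : ℝ => C * τ ^ (γ - 1)) h1.1
    (hf.aestronglyMeasurable measurableSet_Ioc) ?_
  filter_upwards [ae_restrict_mem measurableSet_Ioc] with τ hτ using hb τ hτ

theorem norm_integral_le_rpow {T γ C t : ℝ} (hγ : 0 < γ) {f : ℝ → X} (ht : t ∈ Ioc 0 T)
    (hb : ∀ τ ∈ Ioc 0 T, ‖f τ‖ ≤ C * τ ^ (γ - 1)) :
    ‖∫ τ in (0 : ℝ)..t, f τ‖ ≤ C * (t ^ γ / γ) := by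
  rw [← integral_rpow_sub_one hγ, ← intervalIntegral.integral_const_mul]
  refine intervalIntegral.norm_integral_le_of_norm_le ht.1.le ?_
    ((intervalIntegral.intervalIntegrable_rpow' (by linarith)).const_mul C)
  exact Eventually.of_forall fun τ hτ => hb τ ⟨hτ.1, hτ.2.trans ht.2⟩

open scoped BoundedContinuousFunction

theorem continuousOn_integrand {T γ : ℝ} {H : ℝ → X → X}
    (hH : ContinuousOn (fun p : ℝ × X => H p.1 p.2) (Ioi 0 ×ˢ univ)) (ρ : ℝ →ᵇ X) :
    ContinuousOn (fun τ : ℝ => τ⁻¹ • H τ (τ ^ γ • ρ (Real.log τ))) (Ioc 0 T) := by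
  have h0 : ∀ τ ∈ Ioc 0 T, τ ≠ 0 := fun τ hτ => hτ.1.ne'
  refine (continuousOn_id.inv₀ h0).smul ?_
  refine hH.comp (f := fun τ : ℝ => (τ, τ ^ γ • ρ (Real.log τ))) (continuousOn_id.prodMk ?_)
    fun τ hτ => ⟨hτ.1, mem_univ _⟩
  refine (ContinuousOn.rpow_const continuousOn_id fun τ hτ => Or.inl (h0 τ hτ)).smul ?_
  exact ρ.continuous.comp_continuousOn (Real.continuousOn_log.mono fun τ hτ => h0 τ hτ)

theorem norm_scaled_le {γ τ : ℝ} (hτ : 0 < τ) (x : X) : ‖τ ^ γ • x‖ = τ ^ γ * ‖x‖ := by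
  rw [norm_smul, Real.norm_of_nonneg (by positivity)]

/-- In the unknown rescaled by τ^γ, the singular factor 1/τ becomes τ^{γ-1}, which is integrable at
0. -/
theorem norm_integrand_sub_le {T γ k c : ℝ} {H : ℝ → X → X}
    (hL : ∀ t > 0, ∀ x y, ‖x‖ ≤ c → ‖y‖ ≤ c → ‖H t x - H t y‖ ≤ k * ‖x - y‖) (hT : T ^ γ ≤ c)
    (hγ : 0 < γ) {τ : ℝ} (hτ : τ ∈ Ioc 0 T) {x y : X} (hx : ‖x‖ ≤ 1) (hy : ‖y‖ ≤ 1) :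
    ‖τ⁻¹ • H τ (τ ^ γ • x) - τ⁻¹ • H τ (τ ^ γ • y)‖ ≤ k * ‖x - y‖ * τ ^ (γ - 1) := by
  have hb : ∀ z : X, ‖z‖ ≤ 1 → ‖τ ^ γ • z‖ ≤ c := fun z hz => by
    rw [norm_scaled_le hτ.1]
    calc τ ^ γ * ‖z‖ ≤ τ ^ γ * 1 := by have := hτ.1; gcongr
      _ ≤ T ^ γ := by rw [mul_one]; exact Real.rpow_le_rpow hτ.1.le hτ.2 hγ.le
      _ ≤ c := hT
  rw [← smul_sub, norm_smul, norm_inv, Real.norm_of_nonneg hτ.1.le, Real.rpow_sub_one hτ.1.ne']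
  have h := hL τ hτ.1 _ _ (hb x hx) (hb y hy)
  rw [← smul_sub, norm_scaled_le hτ.1] at h
  calc τ⁻¹ * ‖H τ (τ ^ γ • x) - H τ (τ ^ γ • y)‖ ≤ τ⁻¹ * (k * (τ ^ γ * ‖x - y‖)) :=
        mul_le_mul_of_nonneg_left h (by have := hτ.1; positivity)
    _ = _ := by rw [div_eq_inv_mul]; ring

/-- A contraction argument for `R(t) = S(t) + ∫₀ᵗ H(τ, R(τ)) dτ / τ`. -/
theorem exists_singular_solution [CompleteSpace X] {γ k c C : ℝ} (hγ : 0 < γ) (hγ' : γ < 1)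
    (hk : k ≤ γ / 2) (hk0 : 0 ≤ k) (hc : 0 < c) (hC : 0 ≤ C) {H : ℝ → X → X} {S : ℝ → X}
    (hH : ContinuousOn (fun p : ℝ × X => H p.1 p.2) (Ioi 0 ×ˢ univ)) (hH0 : ∀ t, H t 0 = 0)
    (hL : ∀ t > 0, ∀ x y, ‖x‖ ≤ c → ‖y‖ ≤ c → ‖H t x - H t y‖ ≤ k * ‖x - y‖)
    (hS : ContinuousOn S (Ioi 0)) (hSb : ∀ t > 0, ‖S t‖ ≤ C * t) :
    ∃ T > 0, ∃ R : ℝ → X, ContinuousOn R (Ioc 0 T) ∧ (∀ t ∈ Ioc 0 T, ‖R t‖ ≤ t ^ γ) ∧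
      (∀ t ∈ Ioc 0 T, ‖R t‖ ≤ c) ∧
      (∀ t ∈ Ioc 0 T, ‖H t (R t)‖ ≤ k * t ^ γ) ∧
      ∀ t ∈ Ioc 0 T, IntegrableOn (fun τ => τ⁻¹ • H τ (R τ)) (Ioc 0 T) ∧
        R t = S t + ∫ τ in (0 : ℝ)..t, τ⁻¹ • H τ (R τ) := by
  -- The first condition keeps R = O(t^γ) inside the ball where `H` is Lipschitz. The second makes
  -- the source at most t^γ/2, since C t = C t^{1-γ} t^γ.
  obtain ⟨T, hT0, hTc, hTC⟩ : ∃ T > 0, T ^ γ ≤ c ∧ C * T ^ (1 - γ) ≤ 1 / 2 := by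
    have h1 : Tendsto (fun T : ℝ => T ^ γ) (𝓝[>] 0) (𝓝 0) := by
      have := (Real.continuousAt_rpow_const 0 γ (Or.inr hγ.le)).tendsto
      rw [Real.zero_rpow hγ.ne'] at this
      exact this.mono_left nhdsWithin_le_nhds
    have h2 : Tendsto (fun T : ℝ => C * T ^ (1 - γ)) (𝓝[>] 0) (𝓝 0) := by
      have := (Real.continuousAt_rpow_const 0 (1 - γ) (Or.inr (by linarith))).tendsto.const_mul C
      rw [Real.zero_rpow (by linarith), mul_zero] at this
      exact this.mono_left nhdsWithin_le_nhds
    obtain ⟨T, hT⟩ := ((h1.eventually (ge_mem_nhds hc)).and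
      ((h2.eventually (ge_mem_nhds (by norm_num : (0 : ℝ) < 1 / 2))).and
        self_mem_nhdsWithin)).exists
    exact ⟨T, hT.2.2, hT.1, hT.2.1⟩
  -- The unknown is ρ with R(t) = t^γ ρ(log t). The logarithm moves the singular time 0 to -∞, so
  -- that bounded continuous functions on the whole line form a complete space for the contraction.
  set f : (ℝ →ᵇ X) → ℝ → X := fun ρ τ => τ⁻¹ • H τ (τ ^ γ • ρ (Real.log τ)) with hf
  have hfc : ∀ ρ, ContinuousOn (f ρ) (Ioc 0 T) := fun ρ => continuousOn_integrand hH ρ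
  have hfb : ∀ ρ : ℝ →ᵇ X, ‖ρ‖ ≤ 1 → ∀ τ ∈ Ioc 0 T, ‖f ρ τ‖ ≤ k * τ ^ (γ - 1) := by
    intro ρ hρ τ hτ
    have h1 : ‖ρ (Real.log τ)‖ ≤ 1 := (ρ.norm_coe_le_norm _).trans hρ
    have := norm_integrand_sub_le hL hTc hγ hτ h1 (y := 0) (by simp)
    simp only [smul_zero, hH0, sub_zero] at this
    refine this.trans ?_
    have h3 : (0 : ℝ) ≤ τ ^ (γ - 1) := Real.rpow_nonneg hτ.1.le _
    nlinarith [mul_le_mul_of_nonneg_left h1 hk0, mul_nonneg hk0 h3]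
  have hfi : ∀ ρ : ℝ →ᵇ X, ‖ρ‖ ≤ 1 → IntegrableOn (f ρ) (Ioc 0 T) := fun ρ hρ =>
    integrableOn_of_le_rpow hγ (hfc ρ) (hfb ρ hρ)
  have hfd : ∀ ρ ρ' : ℝ →ᵇ X, ‖ρ‖ ≤ 1 → ‖ρ'‖ ≤ 1 → ∀ τ ∈ Ioc 0 T,
      ‖f ρ τ - f ρ' τ‖ ≤ k * dist ρ ρ' * τ ^ (γ - 1) := by
    intro ρ ρ' hρ hρ' τ hτ
    refine (norm_integrand_sub_le hL hTc hγ hτ ((ρ.norm_coe_le_norm _).trans hρ)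
      ((ρ'.norm_coe_le_norm _).trans hρ')).trans ?_
    have h1 : ‖ρ (Real.log τ) - ρ' (Real.log τ)‖ ≤ dist ρ ρ' := by
      rw [← dist_eq_norm]; exact BoundedContinuousFunction.dist_coe_le_dist _
    have h3 : (0 : ℝ) ≤ τ ^ (γ - 1) := Real.rpow_nonneg hτ.1.le _
    exact mul_le_mul_of_nonneg_right (mul_le_mul_of_nonneg_left h1 hk0) h3
  -- The minimum caps the time at `T`; beyond log T the new function is extended by a constant.
  set m : ℝ → ℝ := fun z => Real.exp (min z (Real.log T)) with hm
  have hmT : ∀ z, m z ∈ Ioc 0 T := fun z => ⟨Real.exp_pos _, by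
    have := Real.exp_le_exp.2 (min_le_right z (Real.log T))
    rwa [Real.exp_log hT0] at this⟩
  have hmc : Continuous m := Real.continuous_exp.comp (continuous_id.min continuous_const)
  set g : (ℝ →ᵇ X) → ℝ → X := fun ρ z => (m z) ^ (-γ) • (S (m z) + ∫ τ in (0 : ℝ)..m z, f ρ τ)
  have hgc : ∀ ρ : ℝ →ᵇ X, ‖ρ‖ ≤ 1 → Continuous (g ρ) := by
    intro ρ hρ
    refine Continuous.smul (hmc.rpow_const fun z => Or.inl (hmT z).1.ne')
      ((hS.comp_continuous hmc fun z => (hmT z).1).add ?_)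
    have h1 : IntegrableOn (f ρ) (uIcc 0 T) := by
      rw [uIcc_of_le hT0.le, integrableOn_Icc_iff_integrableOn_Ioc]; exact hfi ρ hρ
    have h2 := intervalIntegral.continuousOn_primitive_interval h1
    rw [uIcc_of_le hT0.le] at h2
    exact h2.comp_continuous hmc fun z => ⟨(hmT z).1.le, (hmT z).2⟩
  have hgb : ∀ ρ : ℝ →ᵇ X, ‖ρ‖ ≤ 1 → ∀ z, ‖g ρ z‖ ≤ 1 := by
    intro ρ hρ z
    have hz := hmT z
    have h1 := norm_integral_le_rpow hγ hz (hfb ρ hρ)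
    have h2 := hSb _ hz.1
    have h3 : 0 < (m z) ^ γ := Real.rpow_pos_of_pos hz.1 _
    have h4 : C * m z ≤ (1 / 2) * (m z) ^ γ := by
      have e : m z = (m z) ^ (1 - γ) * (m z) ^ γ := by
        rw [← Real.rpow_add hz.1]; simp
      have h5 : (m z) ^ (1 - γ) ≤ T ^ (1 - γ) := Real.rpow_le_rpow hz.1.le hz.2 (by linarith)
      calc C * m z = C * (m z) ^ (1 - γ) * (m z) ^ γ := by rw [mul_assoc, ← e]
        _ ≤ (1 / 2) * (m z) ^ γ :=
          mul_le_mul_of_nonneg_right ((mul_le_mul_of_nonneg_left h5 hC).trans hTC) h3.le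
    have h6 : k * ((m z) ^ γ / γ) ≤ (1 / 2) * (m z) ^ γ := by
      rw [mul_div_assoc', div_le_iff₀ hγ]
      nlinarith [mul_le_mul_of_nonneg_right hk h3.le]
    rw [norm_scaled_le hz.1, Real.rpow_neg hz.1.le, inv_mul_le_iff₀ h3, mul_one]
    refine (norm_add_le _ _).trans ?_
    linarith
  have hgd : ∀ ρ ρ' : ℝ →ᵇ X, ‖ρ‖ ≤ 1 → ‖ρ'‖ ≤ 1 → ∀ z,
      dist (g ρ z) (g ρ' z) ≤ (1 / 2) * dist ρ ρ' := by
    intro ρ ρ' hρ hρ' z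
    have hz := hmT z
    have h3 : 0 < (m z) ^ γ := Real.rpow_pos_of_pos hz.1 _
    have hi : ∀ ρ : ℝ →ᵇ X, ‖ρ‖ ≤ 1 → IntervalIntegrable (f ρ) volume 0 (m z) := fun ρ hρ => by
      rw [intervalIntegrable_iff_integrableOn_Ioc_of_le hz.1.le]
      exact (hfi ρ hρ).mono_set (Ioc_subset_Ioc_right hz.2)
    have h1 := norm_integral_le_rpow (f := fun τ => f ρ τ - f ρ' τ) hγ hz (hfd ρ ρ' hρ hρ')
    rw [dist_eq_norm, ← smul_sub, add_sub_add_left_eq_sub,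
      ← intervalIntegral.integral_sub (hi ρ hρ) (hi ρ' hρ'), norm_scaled_le hz.1,
      Real.rpow_neg hz.1.le, inv_mul_le_iff₀ h3]
    refine h1.trans ?_
    have h0 : 0 ≤ dist ρ ρ' := dist_nonneg
    rw [mul_div_assoc', div_le_iff₀ hγ]
    nlinarith [mul_le_mul_of_nonneg_right hk (mul_nonneg h0 h3.le)]
  -- The value 0 outside the unit ball is never used: the contraction is restricted to that ball.
  set Γ : (ℝ →ᵇ X) → (ℝ →ᵇ X) := fun ρ => if hρ : ‖ρ‖ ≤ 1 then
    BoundedContinuousFunction.ofNormedAddCommGroup (g ρ) (hgc ρ hρ) 1 (hgb ρ hρ) else 0 with hΓ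
  have hΓv : ∀ ρ : ℝ →ᵇ X, ‖ρ‖ ≤ 1 → ∀ z, Γ ρ z = g ρ z := fun ρ hρ z => by
    simp only [hΓ, dif_pos hρ, BoundedContinuousFunction.coe_ofNormedAddCommGroup]
  have hmaps : MapsTo Γ (Metric.closedBall 0 1) (Metric.closedBall 0 1) := by
    intro ρ hρ
    rw [mem_closedBall_zero_iff] at hρ ⊢
    rw [BoundedContinuousFunction.norm_le zero_le_one]
    exact fun z => by rw [hΓv ρ hρ]; exact hgb ρ hρ z
  have hcontr : ContractingWith (1 / 2) (hmaps.restrict Γ _ _) := by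
    refine ⟨by norm_num, LipschitzWith.of_dist_le_mul fun ρ ρ' => ?_⟩
    have h1 : ‖(ρ : ℝ →ᵇ X)‖ ≤ 1 := mem_closedBall_zero_iff.1 ρ.2
    have h2 : ‖(ρ' : ℝ →ᵇ X)‖ ≤ 1 := mem_closedBall_zero_iff.1 ρ'.2
    rw [Subtype.dist_eq, Subtype.dist_eq, MapsTo.val_restrict_apply, MapsTo.val_restrict_apply,
      BoundedContinuousFunction.dist_le (by positivity)]
    intro z
    rw [hΓv _ h1, hΓv _ h2]
    simpa using hgd _ _ h1 h2 z
  obtain ⟨ρ, hρ1, hρ2, -⟩ := hcontr.exists_fixedPoint' Metric.isClosed_closedBall.isComplete hmaps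
    (x := 0) (by simp) (edist_ne_top _ _)
  rw [mem_closedBall_zero_iff] at hρ1
  have hR : ∀ t ∈ Ioc 0 T, ‖t ^ γ • ρ (Real.log t)‖ ≤ t ^ γ := fun t ht => by
    rw [norm_scaled_le ht.1]
    exact mul_le_of_le_one_right (Real.rpow_nonneg ht.1.le _) ((ρ.norm_coe_le_norm _).trans hρ1)
  refine ⟨T, hT0, fun t => t ^ γ • ρ (Real.log t), ?_, hR, fun t ht => (hR t ht).trans
    ((Real.rpow_le_rpow ht.1.le ht.2 hγ.le).trans hTc), fun t ht => ?_, fun t ht => ⟨hfi ρ hρ1, ?_⟩⟩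
  · refine (ContinuousOn.rpow_const continuousOn_id fun τ hτ => Or.inl hτ.1.ne').smul ?_
    exact ρ.continuous.comp_continuousOn (Real.continuousOn_log.mono fun τ hτ => hτ.1.ne')
  · have h1 := hfb ρ hρ1 t ht
    simp only [hf] at h1
    rw [norm_smul, norm_inv, Real.norm_of_nonneg ht.1.le, Real.rpow_sub_one ht.1.ne',
      inv_mul_le_iff₀ ht.1] at h1
    refine h1.trans (le_of_eq ?_)
    have := ht.1.ne'
    field_simp
  · have h1 : m (Real.log t) = t := by
      simp only [hm]
      rw [min_eq_left (Real.log_le_log ht.1 ht.2), Real.exp_log ht.1]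
    have h2 : ρ (Real.log t) = g ρ (Real.log t) := by rw [← hΓv ρ hρ1, hρ2]
    simp only [g, h1] at h2
    have h3 : t ^ γ * t ^ (-γ) = 1 := by rw [← Real.rpow_add ht.1]; simp
    simp only []
    rw [h2, smul_smul, h3, one_smul]

end singular

/-! ### Oscillatory integrals -/

/-- The function `e^{i(c/t + μ log t)} / t` has a primitive of size `O(t)`. -/
theorem exists_oscillatory_primitive {c : ℝ} (hc : c ≠ 0) (μ : ℝ) :
    ∃ (Ψ : ℝ → ℂ) (C : ℝ), 0 ≤ C ∧ (∀ t > 0, ‖Ψ t‖ ≤ C * t) ∧ ∀ t > 0,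
      HasDerivAt Ψ (((t⁻¹ : ℝ) : ℂ) * Complex.exp (Complex.I * (c * t⁻¹ + μ * Real.log t : ℝ))) t := by
  set e : ℝ → ℂ := fun t => Complex.exp (Complex.I * (c * t⁻¹ + μ * Real.log t : ℝ)) with he
  have hen : ∀ t, ‖e t‖ = 1 := fun t => by
    simp only [he]; rw [mul_comm, Complex.norm_exp_ofReal_mul_I]
  have hed : ∀ t > 0, HasDerivAt e (e t * (Complex.I * (c * (-(t ^ 2)⁻¹) + μ * t⁻¹ : ℝ))) t := by
    intro t ht
    have h1 : HasDerivAt (fun t : ℝ => c * t⁻¹ + μ * Real.log t)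
        (c * (-(t ^ 2)⁻¹) + μ * t⁻¹) t :=
      ((hasDerivAt_inv ht.ne').const_mul c).add ((Real.hasDerivAt_log ht.ne').const_mul μ)
    exact (h1.ofReal_comp.const_mul Complex.I).cexp
  have hec : ContinuousOn e (Ioi 0) := fun t ht => (hed t ht).continuousAt.continuousWithinAt
  have hei : ∀ t > 0, IntervalIntegrable e volume 0 t := fun t ht => by
    rw [intervalIntegrable_iff_integrableOn_Ioc_of_le (le_of_lt ht)]
    refine Integrable.mono' (g := fun _ => (1 : ℝ)) (integrable_const _)
      ((hec.mono Ioc_subset_Ioi_self).aestronglyMeasurable measurableSet_Ioc) ?_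
    exact Eventually.of_forall fun τ => (hen τ).le
  -- Integration by parts: (t e)' = (1 + iμ) e - i c e/t, solved for e/t. Both t e and the integral
  -- of e are O(t) because |e| = 1.
  refine ⟨fun t => Complex.I / c * (t * e t - (1 + Complex.I * μ) * ∫ τ in (0 : ℝ)..t, e τ),
    ‖Complex.I / (c : ℂ)‖ * (1 + ‖1 + Complex.I * (μ : ℂ)‖), by positivity, fun t ht => ?_,
    fun t ht => ?_⟩
  · have h1 : ‖∫ τ in (0 : ℝ)..t, e τ‖ ≤ t := by
      have := intervalIntegral.norm_integral_le_of_norm_le_const (a := 0) (b := t) (C := 1) (f := e)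
        fun τ _ => (hen τ).le
      simpa [abs_of_pos ht] using this
    rw [norm_mul, mul_assoc]
    refine mul_le_mul_of_nonneg_left ((norm_sub_le _ _).trans ?_) (norm_nonneg _)
    rw [norm_mul, norm_mul, hen, Complex.norm_real, Real.norm_of_nonneg ht.le, add_mul]
    have := mul_le_mul_of_nonneg_left h1 (norm_nonneg (1 + Complex.I * (μ : ℂ)))
    linarith
  · have h1 : HasDerivAt (fun t => ∫ τ in (0 : ℝ)..t, e τ) (e t) t :=
      intervalIntegral.integral_hasDerivAt_right (hei t ht)
        (hec.stronglyMeasurableAtFilter isOpen_Ioi t ht) (hed t ht).continuousAt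
    have h2 : HasDerivAt (fun t : ℝ => (t : ℂ)) 1 t := by
      simpa using (hasDerivAt_id t).ofReal_comp
    have h3 := ((h2.mul (hed t ht)).sub (h1.const_mul (1 + Complex.I * (μ : ℂ)))).const_mul
      (Complex.I / (c : ℂ))
    refine HasDerivAt.congr_deriv (g' := ((t⁻¹ : ℝ) : ℂ) * e t) h3 ?_
    generalize e t = z
    have hct : (c : ℂ) ≠ 0 := by exact_mod_cast hc
    have htt : (t : ℂ) ≠ 0 := by exact_mod_cast ht.ne'
    push_cast
    field_simp
    ring_nf
    simp only [Complex.I_sq]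
    ring

/-! ### Continuity of trilinear convolutions -/

/-- The cubic map of `ℓ¹` given by a kernel. -/
def cubeMap (K : Idx → Idx → Idx → ℂ) (A : Ell1) : Ell1 := ofFun (triple K A A A)

theorem cubeMap_apply {K : Idx → Idx → Idx → ℂ} (hK : ∀ n₁ n₂ n₃, ‖K n₁ n₂ n₃‖ ≤ 1) (A : Ell1)
    (n : Idx) : cubeMap K A n = triple K A A A n :=
  ofFun_apply (sum_norm_triple_le hK A.summable A.summable A.summable).1 n

theorem norm_cubeMap_sub_le {K : Idx → Idx → Idx → ℂ} (hK : ∀ n₁ n₂ n₃, ‖K n₁ n₂ n₃‖ ≤ 1)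
    {A B : Ell1} {c : ℝ} (hA : ‖A‖ ≤ c) (hB : ‖B‖ ≤ c) :
    ‖cubeMap K A - cubeMap K B‖ ≤ 3 * c ^ 2 * ‖A - B‖ := by
  refine Ell1.norm_le fun s => ?_
  have := sum_norm_triple_sub_le hK A.summable B.summable (A.norm_eq ▸ hA)
    (B.norm_eq ▸ hB) s
  have e : ‖A - B‖ = ∑' n, ‖A n - B n‖ := (A - B).norm_eq
  simpa only [e, lp.coeFn_sub, Pi.sub_apply, cubeMap_apply hK] using this

/-- The kernels are not equicontinuous in time, since their frequencies are unbounded. Continuity at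
(t₀, A₀) combines a Lipschitz bound in A that is uniform in the kernel with dominated convergence at
the fixed sequence A₀. -/
theorem continuousOn_cubeMap {K : ℝ → Idx → Idx → Idx → ℂ} {I : Set ℝ}
    (hK : ∀ t n₁ n₂ n₃, ‖K t n₁ n₂ n₃‖ ≤ 1)
    (hc : ∀ n₁ n₂ n₃, ContinuousOn (fun t => K t n₁ n₂ n₃) I) :
    ContinuousOn (fun p : ℝ × Ell1 => cubeMap (K p.1) p.2) (I ×ˢ univ) := by
  rintro ⟨t₀, A₀⟩ ⟨ht₀, -⟩
  rw [ContinuousWithinAt, tendsto_iff_norm_sub_tendsto_zero]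
  set F : ℝ → ℝ := fun t => ∑' q : Idx × (Idx × Idx),
    ‖K t q.1 q.2.1 q.2.2 - K t₀ q.1 q.2.1 q.2.2‖ * (‖A₀ q.1‖ * (‖A₀ q.2.1‖ * ‖A₀ q.2.2‖))
  have hF : Tendsto F (𝓝[I] t₀) (𝓝 0) := by
    have h := tendsto_tsum_of_dominated_convergence (𝓕 := 𝓝[I] t₀)
      (f := fun t (q : Idx × (Idx × Idx)) => ‖K t q.1 q.2.1 q.2.2 - K t₀ q.1 q.2.1 q.2.2‖ *
        (‖A₀ q.1‖ * (‖A₀ q.2.1‖ * ‖A₀ q.2.2‖))) (g := fun _ => (0 : ℝ))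
      ((summable_cube A₀.summable A₀.summable A₀.summable).mul_left 2) (fun q => ?_)
      (Eventually.of_forall fun t q => ?_)
    · simpa using h
    · have h1 := ((hc q.1 q.2.1 q.2.2) t₀ ht₀).tendsto.sub_const (K t₀ q.1 q.2.1 q.2.2)
      rw [sub_self] at h1
      simpa using h1.norm.mul_const (‖A₀ q.1‖ * (‖A₀ q.2.1‖ * ‖A₀ q.2.2‖))
    · rw [Real.norm_of_nonneg (by positivity)]
      refine mul_le_mul_of_nonneg_right ((norm_sub_le _ _).trans ?_) (by positivity)
      have := hK t q.1 q.2.1 q.2.2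
      have := hK t₀ q.1 q.2.1 q.2.2
      linarith
  have hbound : ∀ p : ℝ × Ell1, ‖cubeMap (K p.1) p.2 - cubeMap (K t₀) A₀‖ ≤
      3 * (‖p.2‖ + ‖A₀‖) ^ 2 * ‖p.2 - A₀‖ + F p.1 := by
    intro p
    have h1 := norm_cubeMap_sub_le (hK p.1) (A := p.2) (B := A₀) (c := ‖p.2‖ + ‖A₀‖)
      (by linarith [norm_nonneg A₀]) (by linarith [norm_nonneg p.2])
    have h2 : ‖cubeMap (K p.1) A₀ - cubeMap (K t₀) A₀‖ ≤ F p.1 := by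
      have hs : ∀ n₁ n₂ n₃, ‖K p.1 n₁ n₂ n₃ - K t₀ n₁ n₂ n₃‖ ≤ 2 := fun n₁ n₂ n₃ =>
        (norm_sub_le _ _).trans (by linarith [hK p.1 n₁ n₂ n₃, hK t₀ n₁ n₂ n₃])
      have h3 := sum_norm_triple_le hs A₀.summable A₀.summable A₀.summable
      refine Ell1.norm_le fun s => ?_
      simp only [lp.coeFn_sub, Pi.sub_apply, cubeMap_apply (hK _),
        triple_sub_kernel (hK p.1) (hK t₀) A₀.summable A₀.summable A₀.summable]
      exact (h3.1.sum_le_tsum s fun _ _ => norm_nonneg _).trans h3.2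
    calc _ ≤ ‖cubeMap (K p.1) p.2 - cubeMap (K p.1) A₀‖ +
          ‖cubeMap (K p.1) A₀ - cubeMap (K t₀) A₀‖ := norm_sub_le_norm_sub_add_norm_sub _ _ _
      _ ≤ _ := add_le_add h1 h2
  refine squeeze_zero (fun _ => norm_nonneg _) hbound ?_
  have h1 : Tendsto (fun p : ℝ × Ell1 => 3 * (‖p.2‖ + ‖A₀‖) ^ 2 * ‖p.2 - A₀‖)
      (𝓝[I ×ˢ univ] (t₀, A₀)) (𝓝 0) := by
    have hcont : Continuous fun p : ℝ × Ell1 => 3 * (‖p.2‖ + ‖A₀‖) ^ 2 * ‖p.2 - A₀‖ := by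
      fun_prop
    have := hcont.tendsto (t₀, A₀)
    simp only [sub_self, norm_zero, mul_zero] at this
    exact this.mono_left nhdsWithin_le_nhds
  have h2 : Tendsto (fun p : ℝ × Ell1 => F p.1) (𝓝[I ×ˢ univ] (t₀, A₀)) (𝓝 0) := by
    refine hF.comp ?_
    rw [nhdsWithin_prod_eq]
    exact tendsto_fst
  simpa using h1.add h2

/-! ### Resonant and nonresonant interactions of a finite family -/

/-- The convolution is tested against the indicator of `n`; outside the support of `A` every product
vanishes. -/
theorem triple_eq_sum (K : Idx → Idx → Idx → ℂ) (hK : ∀ n₁ n₂ n₃, ‖K n₁ n₂ n₃‖ ≤ 1)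
    {A : Idx → ℂ} {P : Finset Idx} (hA : ∀ n ∉ P, A n = 0) (n : Idx) :
    triple K A A A n = ∑ q ∈ P ×ˢ (P ×ˢ P), if q.1 - q.2.1 + q.2.2 = n then
      K q.1 q.2.1 q.2.2 * (A q.1 * star (A q.2.1) * A q.2.2) else 0 := by
  have hs : Summable fun n => ‖A n‖ :=
    summable_of_ne_finset_zero (s := P) fun n hn => by rw [hA n hn, norm_zero]
  have h := tsum_triple_mul hK hs hs hs (g := fun m => if m = n then 1 else 0) (G := 1)
    fun m => by split_ifs <;> simp
  simp only [mul_ite, mul_one, mul_zero, tsum_ite_eq] at h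
  rw [h, tsum_eq_sum (s := P ×ˢ (P ×ˢ P))]
  · refine Finset.sum_congr rfl fun q _ => ?_
    split_ifs <;> simp
  · intro q hq
    have h1 : A q.1 * star (A q.2.1) * A q.2.2 = 0 := by
      by_contra h0
      apply hq
      simp only [Finset.mem_product]
      refine ⟨?_, ?_, ?_⟩ <;> by_contra h1 <;> exact h0 (by simp [hA _ h1])
    rw [h1, mul_zero]

/-- Inclusion-exclusion: the two families of resonances overlap where all three indices agree. The
overlap is the origin of the term -|α_n|²α_n, hence of the logarithmic phase. -/
theorem sum_resonant {P : Finset Idx} (F : Idx → Idx → Idx → ℂ) :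
    (∑ q ∈ P ×ˢ (P ×ˢ P), if q.1 = q.2.1 ∨ q.2.1 = q.2.2 then F q.1 q.2.1 q.2.2 else 0) =
      (∑ j ∈ P, ∑ m ∈ P, (F j j m + F m j j)) - ∑ j ∈ P, F j j j := by
  have h1 : ∀ q : Idx × (Idx × Idx),
      (if q.1 = q.2.1 ∨ q.2.1 = q.2.2 then F q.1 q.2.1 q.2.2 else 0) =
      (if q.1 = q.2.1 then F q.1 q.2.1 q.2.2 else 0) +
        (if q.2.1 = q.2.2 then F q.1 q.2.1 q.2.2 else 0) -
        (if q.1 = q.2.1 then if q.2.1 = q.2.2 then F q.1 q.2.1 q.2.2 else 0 else 0) := by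
    intro q
    by_cases h : q.1 = q.2.1 <;> by_cases h' : q.2.1 = q.2.2 <;> simp [h, h']
  simp only [h1, Finset.sum_sub_distrib, Finset.sum_add_distrib, Finset.sum_product]
  congr 1
  · congr 1
    · refine Finset.sum_congr rfl fun j hj => ?_
      rw [Finset.sum_comm]
      refine Finset.sum_congr rfl fun m _ => ?_
      simp [hj]
    · rw [Finset.sum_comm]
      refine Finset.sum_congr rfl fun j hj => Finset.sum_congr rfl fun m _ => ?_
      simp [hj]
  · refine Finset.sum_congr rfl fun j hj => ?_
    rw [Finset.sum_comm, Finset.sum_eq_single j]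
    · rw [Finset.sum_eq_single j]
      · simp
      · intro x _ hx
        simp [Ne.symm hx]
      · exact fun h => absurd hj h
    · intro m _ hm
      refine Finset.sum_eq_zero fun x _ => ?_
      by_cases h : j = x
      · subst h
        simp [Ne.symm hm]
      · simp [h]
    · exact fun h => absurd hj h

/-! ### Existence of the profile in weighted `ℓ¹` -/

/-- The interaction kernel for the coefficients multiplied by `e^{iθₙ log t}` and by weights. -/
def twisted (a b ς : ℝ) (θ w : Idx → ℝ) (t : ℝ) (n₁ n₂ n₃ : Idx) : ℂ :=
  ((w (n₁ - n₂ + n₃) / (w n₁ * w n₂ * w n₃) : ℝ) : ℂ) * (phase a b (ς / t) n₁ n₂ n₃ *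
    Complex.exp (Complex.I * ((θ (n₁ - n₂ + n₃) - θ n₁ + θ n₂ - θ n₃) * Real.log t : ℝ)))

/-- Submultiplicativity of the weight is what keeps the weighted kernel bounded by 1; the two
exponentials have modulus at most 1. -/
theorem norm_twisted_le {w : Idx → ℝ} (hw : ∀ n, 0 < w n)
    (hw' : ∀ n₁ n₂ n₃, w (n₁ - n₂ + n₃) ≤ w n₁ * w n₂ * w n₃) (a b ς : ℝ) (θ : Idx → ℝ) (t : ℝ)
    (n₁ n₂ n₃ : Idx) : ‖twisted a b ς θ w t n₁ n₂ n₃‖ ≤ 1 := by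
  have h1 := norm_phase_le a b (ς / t) n₁ n₂ n₃
  have hpos : 0 < w n₁ * w n₂ * w n₃ := mul_pos (mul_pos (hw _) (hw _)) (hw _)
  rw [twisted, norm_mul, norm_mul, mul_comm Complex.I, Complex.norm_exp_ofReal_mul_I, mul_one,
    Complex.norm_real, Real.norm_of_nonneg (div_pos (hw _) hpos).le]
  exact mul_le_one₀ ((div_le_one hpos).2 (hw' _ _ _)) (norm_nonneg _) h1

theorem continuousOn_twisted (a b ς : ℝ) (θ w : Idx → ℝ) (n₁ n₂ n₃ : Idx) :
    ContinuousOn (fun t => twisted a b ς θ w t n₁ n₂ n₃) (Ioi 0) := by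
  have h0 : ∀ t ∈ Ioi (0 : ℝ), t ≠ 0 := fun t ht => ne_of_gt ht
  unfold twisted phase
  refine continuousOn_const.mul (ContinuousOn.mul ?_ ?_)
  · refine Complex.continuous_exp.comp_continuousOn (continuousOn_const.mul ?_)
    exact Complex.continuous_ofReal.comp_continuousOn
      ((continuousOn_const.div continuousOn_id h0).mul continuousOn_const)
  · refine Complex.continuous_exp.comp_continuousOn (continuousOn_const.mul ?_)
    exact Complex.continuous_ofReal.comp_continuousOn
      (continuousOn_const.mul (Real.continuousOn_log.mono fun t ht => h0 t ht))

theorem phase_resonant (a b r : ℝ) (j m : Idx) : phase a b r j j m = 1 ∧ phase a b r m j j = 1 := by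
  constructor <;> simp [phase]

/-- On resonances the output index is the one that is not repeated, so the rotations cancel as well
as the phases, and only the weight of the repeated index remains. -/
theorem twisted_resonant {w : Idx → ℝ} (hw : ∀ n, 0 < w n) (a b ς : ℝ) (θ : Idx → ℝ) (t : ℝ)
    (j m : Idx) : twisted a b ς θ w t j j m = ((1 / w j ^ 2 : ℝ) : ℂ) ∧
      twisted a b ς θ w t m j j = ((1 / w j ^ 2 : ℝ) : ℂ) := by
  have h1 := (hw j).ne'
  have h2 := (hw m).ne'
  constructor
  · rw [twisted, (phase_resonant a b _ j m).1]
    simp only [sub_self, zero_add]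
    simp only [sub_add_cancel, sub_self, zero_mul, Complex.ofReal_zero, mul_zero,
      Complex.exp_zero, mul_one]
    congr 1
    field_simp
  · rw [twisted, (phase_resonant a b _ j m).2]
    simp only [sub_add_cancel]
    simp only [sub_self, zero_add, zero_mul, Complex.ofReal_zero, mul_zero, Complex.exp_zero,
      mul_one]
    congr 1
    field_simp

/-- The coefficient of 1/t in the phase is ς(x₁-x₂)(x₂-x₃)/2, nonzero off the resonances by
injectivity. The rotations only add a multiple of log t, which `exists_oscillatory_primitive`
allows. -/
theorem exists_twisted_primitive {a b ς : ℝ} (hpt : Function.Injective (pt a b)) (hς : ς ≠ 0)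
    (θ w : Idx → ℝ) (q : Idx × (Idx × Idx)) :
    ∃ (Ψ : ℝ → ℂ) (C : ℝ), 0 ≤ C ∧ (∀ t > 0, ‖Ψ t‖ ≤ C * t) ∧ ∀ t > 0,
      HasDerivAt Ψ (if q.1 = q.2.1 ∨ q.2.1 = q.2.2 then 0 else
        ((t⁻¹ : ℝ) : ℂ) * twisted a b ς θ w t q.1 q.2.1 q.2.2) t := by
  by_cases h : q.1 = q.2.1 ∨ q.2.1 = q.2.2
  · exact ⟨fun _ => 0, 0, le_rfl, by simp, fun t _ => by simpa [h] using hasDerivAt_const t (0 : ℂ)⟩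
  · rw [not_or] at h
    have hc : ς * ((pt a b q.1 ^ 2 - pt a b q.2.1 ^ 2 + pt a b q.2.2 ^ 2 -
        pt a b (q.1 - q.2.1 + q.2.2) ^ 2) / 4) ≠ 0 := by
      have h1 : pt a b q.1 - pt a b q.2.1 ≠ 0 := sub_ne_zero.2 fun e => h.1 (hpt e)
      have h2 : pt a b q.2.1 - pt a b q.2.2 ≠ 0 := sub_ne_zero.2 fun e => h.2 (hpt e)
      have e : pt a b q.1 ^ 2 - pt a b q.2.1 ^ 2 + pt a b q.2.2 ^ 2 -
          pt a b (q.1 - q.2.1 + q.2.2) ^ 2 =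
          2 * ((pt a b q.1 - pt a b q.2.1) * (pt a b q.2.1 - pt a b q.2.2)) := by
        rw [pt_interaction]; ring
      rw [e]
      exact mul_ne_zero hς (div_ne_zero (mul_ne_zero two_ne_zero (mul_ne_zero h1 h2)) four_ne_zero)
    obtain ⟨Ψ, C, hC, hb, hd⟩ := exists_oscillatory_primitive hc
      (θ (q.1 - q.2.1 + q.2.2) - θ q.1 + θ q.2.1 - θ q.2.2)
    set W : ℂ := ((w (q.1 - q.2.1 + q.2.2) / (w q.1 * w q.2.1 * w q.2.2) : ℝ) : ℂ)
    refine ⟨fun t => W * Ψ t, ‖W‖ * C, by positivity, fun t ht => ?_, fun t ht => ?_⟩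
    · rw [norm_mul, mul_assoc]
      exact mul_le_mul_of_nonneg_left (hb t ht) (norm_nonneg _)
    · refine HasDerivAt.congr_deriv ((hd t ht).const_mul W) ?_
      rw [if_neg (not_or.2 h), twisted, phase, ← Complex.exp_add, mul_left_comm]
      congr 3
      push_cast
      ring

/-- The resonant interactions of a finite family are diagonal. -/
theorem sum_resonant_twisted {w : Idx → ℝ} (hw : ∀ n, 0 < w n) (a b ς : ℝ) (θ lam : Idx → ℝ)
    (t : ℝ) (α : Idx →₀ ℂ)
    (hres : ∀ n ∈ α.support, 2 * ∑ j ∈ α.support, ‖α j‖ ^ 2 - ‖α n‖ ^ 2 = lam n) (n : Idx) :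
    (∑ q ∈ α.support ×ˢ (α.support ×ˢ α.support), if q.1 = q.2.1 ∨ q.2.1 = q.2.2 then
      (if q.1 - q.2.1 + q.2.2 = n then twisted a b ς θ w t q.1 q.2.1 q.2.2 *
        ((w q.1 * α q.1) * star (w q.2.1 * α q.2.1) * (w q.2.2 * α q.2.2)) else 0) else 0) =
      (lam n : ℂ) * (w n * α n) := by
  rw [sum_resonant (fun n₁ n₂ n₃ => if n₁ - n₂ + n₃ = n then twisted a b ς θ w t n₁ n₂ n₃ *
    ((w n₁ * α n₁) * star (w n₂ * α n₂) * (w n₃ * α n₃)) else 0)]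
  have hsq : ∀ j, α j * star (α j) = ((‖α j‖ ^ 2 : ℝ) : ℂ) := fun j => by
    rw [Complex.star_def, Complex.mul_conj, Complex.normSq_eq_norm_sq]
  have hw0 : ∀ j, (w j : ℂ) ≠ 0 := fun j => by exact_mod_cast (hw j).ne'
  have h1 : ∀ j m, ((1 / w j ^ 2 : ℝ) : ℂ) *
      ((w j * α j) * star (w j * α j) * (w m * α m)) = ((‖α j‖ ^ 2 : ℝ) : ℂ) * (w m * α m) := by
    intro j m
    rw [← hsq, star_mul', Complex.star_def, Complex.conj_ofReal]
    push_cast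
    have := hw0 j
    field_simp
  have h2 : ∀ j m, ((1 / w j ^ 2 : ℝ) : ℂ) *
      ((w m * α m) * star (w j * α j) * (w j * α j)) = ((‖α j‖ ^ 2 : ℝ) : ℂ) * (w m * α m) := by
    intro j m
    rw [← h1 j m]
    ring
  simp only [sub_self, zero_add, sub_add_cancel, (twisted_resonant hw a b ς θ t _ _).1,
    (twisted_resonant hw a b ς θ t _ _).2, h1, h2, Finset.sum_add_distrib, Finset.sum_ite_eq']
  by_cases hn : n ∈ α.support
  · simp only [if_pos hn, ← hres n hn, ← Finset.sum_mul]
    push_cast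
    ring
  · have : α n = 0 := by simpa using hn
    simp [this]

/-- The existence argument, for the sequence multiplied by the weight and freed of its rotation. The
hypothesis `hres` says that `lam` is the resonant self-interaction of α, so the source consists of
oscillating terms only. -/
theorem exists_weighted_profile {γ a b σ ς : ℝ} (hγ : 1 / 2 < γ) (hγ' : γ < 1)
    (hσ : σ = 1 ∨ σ = -1) (hpt : Function.Injective (pt a b)) (hς : ς ≠ 0) (θ lam : Idx → ℝ)
    {w : Idx → ℝ} (hw : ∀ n, 0 < w n)
    (hw' : ∀ n₁ n₂ n₃, w (n₁ - n₂ + n₃) ≤ w n₁ * w n₂ * w n₃) (α : Idx →₀ ℂ)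
    (hα : ∑ n ∈ α.support, w n * ‖α n‖ ≤ 1) (hlam : ∀ n, |lam n| ≤ 2)
    (hres : ∀ n ∈ α.support, 2 * ∑ j ∈ α.support, ‖α j‖ ^ 2 - ‖α n‖ ^ 2 = lam n) :
    ∃ T > 0, ∃ S S' : ℝ → Ell1, (∀ t ∈ Ioo 0 T, HasDerivAt S (S' t) t) ∧
      ContinuousOn S' (Ioo 0 T) ∧ (∀ t ∈ Ioo 0 T, ‖S t‖ ≤ t ^ γ) ∧
      (∃ C, ∀ t ∈ Ioo 0 T, t * ‖S' t‖ ≤ C) ∧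
      ∀ t ∈ Ioo 0 T, ∀ n, S' t n = (t⁻¹ : ℝ) * (Complex.I * ((σ / (8 * Real.pi) : ℝ) : ℂ)) *
        (triple (twisted a b ς θ w t) (fun n => w n * α n + S t n) (fun n => w n * α n + S t n)
          (fun n => w n * α n + S t n) n - lam n * (w n * α n + S t n)) := by
  set κ : ℂ := Complex.I * ((σ / (8 * Real.pi) : ℝ) : ℂ) with hκ
  have hκn : ‖κ‖ = 1 / (8 * Real.pi) := by
    have h : |σ| = 1 := by rcases hσ with rfl | rfl <;> simp
    rw [hκ, norm_mul, Complex.norm_I, one_mul, Complex.norm_real, Real.norm_eq_abs, abs_div, h,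
      abs_of_pos (by positivity)]
  have hκ24 : ‖κ‖ ≤ 1 / 24 := by
    rw [hκn]
    exact one_div_le_one_div_of_le (by norm_num) (by linarith [Real.pi_gt_three])
  have hK := norm_twisted_le hw hw' a b ς θ
  have hsum : Summable fun n => ‖(w n : ℂ) * α n‖ :=
    summable_of_ne_finset_zero (s := α.support) fun n hn => by
      simp [show α n = 0 by simpa using hn]
  set A : Ell1 := ofFun fun n => (w n : ℂ) * α n with hA
  have hAn : ∀ n, A n = w n * α n := ofFun_apply hsum
  have hA1 : ‖A‖ ≤ 1 := by
    rw [hA, norm_ofFun hsum, tsum_eq_sum (s := α.support) fun n hn => by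
      simp [show α n = 0 by simpa using hn]]
    refine le_trans (le_of_eq (Finset.sum_congr rfl fun n _ => ?_)) hα
    rw [norm_mul, Complex.norm_real, Real.norm_of_nonneg (hw n).le]
  have hlam' : ∀ n, ‖(lam n : ℂ)‖ ≤ 2 := fun n => by
    rw [Complex.norm_real, Real.norm_eq_abs]; exact hlam n
  set L := mulCLM (fun n => (lam n : ℂ)) 2 hlam'
  set N : ℝ → Ell1 → Ell1 := fun t x => κ • (cubeMap (twisted a b ς θ w t) (A + x) - L (A + x))
    with hN
  -- Splits the nonlinearity into its value at zero remainder, which is integrated explicitly using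
  -- oscillation, and a part that vanishes at zero remainder, which goes into the contraction.
  set H : ℝ → Ell1 → Ell1 := fun t x => N t x - N t 0 with hH
  have hNc : ContinuousOn (fun p : ℝ × Ell1 => N p.1 p.2) (Ioi 0 ×ˢ univ) := by
    refine ContinuousOn.const_smul (ContinuousOn.sub ?_ ?_) κ
    · refine (continuousOn_cubeMap hK (continuousOn_twisted a b ς θ w)).comp
        (f := fun p : ℝ × Ell1 => (p.1, A + p.2)) (by fun_prop) fun p hp => ⟨hp.1, mem_univ _⟩
    · exact (L.continuous.comp (continuous_const.add continuous_snd)).continuousOn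
  have hHc : ContinuousOn (fun p : ℝ × Ell1 => H p.1 p.2) (Ioi 0 ×ˢ univ) := by
    refine hNc.sub ?_
    exact hNc.comp (f := fun p : ℝ × Ell1 => (p.1, 0)) (by fun_prop) fun p hp => ⟨hp.1, mem_univ _⟩
  -- The weighted datum has norm at most 1, so the arguments have norm at most 11/10, and (3
  -- (11/10)² + 2)/24 < 1/4 ≤ γ/2.
  have hHL : ∀ t > 0, ∀ x y, ‖x‖ ≤ 1 / 10 → ‖y‖ ≤ 1 / 10 →
      ‖H t x - H t y‖ ≤ (1 / 4) * ‖x - y‖ := by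
    intro t _ x y hx hy
    have hb : ∀ z : Ell1, ‖z‖ ≤ 1 / 10 → ‖A + z‖ ≤ 11 / 10 := fun z hz =>
      (norm_add_le _ _).trans (by linarith)
    have h1 := norm_cubeMap_sub_le (hK t) (hb x hx) (hb y hy)
    have h2 : ‖L (x - y)‖ ≤ 2 * ‖x - y‖ := norm_mulCLM_le _ _ _ _
    rw [add_sub_add_left_eq_sub] at h1
    have e : H t x - H t y = κ • ((cubeMap (twisted a b ς θ w t) (A + x) -
        cubeMap (twisted a b ς θ w t) (A + y)) - L (x - y)) := by
      simp only [hH, hN, map_sub, map_add, ← smul_sub]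
      congr 1
      abel
    rw [e, norm_smul]
    have h3 := norm_sub_le (cubeMap (twisted a b ς θ w t) (A + x) -
        cubeMap (twisted a b ς θ w t) (A + y)) (L (x - y))
    have h0 := norm_nonneg (x - y)
    calc _ ≤ 1 / 24 * (3 * (11 / 10) ^ 2 * ‖x - y‖ + 2 * ‖x - y‖) := by
          gcongr
          linarith
      _ ≤ _ := by linarith
  choose Ψ C hC0 hC hΨ using exists_twisted_primitive hpt hς θ w
  set P := α.support ×ˢ (α.support ×ˢ α.support)
  set d : Idx × (Idx × Idx) → ℂ := fun q =>
    A q.1 * star (A q.2.1) * A q.2.2 with hd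
  set δ : Idx → Ell1 := fun n => lp.single 1 n (1 : ℂ) with hδ
  -- An explicit primitive of the source: α has finite support, so the sum is finite and no
  -- uniformity in the frequencies is required.
  set Sr : ℝ → Ell1 := fun t => κ • ∑ q ∈ P, (Ψ q t * d q) • δ (q.1 - q.2.1 + q.2.2) with hSr
  have hδn : ∀ n, ‖δ n‖ = 1 := fun n => by simp [hδ]
  have hsrc : ∀ t > 0, HasDerivAt Sr (t⁻¹ • N t 0) t := by
    intro t ht
    have h1 : HasDerivAt Sr (κ • ∑ q ∈ P, ((if q.1 = q.2.1 ∨ q.2.1 = q.2.2 then 0 else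
        ((t⁻¹ : ℝ) : ℂ) * twisted a b ς θ w t q.1 q.2.1 q.2.2) * d q) •
          δ (q.1 - q.2.1 + q.2.2)) t := by
      refine HasDerivAt.const_smul κ (HasDerivAt.fun_sum fun q _ => ?_)
      exact ((hΨ q t ht).mul_const _).smul_const _
    refine h1.congr_deriv ?_
    have hcoe : ∀ (n : Idx) (f : Idx × (Idx × Idx) → ℂ),
        (∑ q ∈ P, f q • δ (q.1 - q.2.1 + q.2.2) : Ell1) n =
          ∑ q ∈ P, if q.1 - q.2.1 + q.2.2 = n then f q else 0 := by
      intro n f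
      rw [lp.coeFn_sum, Finset.sum_apply]
      refine Finset.sum_congr rfl fun q _ => ?_
      rw [lp.coeFn_smul, Pi.smul_apply, hδ, lp.single_apply, Pi.single_apply, smul_eq_mul]
      by_cases h : q.1 - q.2.1 + q.2.2 = n
      · simp [h]
      · simp [h, Ne.symm h]
    ext n
    have hcube : cubeMap (twisted a b ς θ w t) A n = ∑ q ∈ P, if q.1 - q.2.1 + q.2.2 = n then
        twisted a b ς θ w t q.1 q.2.1 q.2.2 * d q else 0 := by
      rw [cubeMap_apply (hK t)]
      exact triple_eq_sum _ (hK t) (fun n hn => by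
        rw [hAn]; simp [show α n = 0 by simpa using hn]) n
    -- The resonant part of the cube is exactly the diagonal term that is subtracted, so only
    -- nonresonant triples remain.
    have hr := sum_resonant_twisted hw a b ς θ lam t α hres n
    simp only [← hAn] at hr
    have e1 : cubeMap (twisted a b ς θ w t) A n - lam n * A n =
        ∑ q ∈ P, if q.1 - q.2.1 + q.2.2 = n then (if q.1 = q.2.1 ∨ q.2.1 = q.2.2 then 0 else
          twisted a b ς θ w t q.1 q.2.1 q.2.2) * d q else 0 := by
      rw [hcube, ← hr, ← Finset.sum_sub_distrib]
      refine Finset.sum_congr rfl fun q _ => ?_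
      by_cases h : q.1 = q.2.1 ∨ q.2.1 = q.2.2 <;>
        by_cases h' : q.1 - q.2.1 + q.2.2 = n <;> simp [h, h', hd]
    have e2 : N t 0 n = κ * (cubeMap (twisted a b ς θ w t) A n - lam n * A n) := by
      simp only [hN, add_zero]
      rw [lp.coeFn_smul, Pi.smul_apply, lp.coeFn_sub, Pi.sub_apply, mulCLM_apply, smul_eq_mul]
    rw [lp.coeFn_smul, Pi.smul_apply, hcoe, lp.coeFn_smul, Pi.smul_apply, e2, e1,
      Complex.real_smul, smul_eq_mul, mul_left_comm, Finset.mul_sum (a := ((t⁻¹ : ℝ) : ℂ))]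
    congr 1
    refine Finset.sum_congr rfl fun q _ => ?_
    split_ifs <;> ring
  have hSrb : ∀ t > 0, ‖Sr t‖ ≤ (‖κ‖ * ∑ q ∈ P, C q * ‖d q‖) * t := by
    intro t ht
    rw [hSr, norm_smul, mul_assoc, Finset.sum_mul]
    refine mul_le_mul_of_nonneg_left ((norm_sum_le _ _).trans (Finset.sum_le_sum fun q _ => ?_))
      (norm_nonneg _)
    rw [norm_smul, hδn, mul_one, norm_mul, mul_right_comm]
    exact mul_le_mul_of_nonneg_right (hC q t ht) (norm_nonneg _)
  obtain ⟨T, hT, R, hRc, hRγ, -, hHR, hR⟩ := exists_singular_solution (γ := γ) (k := 1 / 4)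
    (c := 1 / 10) (by linarith) hγ' (by linarith) (by norm_num) (by norm_num)
    (mul_nonneg (norm_nonneg _)
      (Finset.sum_nonneg fun q _ => mul_nonneg (hC0 q) (norm_nonneg _))) hHc (fun t => by simp [hH]) hHL
    (fun t ht => (hsrc t ht).continuousAt.continuousWithinAt) hSrb
  have hIoo : ∀ {t}, t ∈ Ioo 0 T → t ∈ Ioc 0 T := fun ht => ⟨ht.1, ht.2.le⟩
  have hHRc : ContinuousOn (fun τ => τ⁻¹ • H τ (R τ)) (Ioo 0 T) := by
    refine (continuousOn_id.inv₀ fun t ht => ht.1.ne').smul ?_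
    exact hHc.comp (f := fun t => (t, R t))
      (continuousOn_id.prodMk (hRc.mono fun t ht => hIoo ht)) fun t ht => ⟨ht.1, mem_univ _⟩
  have hNRc : ContinuousOn (fun τ => τ⁻¹ • N τ (R τ)) (Ioo 0 T) := by
    refine (continuousOn_id.inv₀ fun t ht => ht.1.ne').smul ?_
    exact hNc.comp (f := fun t => (t, R t))
      (continuousOn_id.prodMk (hRc.mono fun t ht => hIoo ht)) fun t ht => ⟨ht.1, mem_univ _⟩
  refine ⟨T, hT, R, fun t => t⁻¹ • N t (R t), fun t ht => ?_, hNRc, fun t ht => hRγ t (hIoo ht),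
    ⟨‖κ‖ * (3 * 1 + 2) + T ^ γ, fun t ht => ?_⟩, fun t ht n => ?_⟩
  · have h1 : HasDerivAt (fun t => ∫ τ in (0 : ℝ)..t, τ⁻¹ • H τ (R τ)) (t⁻¹ • H t (R t)) t := by
      refine intervalIntegral.integral_hasDerivAt_right ?_
        (hHRc.stronglyMeasurableAtFilter isOpen_Ioo t ht)
        (hHRc.continuousAt (isOpen_Ioo.mem_nhds ht))
      rw [intervalIntegrable_iff_integrableOn_Ioc_of_le ht.1.le]
      exact (hR t (hIoo ht)).1.mono_set (Ioc_subset_Ioc_right ht.2.le)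
    have h2 := (hsrc t ht.1).add h1
    have e : t⁻¹ • N t 0 + t⁻¹ • H t (R t) = t⁻¹ • N t (R t) := by
      simp only [hH]; rw [← smul_add, add_sub_cancel]
    rw [e] at h2
    refine h2.congr_of_eventuallyEq ?_
    filter_upwards [isOpen_Ioo.mem_nhds ht] with τ hτ
    exact (hR τ (hIoo hτ)).2
  -- Only the primitive of the source is small, not the source itself. Hence t R' is merely bounded
  -- although R is O(t^γ).
  · rw [norm_smul, norm_inv, Real.norm_of_nonneg ht.1.le, mul_inv_cancel_left₀ ht.1.ne']
    have e : N t (R t) = N t 0 + H t (R t) := by simp [hH]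
    have h1 : ‖N t 0‖ ≤ ‖κ‖ * (3 * 1 + 2) := by
      have h2 := norm_cubeMap_sub_le (hK t) hA1 (B := 0) (by simp)
      have h3 : cubeMap (twisted a b ς θ w t) 0 = 0 := by
        ext n
        rw [cubeMap_apply (hK t)]
        simp [triple]
      rw [h3, sub_zero, sub_zero] at h2
      have h4 : ‖L A‖ ≤ 2 * ‖A‖ := norm_mulCLM_le _ _ _ _
      simp only [hN, add_zero]
      rw [norm_smul]
      refine mul_le_mul_of_nonneg_left ((norm_sub_le _ _).trans ?_) (norm_nonneg _)
      nlinarith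
    have h2 := hHR t (hIoo ht)
    have h3 : t ^ γ ≤ T ^ γ := Real.rpow_le_rpow ht.1.le ht.2.le (by linarith)
    have h4 : 0 ≤ t ^ γ := Real.rpow_nonneg ht.1.le _
    rw [e]
    refine (norm_add_le _ _).trans ?_
    linarith
  · have e : ⇑(A + R t) = fun n => w n * α n + R t n := by
      funext m
      rw [lp.coeFn_add, Pi.add_apply, hAn]
    simp only [hN]
    rw [lp.coeFn_smul, Pi.smul_apply, lp.coeFn_smul, Pi.smul_apply, lp.coeFn_sub, Pi.sub_apply,
      mulCLM_apply, cubeMap_apply (hK t), e, smul_eq_mul, Complex.real_smul]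
    ring

/-! ### Uniqueness for singular integral equations -/

/-- With W the function differentiated here, W' = γ (1/t + β t^{γ-1}) W. For β = C/κ this gives (κ/t
+ C t^{γ-1}) W = (κ/γ) W': integrating the inequality against W gains the factor κ/γ. -/
theorem hasDerivAt_bielecki (γ β : ℝ) {t : ℝ} (ht : 0 < t) :
    HasDerivAt (fun t : ℝ => t ^ γ * Real.exp (β * t ^ γ))
      (γ * t ^ (γ - 1) * Real.exp (β * t ^ γ) * (1 + β * t ^ γ)) t := by
  have h1 : HasDerivAt (fun t : ℝ => t ^ γ) (γ * t ^ (γ - 1)) t :=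
    Real.hasDerivAt_rpow_const (Or.inl ht.ne')
  refine HasDerivAt.congr_deriv (h1.mul (h1.const_mul β).exp) ?_
  ring

/-- A solution of a linear integral inequality with a small singular coefficient `κ / t` vanishes
if it is `O(t^γ)` with `κ < γ`. -/
theorem eq_zero_of_singular_integral {γ T κ C C₀ : ℝ} (hκ : 0 < κ) (hκγ : κ < γ) (hC : 0 ≤ C)
    {D G : ℝ → Idx → ℂ} (hDs : ∀ t ∈ Ioo 0 T, Summable fun n => ‖D t n‖)
    (hD : ∀ t ∈ Ioo 0 T, ∑' n, ‖D t n‖ ≤ C₀ * t ^ γ)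
    (hG : ∀ t ∈ Ioo 0 T, ∀ s : Finset Idx,
      ∑ n ∈ s, ‖G t n‖ ≤ (κ / t + C * t ^ (γ - 1)) * ∑' n, ‖D t n‖)
    (hI : ∀ t' ∈ Ioo 0 T, ∀ t ∈ Ioo 0 T, t' ≤ t → ∀ n,
      IntervalIntegrable (fun τ => G τ n) volume t' t ∧ D t n - D t' n = ∫ τ in t'..t, G τ n) :
    ∀ t ∈ Ioo 0 T, ∀ n, D t n = 0 := by
  have hγ : 0 < γ := hκ.trans hκγ
  set β := C / κ with hβ
  have hβ0 : 0 ≤ β := by positivity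
  set W : ℝ → ℝ := fun t => t ^ γ * Real.exp (β * t ^ γ) with hW
  set W' : ℝ → ℝ := fun t => γ * t ^ (γ - 1) * Real.exp (β * t ^ γ) * (1 + β * t ^ γ) with hW'
  have hW0 : ∀ t > 0, 0 < W t := fun t ht => by simp only [hW]; positivity
  have hWd : ∀ t > 0, HasDerivAt W (W' t) t := fun t ht => hasDerivAt_bielecki γ β ht
  have hWc : ContinuousOn W' (Ioi 0) := by
    have h : ∀ p : ℝ, ContinuousOn (fun t : ℝ => t ^ p) (Ioi 0) := fun p =>
      ContinuousOn.rpow_const continuousOn_id fun t ht => Or.inl (ne_of_gt ht)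
    refine ((continuousOn_const.mul (h _)).mul ?_).mul
      (continuousOn_const.add (continuousOn_const.mul (h _)))
    exact Real.continuous_exp.comp_continuousOn (continuousOn_const.mul (h _))
  have hstep : ∀ K : ℝ, 0 ≤ K → (∀ t ∈ Ioo 0 T, ∑' n, ‖D t n‖ ≤ K * W t) →
      ∀ t ∈ Ioo 0 T, ∑' n, ‖D t n‖ ≤ κ / γ * K * W t := by
    intro K hK hKW t ht
    -- Each coefficient is only known to be integrable separately, so the integration is done on
    -- finite sums, with bounds that do not depend on the finite set.
    refine Real.tsum_le_of_sum_le (fun _ => norm_nonneg _) fun s => ?_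
    have hbound : ∀ t' ∈ Ioo 0 t, ∑ n ∈ s, ‖D t n‖ ≤ C₀ * t' ^ γ + κ / γ * K * W t := by
      intro t' ht'
      have ht'T : t' ∈ Ioo 0 T := ⟨ht'.1, ht'.2.trans ht.2⟩
      have hpos : ∀ τ ∈ uIcc t' t, 0 < τ := fun τ hτ => by
        rw [uIcc_of_le ht'.2.le] at hτ; exact ht'.1.trans_le hτ.1
      have hGi := fun n => (hI t' ht'T t ht ht'.2.le n).1
      have hWi : IntervalIntegrable (fun τ => κ / γ * K * W' τ) volume t' t :=
        (continuousOn_const.mul (hWc.mono fun τ hτ => hpos τ hτ)).intervalIntegrable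
      have h1 : ∑ n ∈ s, ‖∫ τ in t'..t, G τ n‖ ≤ ∫ τ in t'..t, κ / γ * K * W' τ := by
        calc ∑ n ∈ s, ‖∫ τ in t'..t, G τ n‖ ≤ ∑ n ∈ s, ∫ τ in t'..t, ‖G τ n‖ :=
              Finset.sum_le_sum fun n _ =>
                intervalIntegral.norm_integral_le_integral_norm ht'.2.le
          _ = ∫ τ in t'..t, ∑ n ∈ s, ‖G τ n‖ :=
              (intervalIntegral.integral_finsetSum fun n _ => (hGi n).norm).symm
          _ ≤ _ := by
              refine intervalIntegral.integral_mono_on ht'.2.le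
                (by simpa only [Finset.sum_fn] using
                  IntervalIntegrable.sum s fun n _ => (hGi n).norm) hWi fun τ hτ => ?_
              have hτ0 : 0 < τ := ht'.1.trans_le hτ.1
              have hτT : τ ∈ Ioo 0 T := ⟨hτ0, hτ.2.trans_lt ht.2⟩
              have hr : 0 ≤ κ / τ + C * τ ^ (γ - 1) := by positivity
              refine (hG τ hτT s).trans ((mul_le_mul_of_nonneg_left (hKW τ hτT) hr).trans
                (le_of_eq ?_))
              simp only [hW, hW', hβ]
              rw [Real.rpow_sub_one hτ0.ne']
              field_simp
      have h2 : ∫ τ in t'..t, κ / γ * K * W' τ = κ / γ * K * (W t - W t') := by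
        rw [intervalIntegral.integral_const_mul, intervalIntegral.integral_eq_sub_of_hasDerivAt
          fun τ hτ => hWd τ (hpos τ hτ)]
        exact (hWc.mono fun τ hτ => hpos τ hτ).intervalIntegrable
      have h3 : ∑ n ∈ s, ‖D t' n‖ ≤ C₀ * t' ^ γ :=
        ((hDs t' ht'T).sum_le_tsum s fun _ _ => norm_nonneg _).trans (hD t' ht'T)
      have h4 : ∑ n ∈ s, ‖D t n‖ ≤ ∑ n ∈ s, ‖D t' n‖ + ∑ n ∈ s, ‖∫ τ in t'..t, G τ n‖ := by
        rw [← Finset.sum_add_distrib]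
        refine Finset.sum_le_sum fun n _ => ?_
        rw [← (hI t' ht'T t ht ht'.2.le n).2]
        exact norm_le_norm_add_norm_sub' _ _
      have h5 : 0 ≤ κ / γ * K * W t' := by have := (hW0 t' ht'.1).le; positivity
      rw [h2] at h1
      linarith
    -- The value at the lower endpoint `t'` is O(t'^γ) and drops out as `t'` tends to 0.
    have hlim : Tendsto (fun t' : ℝ => C₀ * t' ^ γ + κ / γ * K * W t) (𝓝[>] 0)
        (𝓝 (κ / γ * K * W t)) := by
      have h := (Real.continuousAt_rpow_const 0 γ (Or.inr hγ.le)).tendsto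
      rw [Real.zero_rpow hγ.ne'] at h
      simpa using ((h.mono_left nhdsWithin_le_nhds).const_mul C₀).add_const (κ / γ * K * W t)
    refine ge_of_tendsto hlim ?_
    filter_upwards [Ioo_mem_nhdsGT ht.1] with t' ht' using hbound t' ht'
  -- Each pass multiplies the constant by κ/γ < 1, so the iterated bounds tend to 0.
  have hiter : ∀ m : ℕ, ∀ t ∈ Ioo 0 T, ∑' n, ‖D t n‖ ≤ (κ / γ) ^ m * max C₀ 0 * W t := by
    intro m
    induction m with
    | zero =>
      intro t ht
      refine (hD t ht).trans ?_
      have h1 : 1 ≤ Real.exp (β * t ^ γ) := Real.one_le_exp (by have := ht.1; positivity)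
      have h2 : 0 ≤ t ^ γ := Real.rpow_nonneg ht.1.le _
      simp only [pow_zero, one_mul, hW]
      have h3 : C₀ * t ^ γ ≤ max C₀ 0 * t ^ γ := mul_le_mul_of_nonneg_right (le_max_left _ _) h2
      refine h3.trans (mul_le_mul_of_nonneg_left ?_ (le_max_right _ _))
      exact le_mul_of_one_le_right h2 h1
    | succ m ih =>
      intro t ht
      rw [pow_succ', mul_assoc (κ / γ)]
      exact hstep _ (by positivity) ih t ht
  intro t ht n
  have hlim : Tendsto (fun m : ℕ => (κ / γ) ^ m * max C₀ 0 * W t) atTop (𝓝 0) := by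
    have h := tendsto_pow_atTop_nhds_zero_of_lt_one (by positivity) ((div_lt_one hγ).2 hκγ)
    simpa using (h.mul_const (max C₀ 0)).mul_const (W t)
  have h0 : ∑' n, ‖D t n‖ ≤ 0 := ge_of_tendsto' hlim fun m => hiter m t ht
  have h1 := (hDs t ht).le_tsum n fun _ _ => norm_nonneg _
  exact norm_le_zero_iff.1 (h1.trans h0)

/-- Uniqueness of small solutions of the system for the coefficients. -/
theorem eq_of_force {γ T a b σ ς M c C : ℝ} (hγ : 1 / 2 < γ) (hσ : σ = 1 ∨ σ = -1)
    (hς : ς = 1 ∨ ς = -1) (hM : 0 ≤ M) (hM' : M ≤ 1) (hc0 : 0 ≤ c) (hc : c ≤ 1 / 2) (hC : 0 ≤ C)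
    {A B : ℝ → Idx → ℂ}
    (hA : ∀ t ∈ Ioo 0 T, Summable fun n => ‖A t n‖) (hB : ∀ t ∈ Ioo 0 T, Summable fun n => ‖B t n‖)
    (hAb : ∀ t ∈ Ioo 0 T, ∑' n, ‖A t n‖ ≤ c + C * t ^ γ)
    (hBb : ∀ t ∈ Ioo 0 T, ∑' n, ‖B t n‖ ≤ c + C * t ^ γ)
    (hAB : ∀ t ∈ Ioo 0 T, ∑' n, ‖A t n - B t n‖ ≤ C * t ^ γ)
    (hAI : ∀ t' ∈ Ioo 0 T, ∀ t ∈ Ioo 0 T, t' ≤ t → ∀ n,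
      IntervalIntegrable (fun τ => force a b σ M (ς * τ) (A τ) n) volume t' t ∧
      A t n - A t' n = ∫ τ in t'..t, force a b σ M (ς * τ) (A τ) n)
    (hBI : ∀ t' ∈ Ioo 0 T, ∀ t ∈ Ioo 0 T, t' ≤ t → ∀ n,
      IntervalIntegrable (fun τ => force a b σ M (ς * τ) (B τ) n) volume t' t ∧
      B t n - B t' n = ∫ τ in t'..t, force a b σ M (ς * τ) (B τ) n) :
    ∀ t ∈ Ioo 0 T, ∀ n, A t n = B t n := by
  by_cases hT : T ≤ 0
  · intro t ht
    exact absurd (ht.1.trans ht.2) (not_lt.2 hT)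
  rw [not_le] at hT
  have hab : |ς| = 1 := by rcases hς with rfl | rfl <;> simp
  suffices h : ∀ t ∈ Ioo 0 T, ∀ n, A t n - B t n = 0 from fun t ht n => sub_eq_zero.1 (h t ht n)
  -- At t = 0 the numerator is at most 3/4 + 2, and 8π > 24, so κ = 1/4 suffices and is below γ. The
  -- parts of the Lipschitz constant with a factor t^γ go into the integrable term; T^γ bounds the
  -- second factor of the quadratic one.
  refine eq_zero_of_singular_integral (γ := γ) (κ := 1 / 4) (C := 3 * (C + C ^ 2 * T ^ γ))
    (C₀ := C) (by norm_num)
    (by linarith) (by positivity) (fun t ht => ?_) hAB (G := fun τ n =>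
      force a b σ M (ς * τ) (A τ) n - force a b σ M (ς * τ) (B τ) n)
    (fun t ht s => ?_) fun t' ht' t ht htt n => ?_
  · exact Summable.of_nonneg_of_le (fun _ => norm_nonneg _) (fun _ => norm_sub_le _ _)
      ((hA t ht).add (hB t ht))
  · have h := force_sub_le hσ a b (ς * t) (hA t ht) (hB t ht) (hAb t ht) (hBb t ht) hM s
    refine h.trans (mul_le_mul_of_nonneg_right ?_ (tsum_nonneg fun _ => norm_nonneg _))
    have ht0 := ht.1
    rw [abs_mul, hab, one_mul, abs_of_pos ht0, Real.rpow_sub_one ht0.ne']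
    have h1 : t ^ γ ≤ T ^ γ := Real.rpow_le_rpow ht0.le ht.2.le (by linarith)
    have h0 : 0 ≤ t ^ γ := Real.rpow_nonneg ht0.le _
    have e : 1 / 4 / t + 3 * (C + C ^ 2 * T ^ γ) * (t ^ γ / t) =
        (1 / 4 + 3 * (C + C ^ 2 * T ^ γ) * t ^ γ) / t := by ring
    have e2 : (3 * (c + C * t ^ γ) ^ 2 + 2 * M) / (8 * Real.pi * t) =
      ((3 * (c + C * t ^ γ) ^ 2 + 2 * M) / (8 * Real.pi)) / t := by field_simp
    rw [e, e2]
    refine div_le_div_of_nonneg_right ?_ ht0.le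
    rw [div_le_iff₀ (by positivity)]
    have hπ := Real.pi_gt_three
    set z := t ^ γ
    set Z := T ^ γ
    have h3 : C * z * (C * z) ≤ C ^ 2 * Z * z := by nlinarith [mul_nonneg (sq_nonneg C) h0]
    have h4 : 0 ≤ C * z := mul_nonneg hC h0
    have h5 : c * (C * z) ≤ 1 / 2 * (C * z) := mul_le_mul_of_nonneg_right hc h4
    have h6 : c ^ 2 ≤ 1 / 4 := by nlinarith
    have h7 : 3 * (c + C * z) ^ 2 + 2 * M ≤ 3 + 3 * (C * z) + 3 * (C ^ 2 * Z * z) := by nlinarith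
    have h8 : 0 ≤ C ^ 2 * Z * z := by nlinarith [mul_nonneg h4 h4]
    have h9 : 24 * (1 / 4 + 3 * (C + C ^ 2 * Z) * z) ≤
        (1 / 4 + 3 * (C + C ^ 2 * Z) * z) * (8 * Real.pi) := by
      have : 0 ≤ 1 / 4 + 3 * (C + C ^ 2 * Z) * z := by nlinarith
      nlinarith
    nlinarith
  · obtain ⟨a1, a2⟩ := hAI t' ht' t ht htt n
    obtain ⟨b1, b2⟩ := hBI t' ht' t ht htt n
    refine ⟨a1.sub b1, ?_⟩
    rw [intervalIntegral.integral_sub a1 b1, ← a2, ← b2]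
    ring

/-! ### Weights -/

theorem wt_pos (n : Idx) : 0 < wt n := by unfold wt; positivity

theorem one_le_wt (n : Idx) : 1 ≤ wt n := by
  unfold wt
  have := abs_nonneg (n.1 : ℝ)
  have := abs_nonneg (n.2 : ℝ)
  linarith

/-- The length |k| + |k̃| is subadditive, so 1 + δ|n| and its powers are submultiplicative. As δ → 0
the weight tends to 1 on any finite set, while for fixed δ < 1 it stays comparable with that of
l^{2,s}, with constant δ^{-s}. -/
theorem exists_weight {s : ℝ} (hs : 0 < s) (P : Finset Idx) :
    ∃ (w : Idx → ℝ) (C : ℝ), (∀ n, 1 ≤ w n) ∧ (∀ n ∈ P, w n ≤ 2) ∧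
      (∀ n₁ n₂ n₃, w (n₁ - n₂ + n₃) ≤ w n₁ * w n₂ * w n₃) ∧ ∀ n, wt n ^ s / w n ≤ C := by
  set ℓ : Idx → ℝ := fun n => |(n.1 : ℝ)| + |(n.2 : ℝ)| with hℓ
  have hℓ0 : ∀ n, 0 ≤ ℓ n := fun n => by positivity
  have hℓt : ∀ n₁ n₂ n₃, ℓ (n₁ - n₂ + n₃) ≤ ℓ n₁ + ℓ n₂ + ℓ n₃ := by
    intro n₁ n₂ n₃
    simp only [hℓ, Prod.fst_add, Prod.fst_sub, Prod.snd_add, Prod.snd_sub]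
    push_cast
    have h : ∀ x y z : ℝ, |x - y + z| ≤ |x| + |y| + |z| := fun x y z =>
      (abs_add_le _ _).trans (add_le_add_left (abs_sub _ _) _)
    linarith [h n₁.1 n₂.1 n₃.1, h n₁.2 n₂.2 n₃.2]
  have h1 : ∀ n, ∀ᶠ δ : ℝ in 𝓝[>] 0, (1 + δ * ℓ n) ^ s ≤ 2 := by
    intro n
    have h : Tendsto (fun δ : ℝ => (1 + δ * ℓ n) ^ s) (𝓝 0) (𝓝 ((1 + 0 * ℓ n) ^ s)) := by
      refine Tendsto.rpow_const ?_ (Or.inr hs.le)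
      exact (continuous_const.add (continuous_id.mul continuous_const)).tendsto _
    simp only [zero_mul, add_zero, Real.one_rpow] at h
    exact (h.mono_left nhdsWithin_le_nhds).eventually (ge_mem_nhds one_lt_two)
  obtain ⟨δ, hδP, hδ0, hδ1⟩ := (((Finset.eventually_all P).2 fun n _ => h1 n).and
    (Ioo_mem_nhdsGT one_pos : ∀ᶠ δ : ℝ in 𝓝[>] 0, δ ∈ Ioo 0 1)).exists
  have hb : ∀ n, 1 ≤ 1 + δ * ℓ n := fun n => by nlinarith [hℓ0 n]
  refine ⟨fun n => (1 + δ * ℓ n) ^ s, δ⁻¹ ^ s, fun n => Real.one_le_rpow (hb n) hs.le, hδP,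
    fun n₁ n₂ n₃ => ?_, fun n => ?_⟩
  · have hb0 : ∀ n, 0 ≤ 1 + δ * ℓ n := fun n => zero_le_one.trans (hb n)
    rw [← Real.mul_rpow (hb0 _) (hb0 _), ← Real.mul_rpow (mul_nonneg (hb0 _) (hb0 _)) (hb0 _)]
    refine Real.rpow_le_rpow (hb0 _) ?_ hs.le
    have e1 := mul_nonneg hδ0.le (hℓ0 n₁)
    have e2 := mul_nonneg hδ0.le (hℓ0 n₂)
    have e3 := mul_nonneg hδ0.le (hℓ0 n₃)
    have := mul_le_mul_of_nonneg_left (hℓt n₁ n₂ n₃) hδ0.le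
    calc 1 + δ * ℓ (n₁ - n₂ + n₃) ≤ 1 + δ * ℓ n₁ + δ * ℓ n₂ + δ * ℓ n₃ := by linarith
      _ ≤ (1 + δ * ℓ n₁) * (1 + δ * ℓ n₂) * (1 + δ * ℓ n₃) := by
        nlinarith [mul_nonneg e1 e2, mul_nonneg e1 e3, mul_nonneg e2 e3,
          mul_nonneg (mul_nonneg e1 e2) e3]
  · have hb0 : 0 < 1 + δ * ℓ n := zero_lt_one.trans_le (hb n)
    rw [← Real.div_rpow (wt_pos n).le hb0.le]
    refine Real.rpow_le_rpow (div_pos (wt_pos n) hb0).le ?_ hs.le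
    rw [div_le_iff₀ hb0, inv_mul_eq_div, le_div_iff₀ hδ0]
    have : wt n = 1 + ℓ n := by simp only [wt, hℓ]; ring
    rw [this]
    nlinarith [hℓ0 n]

/-- The interaction kernel without weights. -/
def rotated (a b ς : ℝ) (θ : Idx → ℝ) (t : ℝ) (n₁ n₂ n₃ : Idx) : ℂ :=
  phase a b (ς / t) n₁ n₂ n₃ *
    Complex.exp (Complex.I * ((θ (n₁ - n₂ + n₃) - θ n₁ + θ n₂ - θ n₃) * Real.log t : ℝ))

/-- The weights in the kernel were chosen to undo multiplication of the sequence by `w`. -/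
theorem triple_twisted {w : Idx → ℝ} (hw : ∀ n, 0 < w n) (a b ς : ℝ) (θ : Idx → ℝ) (t : ℝ)
    (B : Idx → ℂ) (n : Idx) :
    triple (twisted a b ς θ w t) (fun n => w n * B n) (fun n => w n * B n) (fun n => w n * B n) n =
      w n * triple (rotated a b ς θ t) B B B n := by
  have hw0 : ∀ j, (w j : ℂ) ≠ 0 := fun j => by exact_mod_cast (hw j).ne'
  rw [triple, triple, ← tsum_mul_left]
  refine tsum_congr fun p => ?_
  have e : p.1 - p.2 + (n - p.1 + p.2) = n := by abel
  simp only [twisted, rotated, e, star_mul', Complex.star_def, Complex.conj_ofReal]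
  push_cast
  have h1 := hw0 p.1
  have h2 := hw0 p.2
  have h3 := hw0 (n - p.1 + p.2)
  field_simp

/-- A remainder that is of class `C¹` in `ℓ¹` and in `l^{2,s}`, with the required decay. -/
structure IsStrongRemainder (s γ T : ℝ) (V V' : ℝ → Ell1) (W W' : ℝ → Ell2) : Prop where
  hasDerivAt : ∀ t ∈ Ioo 0 T, HasDerivAt V (V' t) t
  continuousOn : ContinuousOn V' (Ioo 0 T)
  norm_le : ∀ t ∈ Ioo 0 T, ‖V t‖ ≤ t ^ γ
  weighted_eq : ∀ t n, W t n = weighted s (V t) n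
  weighted_eq' : ∀ t n, W' t n = weighted s (V' t) n
  hasDerivAt₂ : ∀ t ∈ Ioo 0 T, HasDerivAt W (W' t) t
  continuousOn₂ : ContinuousOn W' (Ioo 0 T)
  norm₂_le : ∃ C, ∀ t ∈ Ioo 0 T, ‖W t‖ ≤ C * t ^ γ ∧ t * ‖W' t‖ ≤ C

/-- The weighted existence result with the auxiliary weight divided out. That weight is at most 2 on
the support of α, so an ℓ¹ norm of 1/2 becomes a weighted norm of at most 1. The price is a constant
in the l^{2,s} bounds and a time of existence that depend on α. -/
theorem exists_profile {s γ a b σ ς : ℝ} (hs : 0 < s) (hγ : 1 / 2 < γ) (hγ' : γ < 1)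
    (hσ : σ = 1 ∨ σ = -1) (hpt : Function.Injective (pt a b)) (hς : ς ≠ 0) (θ lam : Idx → ℝ)
    (α : Idx →₀ ℂ) (hα : ∑ n ∈ α.support, ‖α n‖ ≤ 1 / 2) (hlam : ∀ n, |lam n| ≤ 2)
    (hres : ∀ n ∈ α.support, 2 * ∑ j ∈ α.support, ‖α j‖ ^ 2 - ‖α n‖ ^ 2 = lam n) :
    ∃ T > 0, ∃ (V V' : ℝ → Ell1) (W W' : ℝ → Ell2), IsStrongRemainder s γ T V V' W W' ∧
      ∀ t ∈ Ioo 0 T, ∀ n, V' t n = (t⁻¹ : ℝ) * (Complex.I * ((σ / (8 * Real.pi) : ℝ) : ℂ)) *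
        (triple (rotated a b ς θ t) (fun n => α n + V t n) (fun n => α n + V t n)
          (fun n => α n + V t n) n - lam n * (α n + V t n)) := by
  obtain ⟨w, C, hw1, hw2, hw3, hwC⟩ := exists_weight hs α.support
  have hw : ∀ n, 0 < w n := fun n => zero_lt_one.trans_le (hw1 n)
  have hw0 : ∀ j, (w j : ℂ) ≠ 0 := fun j => by exact_mod_cast (hw j).ne'
  obtain ⟨T, hT, S, S', hS, hSc, hSb, ⟨C', hSb'⟩, hode⟩ := exists_weighted_profile hγ hγ' hσ hpt hς
    θ lam hw hw3 α (by
      calc ∑ n ∈ α.support, w n * ‖α n‖ ≤ ∑ n ∈ α.support, 2 * ‖α n‖ :=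
            Finset.sum_le_sum fun n hn => mul_le_mul_of_nonneg_right (hw2 n hn) (norm_nonneg _)
        _ ≤ 1 := by rw [← Finset.mul_sum]; linarith) hlam hres
  have hm1 : ∀ n, ‖((w n)⁻¹ : ℂ)‖ ≤ 1 := fun n => by
    rw [norm_inv, Complex.norm_real, Real.norm_of_nonneg (hw n).le]
    exact inv_le_one_of_one_le₀ (hw1 n)
  have hm2 : ∀ n, ‖((wt n ^ s / w n : ℝ) : ℂ)‖ ≤ C := fun n => by
    rw [Complex.norm_real, Real.norm_of_nonneg
      (div_nonneg (Real.rpow_nonneg (wt_pos n).le _) (hw n).le)]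
    exact hwC n
  have hC0 : 0 ≤ C := (norm_nonneg _).trans (hm2 0)
  -- Two images of the weighted sequence: dividing by the weight returns to plain ℓ¹, and
  -- multiplying by the quotient of the two weights lands in the ℓ² model of l^{2,s}. Both maps are
  -- linear and bounded, so derivatives and bounds carry over.
  set E₁ := mulCLM _ _ hm1
  set E₂ := mulCLM₂ _ _ hm2
  have hweight : ∀ (A : Ell1) n, E₂ A n = weighted s (E₁ A) n := fun A n => by
    simp only [E₁, E₂, weighted]
    rw [mulCLM₂_apply, mulCLM_apply]
    push_cast
    ring
  have hE₂ : ∀ A, ‖E₂ A‖ ≤ C * ‖A‖ := norm_mulCLM₂_le _ _ hm2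
  refine ⟨T, hT, fun t => E₁ (S t), fun t => E₁ (S' t), fun t => E₂ (S t), fun t => E₂ (S' t),
    ⟨fun t ht => ?_, E₁.continuous.comp_continuousOn hSc, fun t ht => ?_, fun t n => hweight _ n,
      fun t n => hweight _ n, fun t ht => ?_, E₂.continuous.comp_continuousOn hSc,
      max C (C * C'), fun t ht => ⟨?_, ?_⟩⟩, fun t ht n => ?_⟩
  · exact (E₁.restrictScalars ℝ).hasFDerivAt.comp_hasDerivAt t (hS t ht)
  · have := norm_mulCLM_le _ _ hm1 (S t)
    rw [one_mul] at this
    exact this.trans (hSb t ht)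
  · exact (E₂.restrictScalars ℝ).hasFDerivAt.comp_hasDerivAt t (hS t ht)
  · have h0 : 0 ≤ t ^ γ := Real.rpow_nonneg ht.1.le _
    exact (hE₂ _).trans ((mul_le_mul_of_nonneg_left (hSb t ht) hC0).trans
      (mul_le_mul_of_nonneg_right (le_max_left _ _) h0))
  · calc t * ‖E₂ (S' t)‖ ≤ t * (C * ‖S' t‖) := mul_le_mul_of_nonneg_left (hE₂ _) ht.1.le
      _ = C * (t * ‖S' t‖) := by ring
      _ ≤ C * C' := mul_le_mul_of_nonneg_left (hSb' t ht) hC0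
      _ ≤ _ := le_max_right _ _
  · have e : (fun n => (w n : ℂ) * α n + S t n) = fun n => w n * (α n + E₁ (S t) n) := by
      funext m
      simp only [E₁]
      rw [mulCLM_apply]
      have := hw0 m
      field_simp
    have h := hode t ht n
    rw [e, triple_twisted hw] at h
    have e' : (w n : ℂ) * α n + S t n = w n * (α n + E₁ (S t) n) := congrFun e n
    rw [e'] at h
    have e'' : E₁ (S' t) n = (w n : ℂ)⁻¹ * S' t n := mulCLM_apply _ _ _ _ _
    rw [e'', h]
    have := hw0 n
    field_simp

/-! ### From the profile to the coefficients -/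

theorem cexp_star_mul (x y z v : ℝ) :
    Complex.exp (-Complex.I * x) * star (Complex.exp (-Complex.I * y)) *
      Complex.exp (-Complex.I * z) = Complex.exp (-Complex.I * v) *
        Complex.exp (Complex.I * (v - x + y - z)) := by
  rw [Complex.star_def, ← Complex.exp_conj, ← Complex.exp_add, ← Complex.exp_add,
    ← Complex.exp_add]
  congr 1
  simp only [map_mul, map_neg, Complex.conj_I, Complex.conj_ofReal]
  ring

/-- A gauge change: rotations taken out of the coefficients reappear in the kernel as the exponent
θ_n - θ_{n₁} + θ_{n₂} - θ_{n₃}. -/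
theorem cubic_rotation (a b ς : ℝ) (θ : Idx → ℝ) (t : ℝ) (B : Idx → ℂ) (n : Idx) :
    cubic a b (ς / t) (fun n => Complex.exp (-Complex.I * (θ n * Real.log t : ℝ)) * B n) n =
      Complex.exp (-Complex.I * (θ n * Real.log t : ℝ)) * triple (rotated a b ς θ t) B B B n := by
  rw [cubic, triple, triple, ← tsum_mul_left]
  refine tsum_congr fun p => ?_
  have e : p.1 - p.2 + (n - p.1 + p.2) = n := by abel
  have h := cexp_star_mul (θ p.1 * Real.log t) (θ p.2 * Real.log t)
    (θ (n - p.1 + p.2) * Real.log t) (θ n * Real.log t)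
  have e2 : Complex.exp (Complex.I * ((θ n - θ p.1 + θ p.2 - θ (n - p.1 + p.2)) *
      Real.log t : ℝ)) = Complex.exp (Complex.I * (((θ n * Real.log t : ℝ) : ℂ) -
        (θ p.1 * Real.log t : ℝ) + (θ p.2 * Real.log t : ℝ) -
        (θ (n - p.1 + p.2) * Real.log t : ℝ))) := by
    congr 1; push_cast; ring
  simp only [rotated, e, star_mul', e2]
  linear_combination phase a b (ς / t) p.1 p.2 (n - p.1 + p.2) *
    (B p.1 * star (B p.2) * B (n - p.1 + p.2)) * h

theorem hasDerivAt_rotation (θ : ℝ) {t : ℝ} (ht : 0 < t) :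
    HasDerivAt (fun t => Complex.exp (-Complex.I * (θ * Real.log t : ℝ)))
      (Complex.exp (-Complex.I * (θ * Real.log t : ℝ)) * (-Complex.I * (θ * t⁻¹ : ℝ))) t :=
  (((Real.hasDerivAt_log ht.ne').const_mul θ).ofReal_comp.const_mul (-Complex.I)).cexp

/-- Differentiating the rotation produces -iθ_n/t; the relation `hlam` says that this accounts
exactly for the gap between `lam` and the 2M of the equation, as σ² = 1. With ς = -1 the force is
evaluated at the reflected time. -/
theorem hasDerivAt_coefficient {a b σ ς M : ℝ} (hσ : σ = 1 ∨ σ = -1) (hς : ς = 1 ∨ ς = -1)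
    {θ lam : Idx → ℝ} (hlam : ∀ n, lam n = 2 * M - 8 * Real.pi * σ * θ n) (α : Idx → ℂ)
    {V V' : ℝ → Ell1} {t : ℝ} (ht : 0 < t) (hV : HasDerivAt V (V' t) t)
    (hode : ∀ n, V' t n = (t⁻¹ : ℝ) * (Complex.I * ((σ / (8 * Real.pi) : ℝ) : ℂ)) *
      (triple (rotated a b ς θ t) (fun n => α n + V t n) (fun n => α n + V t n)
        (fun n => α n + V t n) n - lam n * (α n + V t n))) (n : Idx) :
    HasDerivAt (fun t => Complex.exp (-Complex.I * (θ n * Real.log t : ℝ)) * (α n + V t n))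
      (force a b σ M (ς * t)
        (fun n => Complex.exp (-Complex.I * (θ n * Real.log t : ℝ)) * (α n + V t n)) n) t := by
  have h1 : HasDerivAt (fun t => V t n) (V' t n) t := by
    have h := ((pairCLM (fun m => if m = n then 1 else 0) 1 fun m => by
      split_ifs <;> simp).restrictScalars ℝ).hasFDerivAt.comp_hasDerivAt t hV
    have e : ∀ A : Ell1, ((pairCLM (fun m => if m = n then 1 else 0) 1 fun m => by
      split_ifs <;> simp).restrictScalars ℝ) A = A n := fun A => by
      rw [ContinuousLinearMap.coe_restrictScalars', pairCLM_apply]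
      simp [tsum_ite_eq]
    rw [e] at h
    refine h.congr_of_eventuallyEq (Eventually.of_forall fun τ => ?_)
    exact (e _).symm
  have h2 := (hasDerivAt_rotation (θ n) ht).mul (h1.const_add (α n))
  refine h2.congr_deriv ?_
  have hςt : 1 / (ς * t) = ς / t := by rcases hς with rfl | rfl <;> field_simp
  have hςa : |ς * t| = t := by rcases hς with rfl | rfl <;> simp [abs_of_pos ht]
  have hσ2 : (σ : ℂ) * σ = 1 := by rcases hσ with rfl | rfl <;> simp
  rw [force, hςt, hςa, cubic_rotation, hode n, hlam n]
  have htc : (t : ℂ) ≠ 0 := by exact_mod_cast ht.ne'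
  have hπ : (Real.pi : ℂ) ≠ 0 := by exact_mod_cast Real.pi_ne_zero
  push_cast
  field_simp
  linear_combination (8 * Real.pi * θ n * (α n + V t n)) * hσ2

/-! ### Derivatives of evolved Dirac masses -/

theorem hasDerivAt_evolvedDirac_right (t y x : ℝ) : HasDerivAt (fun x => evolvedDirac t y x)
    (evolvedDirac t y x * (Complex.I * ((x - y) / (2 * t) : ℝ))) x := by
  have h1 : HasDerivAt (fun x : ℝ => (x - y) ^ 2 / (4 * t)) ((x - y) / (2 * t)) x := by
    refine ((((hasDerivAt_id x).sub_const y).pow 2).div_const (4 * t)).congr_deriv ?_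
    simp only [id]
    rcases eq_or_ne t 0 with rfl | ht
    · simp
    · field_simp
      norm_num
      ring
  have h2 := ((h1.ofReal_comp.const_mul Complex.I).cexp).div_const
    ((4 * Real.pi * Complex.I * t : ℂ) ^ (1 / 2 : ℂ))
  refine h2.congr_deriv ?_
  rw [evolvedDirac]
  ring

theorem hasDerivAt_evolvedDirac_left {t : ℝ} (ht : 0 < t) (y x : ℝ) :
    HasDerivAt (fun t => evolvedDirac t y x)
      (evolvedDirac t y x * (-Complex.I * ((x - y) ^ 2 / (4 * t ^ 2) : ℝ) - 1 / (2 * t))) t := by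
  have ht0 : (t : ℂ) ≠ 0 := by exact_mod_cast ht.ne'
  have h1 : HasDerivAt (fun t : ℝ => (x - y) ^ 2 / (4 * t)) (-((x - y) ^ 2 / (4 * t ^ 2))) t := by
    have h := (((hasDerivAt_id t).const_mul 4).inv (by simpa using ht.ne')).const_mul ((x - y) ^ 2)
    refine (h.congr_deriv ?_).congr_of_eventuallyEq (Eventually.of_forall fun τ => ?_)
    · simp only [id]
      field_simp
    · simp [div_eq_mul_inv]
  have h2 := (h1.ofReal_comp.const_mul Complex.I).cexp
  have h3 : HasDerivAt (fun t : ℝ => (4 * Real.pi * Complex.I * t : ℂ) ^ (1 / 2 : ℂ))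
      ((1 / (2 * t)) * (4 * Real.pi * Complex.I * t : ℂ) ^ (1 / 2 : ℂ)) t := by
    have hlin : HasDerivAt (fun z : ℂ => 4 * Real.pi * Complex.I * z)
        (4 * Real.pi * Complex.I) (t : ℂ) := by
      simpa using (hasDerivAt_id (t : ℂ)).const_mul (4 * Real.pi * Complex.I)
    have hne : (4 * Real.pi * Complex.I * t : ℂ) ≠ 0 := by
      simp [ht0, Real.pi_ne_zero]
    -- The base of the power lies on the imaginary axis, away from the cut of the principal root.
    have hs : (4 * Real.pi * Complex.I * t : ℂ) ∈ Complex.slitPlane := by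
      right
      simp [ht.ne', Real.pi_ne_zero]
    refine (hlin.cpow_const (c := 1 / 2) hs).comp_ofReal.congr_deriv ?_
    rw [Complex.cpow_sub _ _ hne, Complex.cpow_one]
    have hπ : (Real.pi : ℂ) ≠ 0 := by exact_mod_cast Real.pi_ne_zero
    have hI := Complex.I_ne_zero
    field_simp
  have h4 := h2.div h3 (root_ne_zero ht.ne')
  refine h4.congr_deriv ?_
  rw [evolvedDirac]
  have := root_ne_zero ht.ne'
  field_simp
  push_cast
  ring

theorem continuousOn_evolvedDirac (y : ℝ) :
    ContinuousOn (fun p : ℝ × ℝ => evolvedDirac p.1 y p.2) (Ioi 0 ×ˢ univ) := by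
  have h0 : ∀ p ∈ (Ioi 0 ×ˢ univ : Set (ℝ × ℝ)), p.1 ≠ 0 := fun p hp => ne_of_gt hp.1
  unfold evolvedDirac
  refine ContinuousOn.div ?_ ?_ fun p hp => root_ne_zero (h0 p hp)
  · refine Complex.continuous_exp.comp_continuousOn (continuousOn_const.mul ?_)
    refine Complex.continuous_ofReal.comp_continuousOn (ContinuousOn.div (by fun_prop)
      (by fun_prop) fun p hp => ?_)
    simpa using h0 p hp
  · refine ContinuousOn.cpow_const ?_ fun p hp => Or.inr ?_
    · fun_prop
    · simp [h0 p hp, Real.pi_ne_zero]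

/-! ### Solutions of the system give distributional solutions -/

/-- The strip `(0,T) × ℝ`. -/
abbrev strip (T : ℝ) : Set (ℝ × ℝ) := Ioo 0 T ×ˢ univ

theorem isOpen_strip (T : ℝ) : IsOpen (strip T) := isOpen_Ioo.prod isOpen_univ

/-- The waves are singular at t = 0, outside the open strip; a test function supported in the strip
makes every product extend continuously by zero. -/
theorem continuous_of_eq_zero_off {X Y : Type*} [TopologicalSpace X]
    [TopologicalSpace Y] [Zero Y] {S K : Set X} {g : X → Y} (hS : IsOpen S) (hg : ContinuousOn g S) (hK : IsClosed K) (hKS : K ⊆ S)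
    (h : ∀ p ∉ K, g p = 0) : Continuous g := by
  refine continuous_iff_continuousAt.2 fun p => ?_
  by_cases hp : p ∈ S
  · exact hg.continuousAt (hS.mem_nhds hp)
  · have h1 : g =ᶠ[𝓝 p] fun _ => 0 := by
      filter_upwards [hK.isOpen_compl.mem_nhds fun hK' => hp (hKS hK')] with q hq using h q hq
    exact continuousAt_const.congr h1.symm

theorem hasDerivAt_slice_left {g : ℝ × ℝ → ℂ} {t x : ℝ} (hg : DifferentiableAt ℝ g (t, x)) :
    HasDerivAt (fun τ => g (τ, x)) (fderiv ℝ g (t, x) (1, 0)) t := by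
  have h : HasDerivAt (fun τ : ℝ => (τ, x)) ((1 : ℝ), (0 : ℝ)) t :=
    (hasDerivAt_id t).prodMk (hasDerivAt_const t x)
  exact hg.hasFDerivAt.comp_hasDerivAt t h

theorem hasDerivAt_slice_right {g : ℝ × ℝ → ℂ} {t x : ℝ} (hg : DifferentiableAt ℝ g (t, x)) :
    HasDerivAt (fun y => g (t, y)) (fderiv ℝ g (t, x) (0, 1)) x := by
  have h : HasDerivAt (fun y : ℝ => (t, y)) ((0 : ℝ), (1 : ℝ)) x :=
    (hasDerivAt_const x t).prodMk (hasDerivAt_id x)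
  exact hg.hasFDerivAt.comp_hasDerivAt x h

/-! ### Slices of test functions and integrals of exact derivatives -/

section testFunction

variable {φ : ℝ × ℝ → ℂ}

/-- The second derivative of `φ` in the second variable. -/
def secondDeriv (φ : ℝ × ℝ → ℂ) (p : ℝ × ℝ) : ℂ :=
  fderiv ℝ (fun q => fderiv ℝ φ q (0, 1)) p (0, 1)

theorem contDiff_partial (hφ : ContDiff ℝ ∞ φ) (v : ℝ × ℝ) :
    ContDiff ℝ ∞ fun p => fderiv ℝ φ p v :=
  (hφ.fderiv_right (m := ∞) (by simp)).clm_apply contDiff_const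

theorem differentiable_of_smooth {g : ℝ × ℝ → ℂ} (hg : ContDiff ℝ ∞ g) : Differentiable ℝ g :=
  hg.differentiable (by simp)

theorem iteratedDeriv_two_slice (hφ : ContDiff ℝ ∞ φ) (p : ℝ × ℝ) :
    iteratedDeriv 2 (fun y => φ (p.1, y)) p.2 = secondDeriv φ p := by
  have h1 : deriv (fun y => φ (p.1, y)) = fun y => fderiv ℝ φ (p.1, y) (0, 1) := by
    funext y
    exact (hasDerivAt_slice_right (differentiable_of_smooth hφ _)).deriv
  rw [iteratedDeriv_succ, iteratedDeriv_one, h1]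
  exact (hasDerivAt_slice_right (g := fun q => fderiv ℝ φ q (0, 1))
    (differentiable_of_smooth (contDiff_partial hφ _) _)).deriv

theorem deriv_slice (hφ : ContDiff ℝ ∞ φ) (p : ℝ × ℝ) :
    deriv (fun τ => φ (τ, p.2)) p.1 = fderiv ℝ φ p (1, 0) :=
  (hasDerivAt_slice_left (differentiable_of_smooth hφ _)).deriv

theorem partial_eq_zero {g : ℝ × ℝ → ℂ} {p : ℝ × ℝ} (hp : p ∉ tsupport g) (v : ℝ × ℝ) :
    fderiv ℝ g p v = 0 := by
  by_contra h
  exact hp (tsupport_fderiv_apply_subset ℝ v (subset_tsupport _ h))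

theorem secondDeriv_eq_zero {p : ℝ × ℝ} (hp : p ∉ tsupport φ) : secondDeriv φ p = 0 :=
  partial_eq_zero (fun h => hp (tsupport_fderiv_apply_subset ℝ _ h)) _

/-- Fubini: on almost every slice the function and its derivative are integrable, and then the
integral of the derivative vanishes. -/
theorem integral_eq_zero_of_hasDerivAt_left {F F' : ℝ × ℝ → ℂ} (hF : Integrable F)
    (hF' : Integrable F') (h : ∀ t x, HasDerivAt (fun τ => F (τ, x)) (F' (t, x)) t) :
    ∫ p, F' p = 0 := by
  rw [Measure.volume_eq_prod] at hF hF' ⊢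
  rw [integral_prod_symm _ hF']
  refine integral_eq_zero_of_ae ?_
  filter_upwards [hF.prod_left_ae, hF'.prod_left_ae] with x h1 h2
  exact integral_eq_zero_of_hasDerivAt_of_integrable (fun t => h t x) h2 h1

theorem integral_eq_zero_of_hasDerivAt_right {F F' : ℝ × ℝ → ℂ} (hF : Integrable F)
    (hF' : Integrable F') (h : ∀ t x, HasDerivAt (fun y => F (t, y)) (F' (t, x)) x) :
    ∫ p, F' p = 0 := by
  rw [Measure.volume_eq_prod] at hF hF' ⊢
  rw [integral_prod _ hF']
  refine integral_eq_zero_of_ae ?_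
  filter_upwards [hF.prod_right_ae, hF'.prod_right_ae] with t h1 h2
  exact integral_eq_zero_of_hasDerivAt_of_integrable (fun x => h t x) h2 h1


end testFunction

/-- The integrand of the weak equation for the single wave `c(t) e^{itΔ} δ_y`. -/
def singleIntegrand (φ : ℝ × ℝ → ℂ) (c c' : ℝ → ℂ) (y : ℝ) (p : ℝ × ℝ) : ℂ :=
  evolvedDirac p.1 y p.2 * (c p.1 * (-Complex.I * fderiv ℝ φ p (1, 0) + secondDeriv φ p) -
    Complex.I * c' p.1 * φ p)

theorem singleIntegrand_eq_zero {φ : ℝ × ℝ → ℂ} {p : ℝ × ℝ} (hp : p ∉ tsupport φ)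
    (c c' : ℝ → ℂ) (y : ℝ) : singleIntegrand φ c c' y p = 0 := by
  rw [singleIntegrand, partial_eq_zero hp, secondDeriv_eq_zero hp, image_eq_zero_of_notMem_tsupport hp]
  simp

theorem continuousOn_fst {g : ℝ → ℂ} {T : ℝ} (h : ContinuousOn g (Ioo 0 T)) :
    ContinuousOn (fun p : ℝ × ℝ => g p.1) (strip T) :=
  h.comp continuous_fst.continuousOn fun _ hp => hp.1

theorem continuousOn_evolvedDirac_strip (T y : ℝ) :
    ContinuousOn (fun p : ℝ × ℝ => evolvedDirac p.1 y p.2) (strip T) :=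
  (continuousOn_evolvedDirac y).mono fun _ hp => ⟨hp.1.1, mem_univ _⟩

theorem continuous_singleIntegrand {T : ℝ} {φ : ℝ × ℝ → ℂ} (hφ : ContDiff ℝ ∞ φ)
    (hs : tsupport φ ⊆ strip T) {c c' : ℝ → ℂ} (hc : ContinuousOn c (Ioo 0 T))
    (hc' : ContinuousOn c' (Ioo 0 T)) (y : ℝ) : Continuous (singleIntegrand φ c c' y) := by
  refine continuous_of_eq_zero_off (isOpen_strip T) ?_ (isClosed_tsupport φ) hs
    fun p hp => singleIntegrand_eq_zero hp c c' y
  have h1 := (contDiff_partial hφ (1, 0)).continuous.continuousOn (s := strip T)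
  have h2 := (contDiff_partial (contDiff_partial hφ (0, 1)) (0, 1)).continuous.continuousOn
    (s := strip T)
  exact (continuousOn_evolvedDirac_strip T y).mul (((continuousOn_fst hc).mul
    ((continuousOn_const.mul h1).add h2)).sub
      ((continuousOn_const.mul (continuousOn_fst hc')).mul hφ.continuous.continuousOn))

/-- Green's formula. As E = e^{itΔ}δ_y solves the free equation, the integrand is the divergence -i
∂_t(cEφ) + ∂_x(c(E φ_x - E_x φ)); the compact support of φ in the strip leaves no boundary terms. -/
theorem integral_singleIntegrand {T : ℝ} {φ : ℝ × ℝ → ℂ} (hφ : ContDiff ℝ ∞ φ)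
    (hcs : HasCompactSupport φ) (hs : tsupport φ ⊆ strip T) {c c' : ℝ → ℂ}
    (hc : ∀ t ∈ Ioo 0 T, HasDerivAt c (c' t) t) (hc' : ContinuousOn c' (Ioo 0 T)) (y : ℝ) :
    ∫ p, singleIntegrand φ c c' y p = 0 := by
  have hcc : ContinuousOn c (Ioo 0 T) := fun t ht => (hc t ht).continuousAt.continuousWithinAt
  set E : ℝ × ℝ → ℂ := fun p => evolvedDirac p.1 y p.2 with hE
  set ex : ℝ × ℝ → ℂ := fun p => Complex.I * ((p.2 - y) / (2 * p.1) : ℝ) with hex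
  set et : ℝ × ℝ → ℂ := fun p =>
    -Complex.I * ((p.2 - y) ^ 2 / (4 * p.1 ^ 2) : ℝ) - 1 / (2 * p.1) with het
  set φt : ℝ × ℝ → ℂ := fun p => fderiv ℝ φ p (1, 0) with hφt
  set φx : ℝ × ℝ → ℂ := fun p => fderiv ℝ φ p (0, 1) with hφx
  have c1 := continuousOn_evolvedDirac_strip T y
  have c2 : ContinuousOn ex (strip T) := by
    refine continuousOn_const.mul (Complex.continuous_ofReal.comp_continuousOn
      (ContinuousOn.div (by fun_prop) (by fun_prop) fun p hp => ?_))
    simpa using hp.1.1.ne'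
  have c3 : ContinuousOn et (strip T) := by
    refine (continuousOn_const.mul (Complex.continuous_ofReal.comp_continuousOn
      (ContinuousOn.div (by fun_prop) (by fun_prop) fun p hp => ?_))).sub
      (ContinuousOn.div continuousOn_const (by fun_prop) fun p hp => ?_)
    · simpa using hp.1.1.ne'
    · simpa using hp.1.1.ne'
  have c4 : ContinuousOn φ (strip T) := hφ.continuous.continuousOn
  have c5 : ContinuousOn φt (strip T) := (contDiff_partial hφ (1, 0)).continuous.continuousOn
  have c6 : ContinuousOn φx (strip T) := (contDiff_partial hφ (0, 1)).continuous.continuousOn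
  have c7 : ContinuousOn (secondDeriv φ) (strip T) :=
    (contDiff_partial (contDiff_partial hφ (0, 1)) (0, 1)).continuous.continuousOn
  have c8 := continuousOn_fst hcc
  have c9 := continuousOn_fst hc'
  have c10 : ContinuousOn (fun p : ℝ × ℝ => Complex.I * ((1 / (2 * p.1) : ℝ) : ℂ)) (strip T) := by
    refine continuousOn_const.mul (Complex.continuous_ofReal.comp_continuousOn
      (ContinuousOn.div (by fun_prop) (by fun_prop) fun p hp => ?_))
    simpa using hp.1.1.ne'
  have z1 : ∀ p ∉ tsupport φ, φ p = 0 := fun p hp => image_eq_zero_of_notMem_tsupport hp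
  have z2 : ∀ p ∉ tsupport φ, φt p = 0 := fun p hp => partial_eq_zero hp _
  have z3 : ∀ p ∉ tsupport φ, φx p = 0 := fun p hp => partial_eq_zero hp _
  have z4 : ∀ p ∉ tsupport φ, secondDeriv φ p = 0 := fun p hp => secondDeriv_eq_zero hp
  have hint : ∀ g : ℝ × ℝ → ℂ, ContinuousOn g (strip T) → (∀ p ∉ tsupport φ, g p = 0) →
      Integrable g := fun g hg h0 =>
    (continuous_of_eq_zero_off (isOpen_strip T) hg (isClosed_tsupport φ) hs
      h0).integrable_of_hasCompactSupport (HasCompactSupport.intro hcs h0)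
  have hnhds : ∀ p ∉ tsupport φ, ∀ᶠ q in 𝓝 p, q ∉ tsupport φ := fun p hp =>
    (isClosed_tsupport φ).isOpen_compl.mem_nhds hp
  set F : ℝ × ℝ → ℂ := fun p => c p.1 * E p * φ p with hF
  set F' : ℝ × ℝ → ℂ := fun p =>
    (c' p.1 * E p + c p.1 * (E p * et p)) * φ p + c p.1 * E p * φt p with hF'
  set G : ℝ × ℝ → ℂ := fun p => c p.1 * (E p * φx p - E p * ex p * φ p) with hG
  set G' : ℝ × ℝ → ℂ := fun p => c p.1 * ((E p * ex p * φx p + E p * secondDeriv φ p) -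
    ((E p * ex p * ex p + E p * (Complex.I * ((1 / (2 * p.1) : ℝ) : ℂ))) * φ p +
      E p * ex p * φx p)) with hG'
  have hFi : Integrable F := hint F ((c8.mul c1).mul c4) fun p hp => by simp [hF, z1 p hp]
  have hFi' : Integrable F' := hint F' ((((c9.mul c1).add (c8.mul (c1.mul c3))).mul c4).add
    ((c8.mul c1).mul c5)) fun p hp => by simp [hF', z1 p hp, z2 p hp]
  have hGi : Integrable G := hint G (c8.mul ((c1.mul c6).sub ((c1.mul c2).mul c4)))
    fun p hp => by simp [hG, z1 p hp, z3 p hp]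
  have hGi' : Integrable G' := hint G' (c8.mul ((((c1.mul c2).mul c6).add (c1.mul c7)).sub
    (((((c1.mul c2).mul c2).add (c1.mul c10)).mul c4).add ((c1.mul c2).mul c6))))
    fun p hp => by simp [hG', z1 p hp, z3 p hp, z4 p hp]
  have hFd : ∀ t x, HasDerivAt (fun τ => F (τ, x)) (F' (t, x)) t := by
    intro t x
    by_cases hp : (t, x) ∈ tsupport φ
    · have ht := (hs hp).1
      exact ((hc t ht).mul (hasDerivAt_evolvedDirac_left ht.1 y x)).mul
        (hasDerivAt_slice_left (differentiable_of_smooth hφ _))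
    · have e : F' (t, x) = 0 := by simp [hF', z1 _ hp, z2 _ hp]
      rw [e]
      refine (hasDerivAt_const t (0 : ℂ)).congr_of_eventuallyEq ?_
      have hcont : ContinuousAt (fun τ : ℝ => (τ, x)) t := by fun_prop
      filter_upwards [hcont.eventually (hnhds _ hp)] with τ hτ
      simp [hF, z1 _ hτ]
  have hGd : ∀ t x, HasDerivAt (fun y => G (t, y)) (G' (t, x)) x := by
    intro t x
    have d1 := hasDerivAt_evolvedDirac_right t y x
    have d2 : HasDerivAt (fun x : ℝ => Complex.I * ((x - y) / (2 * t) : ℝ))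
        (Complex.I * ((1 / (2 * t) : ℝ) : ℂ)) x :=
      ((((hasDerivAt_id x).sub_const y).div_const (2 * t)).ofReal_comp).const_mul Complex.I
    have d3 := hasDerivAt_slice_right (differentiable_of_smooth hφ (t, x))
    have d4 := hasDerivAt_slice_right (g := φx)
      (differentiable_of_smooth (contDiff_partial hφ (0, 1)) (t, x))
    exact ((d1.mul d4).sub ((d1.mul d2).mul d3)).const_mul (c t)
  have h1 := integral_eq_zero_of_hasDerivAt_left hFi hFi' hFd
  have h2 := integral_eq_zero_of_hasDerivAt_right hGi hGi' hGd
  have e : ∀ p, singleIntegrand φ c c' y p = -Complex.I * F' p + G' p := by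
    intro p
    by_cases hp : p ∈ tsupport φ
    · have ht := (hs hp).1.1
      have ht0 : (p.1 : ℂ) ≠ 0 := by exact_mod_cast ht.ne'
      -- The free equation for E, divided by E: `et` and `ex` are its logarithmic derivatives.
      have key : -Complex.I * et p - (ex p * ex p + Complex.I * ((1 / (2 * p.1) : ℝ) : ℂ)) = 0 := by
        simp only [het, hex]
        push_cast
        field_simp
        ring
      simp only [singleIntegrand, hF', hG']
      linear_combination (-(c p.1 * E p * φ p)) * key
    · simp only [singleIntegrand, hF', hG', z1 p hp, z4 p hp, z3 p hp, z2 p hp]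
      simp [partial_eq_zero hp]
  simp only [e]
  rw [integral_add (hFi'.const_mul _) hGi', integral_const_mul, h1, h2]
  simp

theorem aestronglyMeasurable_tsum {ι X : Type*} [Countable ι] [MeasurableSpace X]
    {μ : Measure X} {f : ι → X → ℂ} (hf : ∀ n, AEStronglyMeasurable (f n) μ)
    (hs : ∀ᵐ x ∂μ, Summable fun n => f n x) :
    AEStronglyMeasurable (fun x => ∑' n, f n x) μ := by
  refine aestronglyMeasurable_of_tendsto_ae atTop
    (f := fun (s : Finset ι) x => ∑ n ∈ s, f n x)
    (fun s => Finset.aestronglyMeasurable_fun_sum s fun n _ => hf n) ?_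
  filter_upwards [hs] with x hx using hx.hasSum

/-- The only singularity is at t = 0. On a box with times above half of the given one, monotonicity
of the bound gives a constant. -/
theorem locallyIntegrableOn_strip {T : ℝ} {f : ℝ × ℝ → ℂ} {g : ℝ → ℝ}
    (hf : AEStronglyMeasurable f (volume.restrict (strip T))) (hg : AntitoneOn g (Ioo 0 T))
    (hfg : ∀ p ∈ strip T, ‖f p‖ ≤ g p.1) : LocallyIntegrableOn f (strip T) := by
  intro p hp
  have hp1 := hp.1
  set U : Set (ℝ × ℝ) := Ioo (p.1 / 2) T ×ˢ Ioo (p.2 - 1) (p.2 + 1) with hU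
  have hUs : U ⊆ strip T := fun q hq => ⟨⟨(half_pos hp1.1).trans hq.1.1, hq.1.2⟩, mem_univ _⟩
  have hUm : MeasurableSet U := measurableSet_Ioo.prod measurableSet_Ioo
  have hUn : U ∈ 𝓝 p := by
    refine (isOpen_Ioo.prod isOpen_Ioo).mem_nhds ⟨⟨half_lt_self hp1.1, hp1.2⟩, ?_⟩
    constructor <;> linarith
  refine ⟨U, mem_nhdsWithin_of_mem_nhds hUn, ?_⟩
  have hfin : volume U < ⊤ := by
    rw [hU, Measure.volume_eq_prod, Measure.prod_prod]
    exact ENNReal.mul_lt_top measure_Ioo_lt_top measure_Ioo_lt_top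
  have : IsFiniteMeasure (volume.restrict U) := ⟨by simpa using hfin⟩
  refine Integrable.of_bound (hf.mono_set hUs) (g (p.1 / 2)) ?_
  filter_upwards [ae_restrict_mem hUm] with q hq
  refine (hfg q (hUs hq)).trans (hg ⟨half_pos hp1.1, ?_⟩ (hUs hq).1 hq.1.1.le)
  linarith [hp1.1, hp1.2]

theorem antitoneOn_div_sqrt {T K : ℝ} (hK : 0 ≤ K) :
    AntitoneOn (fun t => K / Real.sqrt (4 * Real.pi * |t|)) (Ioo 0 T) := by
  intro t ht t' ht' htt
  refine div_le_div_of_nonneg_left hK (Real.sqrt_pos.2 (by have := ht.1; positivity)) ?_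
  refine Real.sqrt_le_sqrt ?_
  rw [abs_of_pos ht.1, abs_of_pos ht'.1]
  have := Real.pi_pos
  gcongr

theorem force_eq (a b σ M : ℝ) {t : ℝ} (ht : 0 < t) (A : Idx → ℂ) (n : Idx) :
    -Complex.I * force a b σ M t A n = (σ / 2 : ℝ) *
      (((1 / (4 * Real.pi * |t|) : ℝ) : ℂ) * cubic a b (1 / t) A n -
        ((M / (2 * Real.pi * t) : ℝ) : ℂ) * A n) := by
  have hπ : (Real.pi : ℂ) ≠ 0 := by exact_mod_cast Real.pi_ne_zero
  have htc : (t : ℂ) ≠ 0 := by exact_mod_cast ht.ne'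
  rw [force, abs_of_pos ht]
  push_cast
  field_simp
  simp only [Complex.I_sq]
  ring

/-- The nonlinearity of the equation, expanded in evolved Dirac masses. -/
theorem nonlinearity_wave {A : Idx → ℂ} (hA : Summable fun n => ‖A n‖) (a b σ M : ℝ) {t : ℝ}
    (ht : 0 < t) (x : ℝ) :
    (σ / 2 : ℝ) * ((‖wave a b A t x‖ ^ 2 - M / (2 * Real.pi * t) : ℝ) : ℂ) * wave a b A t x =
      -Complex.I * wave a b (force a b σ M t A) t x := by
  have h := cubic_wave hA a b t x
  have e : -Complex.I * wave a b (force a b σ M t A) t x = (σ / 2 : ℝ) *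
      (((1 / (4 * Real.pi * |t|) : ℝ) : ℂ) * wave a b (cubic a b (1 / t) A) t x -
        ((M / (2 * Real.pi * t) : ℝ) : ℂ) * wave a b A t x) := by
    simp only [wave]
    rw [← tsum_mul_left, ← tsum_mul_left, ← tsum_mul_left,
      ← ((summable_mul_evolvedDirac (summable_cubic hA a b (1 / t)) a b t x).of_norm.mul_left
        _).tsum_sub ((summable_mul_evolvedDirac hA a b t x).of_norm.mul_left _), ← tsum_mul_left]
    refine tsum_congr fun n => ?_
    rw [← mul_assoc, force_eq a b σ M ht]
    ring
  rw [e, ← h]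
  push_cast
  ring

/-- After expansion in waves the weak equation is a series of terms each of which integrates to zero
by `integral_singleIntegrand`. The remaining work is to exchange sum and integral. -/
theorem isDistribSolution_of_hasDerivAt {a b σ M T C : ℝ} (hσ : σ = 1 ∨ σ = -1) (hM : 0 ≤ M)
    {A : ℝ → Idx → ℂ} (hA : ∀ t ∈ Ioo 0 T, Summable fun n => ‖A t n‖)
    (hAb : ∀ t ∈ Ioo 0 T, ∑' n, ‖A t n‖ ≤ C)
    (hd : ∀ t ∈ Ioo 0 T, ∀ n, HasDerivAt (fun τ => A τ n) (force a b σ M t (A t) n) t)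
    (hdc : ∀ n, ContinuousOn (fun t => force a b σ M t (A t) n) (Ioo 0 T)) {u : ℝ → ℝ → ℂ}
    (hu : ∀ t ∈ Ioo 0 T, ∀ x, u t x = wave a b (A t) t x) : IsDistribSolution σ M T u := by
  have hAc : ∀ n, ContinuousOn (fun t => A t n) (Ioo 0 T) := fun n t ht =>
    (hd t ht n).continuousAt.continuousWithinAt
  have hSm : MeasurableSet (strip T) := (isOpen_strip T).measurableSet
  by_cases hT : T ≤ 0
  · have he : Ioo 0 T = ∅ := Ioo_eq_empty (not_lt.2 hT)
    refine ⟨by simp [he, LocallyIntegrableOn], by simp [he, LocallyIntegrableOn],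
      fun φ _ _ hs => ?_⟩
    rw [he, empty_prod, subset_empty_iff, tsupport_eq_empty_iff] at hs
    simp [hs]
  rw [not_le] at hT
  have hC : 0 ≤ C := (tsum_nonneg fun _ => norm_nonneg _).trans
    (hAb (T / 2) ⟨by linarith, by linarith⟩)
  have hmeas : AEStronglyMeasurable (fun p : ℝ × ℝ => u p.1 p.2) (volume.restrict (strip T)) := by
    have h : AEStronglyMeasurable (fun p : ℝ × ℝ => wave a b (A p.1) p.1 p.2)
        (volume.restrict (strip T)) := by
      refine aestronglyMeasurable_tsum (fun n => ?_) ?_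
      · exact ((continuousOn_fst (hAc n)).mul
          (continuousOn_evolvedDirac_strip T _)).aestronglyMeasurable hSm
      · filter_upwards [ae_restrict_mem hSm] with p hp
        exact (summable_mul_evolvedDirac (hA _ hp.1) a b p.1 p.2).of_norm
    refine h.congr ?_
    filter_upwards [ae_restrict_mem hSm] with p hp using (hu _ hp.1 _).symm
  have hbound : ∀ p ∈ strip T, ‖u p.1 p.2‖ ≤ C / Real.sqrt (4 * Real.pi * |p.1|) := fun p hp => by
    rw [hu _ hp.1]
    exact (norm_wave_le (hA _ hp.1) a b p.1 p.2).trans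
      (div_le_div_of_nonneg_right (hAb _ hp.1) (Real.sqrt_nonneg _))
  refine ⟨locallyIntegrableOn_strip hmeas (antitoneOn_div_sqrt hC) hbound,
    locallyIntegrableOn_strip (g := fun t => (C / Real.sqrt (4 * Real.pi * |t|)) ^ 3)
      (AEStronglyMeasurable.mul ?_ hmeas) ?_ ?_, fun φ hφ hcs hs => ?_⟩
  · exact Complex.continuous_ofReal.comp_aestronglyMeasurable (hmeas.norm.pow 2)
  · intro t ht t' ht' htt
    exact pow_le_pow_left₀ (by positivity) (antitoneOn_div_sqrt hC ht ht' htt) 3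
  · intro p hp
    rw [norm_mul, Complex.norm_real, Real.norm_of_nonneg (by positivity), ← pow_succ]
    exact pow_le_pow_left₀ (norm_nonneg _) (hbound p hp) 3
  have hcomp : ∀ p, (u p.1 p.2 *
        (-Complex.I * deriv (fun τ => φ (τ, p.2)) p.1 + iteratedDeriv 2 (fun y => φ (p.1, y)) p.2)
      + (σ / 2 : ℝ) * ((‖u p.1 p.2‖ ^ 2 - M / (2 * Real.pi * p.1) : ℝ) : ℂ) * u p.1 p.2 * φ p) =
      ∑' n, singleIntegrand φ (fun t => A t n) (fun t => force a b σ M t (A t) n) (pt a b n) p := by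
    intro p
    rw [deriv_slice hφ, iteratedDeriv_two_slice hφ]
    by_cases hp : p ∈ tsupport φ
    · have ht := (hs hp).1
      rw [hu _ ht, nonlinearity_wave (hA _ ht) a b σ M ht.1]
      have s1 := (summable_mul_evolvedDirac (hA _ ht) a b p.1 p.2).of_norm
      have s2 := (summable_mul_evolvedDirac (summable_force (hA _ ht) a b σ M p.1) a b p.1
        p.2).of_norm
      simp only [wave]
      rw [← tsum_mul_right, ← tsum_mul_left, ← tsum_mul_right,
        ← (s1.mul_right _).tsum_add ((s2.mul_left _).mul_right _)]
      refine tsum_congr fun n => ?_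
      rw [singleIntegrand]
      ring
    · simp [singleIntegrand_eq_zero hp, partial_eq_zero hp, secondDeriv_eq_zero hp,
        image_eq_zero_of_notMem_tsupport hp]
  simp only [hcomp]
  -- The support stays away from t = 0, so the factors t^{-1/2} of the waves and 1/t of the force
  -- are bounded on it; this yields the constant `Q` below.
  obtain ⟨t₁, ht₁, hK⟩ : ∃ t₁ > 0, ∀ p ∈ tsupport φ, t₁ ≤ p.1 := by
    rcases (tsupport φ).eq_empty_or_nonempty with he | hne
    · exact ⟨1, one_pos, by simp [he]⟩
    · obtain ⟨p, hp, hmin⟩ := hcs.isCompact.exists_isMinOn hne continuous_fst.continuousOn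
      exact ⟨p.1, (hs hp).1.1, fun q hq => hmin hq⟩
  obtain ⟨D, hD⟩ : ∃ D, ∀ p, ‖-Complex.I * fderiv ℝ φ p (1, 0) + secondDeriv φ p‖ ≤ D ∧
      ‖φ p‖ ≤ D := by
    have k1 : Continuous fun p => -Complex.I * fderiv ℝ φ p (1, 0) + secondDeriv φ p :=
      (continuous_const.mul (contDiff_partial hφ (1, 0)).continuous).add
        (contDiff_partial (contDiff_partial hφ (0, 1)) (0, 1)).continuous
    obtain ⟨D₁, h₁⟩ := k1.bounded_above_of_compact_support (HasCompactSupport.intro hcs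
      fun p hp => by simp [partial_eq_zero hp, secondDeriv_eq_zero hp])
    obtain ⟨D₂, h₂⟩ := hφ.continuous.bounded_above_of_compact_support hcs
    exact ⟨max D₁ D₂, fun p => ⟨(h₁ p).trans (le_max_left _ _), (h₂ p).trans (le_max_right _ _)⟩⟩
  have hD0 : 0 ≤ D := (norm_nonneg _).trans (hD 0).2
  set Q : ℝ := D / Real.sqrt (4 * Real.pi * t₁) *
    (C + (3 * C ^ 2 + 2 * M) * C / (8 * Real.pi * t₁)) with hQ
  have hterm : ∀ p, Summable (fun n => ‖singleIntegrand φ (fun t => A t n)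
      (fun t => force a b σ M t (A t) n) (pt a b n) p‖) ∧ ∑' n, ‖singleIntegrand φ (fun t => A t n)
      (fun t => force a b σ M t (A t) n) (pt a b n) p‖ ≤ (tsupport φ).indicator (fun _ => Q) p := by
    intro p
    by_cases hp : p ∈ tsupport φ
    · have ht := (hs hp).1
      have hsum := (hA _ ht).add (summable_force (hA _ ht) a b σ M p.1)
      have hle : ∀ n, ‖singleIntegrand φ (fun t => A t n) (fun t => force a b σ M t (A t) n)
          (pt a b n) p‖ ≤ D / Real.sqrt (4 * Real.pi * t₁) *
            (‖A p.1 n‖ + ‖force a b σ M p.1 (A p.1) n‖) := by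
        intro n
        rw [singleIntegrand, norm_mul, norm_evolvedDirac, div_mul_eq_mul_div, div_mul_eq_mul_div,
          one_mul, abs_of_pos ht.1]
        refine div_le_div₀ (by positivity) ?_ (Real.sqrt_pos.2 (by positivity))
          (Real.sqrt_le_sqrt (mul_le_mul_of_nonneg_left (hK p hp) (by positivity)))
        refine (norm_sub_le _ _).trans ?_
        rw [norm_mul, norm_mul, norm_mul, Complex.norm_I, one_mul, mul_add, mul_comm D, mul_comm D]
        exact add_le_add (mul_le_mul_of_nonneg_left (hD p).1 (norm_nonneg _))
          (mul_le_mul_of_nonneg_left (hD p).2 (norm_nonneg _))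
      have hsum' := Summable.of_nonneg_of_le (fun _ => norm_nonneg _) hle (hsum.mul_left _)
      refine ⟨hsum', ?_⟩
      rw [indicator_of_mem hp]
      refine (hsum'.tsum_le_tsum hle (hsum.mul_left _)).trans ?_
      rw [tsum_mul_left, (hA _ ht).tsum_add (summable_force (hA _ ht) a b σ M p.1), hQ]
      refine mul_le_mul_of_nonneg_left (add_le_add (hAb _ ht) ?_) (by positivity)
      refine (tsum_norm_force_le hσ a b p.1 (hA _ ht) (hAb _ ht) hM).trans ?_
      rw [abs_of_pos ht.1]
      refine div_le_div_of_nonneg_left (by positivity) (by positivity) ?_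
      exact mul_le_mul_of_nonneg_left (hK p hp) (by positivity)
    · simp [singleIntegrand_eq_zero hp, hp, summable_zero]
  rw [integral_tsum]
  · simp only [integral_singleIntegrand hφ hcs hs (fun t ht => hd t ht _) (hdc _), tsum_zero]
  · exact fun n => (continuous_singleIntegrand hφ hs (hAc n) (hdc n) _).aestronglyMeasurable
  · rw [← lintegral_tsum fun n =>
      (continuous_singleIntegrand hφ hs (hAc n) (hdc n) _).enorm.measurable.aemeasurable]
    have hle : ∀ p, ∑' n, ‖singleIntegrand φ (fun t => A t n)
        (fun t => force a b σ M t (A t) n) (pt a b n) p‖ₑ ≤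
        (tsupport φ).indicator (fun _ => ENNReal.ofReal Q) p := by
      intro p
      have h := hterm p
      simp only [← ofReal_norm]
      rw [← ENNReal.ofReal_tsum_of_nonneg (fun _ => norm_nonneg _) h.1]
      refine (ENNReal.ofReal_le_ofReal h.2).trans (le_of_eq ?_)
      by_cases hp : p ∈ tsupport φ <;> simp [hp]
    refine ne_of_lt ((lintegral_mono hle).trans_lt ?_)
    rw [lintegral_indicator (isClosed_tsupport φ).measurableSet, setLIntegral_const]
    exact ENNReal.mul_lt_top ENNReal.ofReal_lt_top hcs.isCompact.measure_lt_top

/-! ### Test functions that single out one coefficient -/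

/-- A test function that oscillates like the complex conjugate of `e^{itΔ} δ_y`. -/
def probe (ψ χ : ℝ → ℂ) (y L : ℝ) (p : ℝ × ℝ) : ℂ :=
  ψ p.1 * χ ((p.2 - y) / (p.1 * L)) *
    Complex.exp (-Complex.I * ((p.2 - y) ^ 2 / (4 * p.1) : ℝ))

section probe

variable {T y L : ℝ} {ψ χ : ℝ → ℂ}

theorem contDiff_probe (hL : 0 < L) (hψ : ContDiff ℝ ∞ ψ) (hψT : tsupport ψ ⊆ Ioo 0 T)
    (hχ : ContDiff ℝ ∞ χ) : ContDiff ℝ ∞ (probe ψ χ y L) := by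
  refine contDiff_iff_contDiffAt.2 fun p => ?_
  by_cases hp : p.1 ∈ tsupport ψ
  · have h0 : p.1 ≠ 0 := (hψT hp).1.ne'
    have h1 : ContDiffAt ℝ ∞ (fun p : ℝ × ℝ => (p.2 - y) / (p.1 * L)) p :=
      (contDiffAt_snd.sub contDiffAt_const).div (contDiffAt_fst.mul contDiffAt_const)
        (mul_ne_zero h0 hL.ne')
    have h2 : ContDiffAt ℝ ∞ (fun p : ℝ × ℝ => (p.2 - y) ^ 2 / (4 * p.1)) p :=
      ((contDiffAt_snd.sub contDiffAt_const).pow 2).div (contDiffAt_const.mul contDiffAt_fst)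
        (mul_ne_zero four_ne_zero h0)
    refine ((hψ.contDiffAt.comp p contDiffAt_fst).mul (hχ.contDiffAt.comp p h1)).mul ?_
    exact (contDiffAt_const.mul (Complex.ofRealCLM.contDiff.contDiffAt.comp p h2)).cexp
  · have h1 : probe ψ χ y L =ᶠ[𝓝 p] fun _ => 0 := by
      have h2 : ∀ᶠ q : ℝ × ℝ in 𝓝 p, q.1 ∉ tsupport ψ :=
        continuous_fst.continuousAt.eventually ((isClosed_tsupport ψ).isOpen_compl.mem_nhds hp)
      filter_upwards [h2] with q hq
      simp [probe, image_eq_zero_of_notMem_tsupport hq]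
    exact contDiffAt_const.congr_of_eventuallyEq h1

theorem exists_compact_probe (hL : 0 < L) (hψc : HasCompactSupport ψ)
    (hψT : tsupport ψ ⊆ Ioo 0 T) (hχc : HasCompactSupport χ) :
    HasCompactSupport (probe ψ χ y L) ∧ tsupport (probe ψ χ y L) ⊆ tsupport ψ ×ˢ univ := by
  obtain ⟨r, hr⟩ := hχc.isCompact.isBounded.subset_closedBall 0
  set K : Set (ℝ × ℝ) := tsupport ψ ×ˢ Metric.closedBall y (r * (T * L)) with hK
  have hKc : IsCompact K := hψc.isCompact.prod (isCompact_closedBall _ _)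
  have h0 : ∀ p ∉ K, probe ψ χ y L p = 0 := by
    intro p hp
    by_contra h
    apply hp
    have hp1 : p.1 ∈ tsupport ψ := by
      by_contra h1
      exact h (by simp [probe, image_eq_zero_of_notMem_tsupport h1])
    have hp2 : (p.2 - y) / (p.1 * L) ∈ tsupport χ := by
      by_contra h1
      exact h (by simp [probe, image_eq_zero_of_notMem_tsupport h1])
    refine ⟨hp1, ?_⟩
    have h1 := hr hp2
    have h2 := hψT hp1
    rw [mem_closedBall_zero_iff, norm_div, Real.norm_of_nonneg (mul_pos h2.1 hL).le,
      div_le_iff₀ (mul_pos h2.1 hL)] at h1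
    have hr0 : 0 ≤ r := by
      have := (norm_nonneg _).trans (mem_closedBall_zero_iff.1 (hr hp2)); exact this
    rw [Metric.mem_closedBall, dist_eq_norm]
    refine h1.trans (mul_le_mul_of_nonneg_left ?_ hr0)
    exact mul_le_mul_of_nonneg_right h2.2.le hL.le
  refine ⟨HasCompactSupport.intro hKc h0, ?_⟩
  refine (closure_minimal (fun p hp => ?_) hKc.isClosed).trans
    (prod_mono_right (subset_univ _))
  by_contra h
  exact hp (h0 p h)

/-- The adjoint equation satisfied by the test function. -/
theorem adjoint_probe (hL : 0 < L) {ψ' χ' χ'' : ℝ → ℂ} (hψ : ∀ t, HasDerivAt ψ (ψ' t) t)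
    (hχ : ∀ z, HasDerivAt χ (χ' z) z) (hχ' : ∀ z, HasDerivAt χ' (χ'' z) z) {t : ℝ} (ht : 0 < t)
    (x : ℝ) :
    -Complex.I * deriv (fun τ => probe ψ χ y L (τ, x)) t +
      iteratedDeriv 2 (fun z => probe ψ χ y L (t, z)) x =
    Complex.exp (-Complex.I * ((x - y) ^ 2 / (4 * t) : ℝ)) *
      (-Complex.I * (ψ' t + ψ t / (2 * t)) * χ ((x - y) / (t * L)) +
        ψ t * χ'' ((x - y) / (t * L)) / (t * L) ^ 2) := by
  have ht0 : (t : ℂ) ≠ 0 := by exact_mod_cast ht.ne'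
  have hL0 : (L : ℂ) ≠ 0 := by exact_mod_cast hL.ne'
  set e : ℝ → ℝ → ℂ := fun t x => Complex.exp (-Complex.I * ((x - y) ^ 2 / (4 * t) : ℝ)) with he
  have het : HasDerivAt (fun τ => e τ x) (e t x * (-Complex.I * (-((x - y) ^ 2 / (4 * t ^ 2)) : ℝ)))
      t := by
    have h1 : HasDerivAt (fun t : ℝ => (x - y) ^ 2 / (4 * t)) (-((x - y) ^ 2 / (4 * t ^ 2))) t := by
      have h := (((hasDerivAt_id t).const_mul 4).inv (by simpa using ht.ne')).const_mul
        ((x - y) ^ 2)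
      refine (h.congr_deriv ?_).congr_of_eventuallyEq (Eventually.of_forall fun τ => ?_)
      · simp only [id]
        field_simp
      · simp [div_eq_mul_inv]
    exact (h1.ofReal_comp.const_mul (-Complex.I)).cexp
  have hex : ∀ x, HasDerivAt (fun z => e t z) (e t x * (-Complex.I * ((x - y) / (2 * t) : ℝ)))
      x := by
    intro x
    have h1 : HasDerivAt (fun x : ℝ => (x - y) ^ 2 / (4 * t)) ((x - y) / (2 * t)) x := by
      refine ((((hasDerivAt_id x).sub_const y).pow 2).div_const (4 * t)).congr_deriv ?_
      simp only [id]
      field_simp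
      norm_num
      ring
    exact (h1.ofReal_comp.const_mul (-Complex.I)).cexp
  have hlx : ∀ x, HasDerivAt (fun z : ℝ => (z - y) / (t * L)) (1 / (t * L)) x := fun x =>
    ((hasDerivAt_id x).sub_const y).div_const (t * L)
  have hlt : HasDerivAt (fun τ : ℝ => (x - y) / (τ * L)) (-((x - y) / (t ^ 2 * L))) t := by
    have h := (((hasDerivAt_id t).mul_const L).inv (by simpa using ⟨ht.ne', hL.ne'⟩)).const_mul
      (x - y)
    refine (h.congr_deriv ?_).congr_of_eventuallyEq (Eventually.of_forall fun τ => ?_)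
    · simp only [id]
      field_simp
    · simp [div_eq_mul_inv]
  have hdx : ∀ x, HasDerivAt (fun z => (z - y) / (2 * t)) (1 / (2 * t)) x := fun x =>
    ((hasDerivAt_id x).sub_const y).div_const (2 * t)
  have d1 : HasDerivAt (fun τ => probe ψ χ y L (τ, x))
      ((ψ' t * χ ((x - y) / (t * L)) +
        ψ t * ((-((x - y) / (t ^ 2 * L)) : ℝ) • χ' ((x - y) / (t * L)))) * e t x +
        ψ t * χ ((x - y) / (t * L)) *
          (e t x * (-Complex.I * (-((x - y) ^ 2 / (4 * t ^ 2)) : ℝ)))) t :=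
    ((hψ t).mul ((hχ _).scomp t hlt)).mul het
  have d2 : ∀ x, HasDerivAt (fun z => probe ψ χ y L (t, z))
      (ψ t * ((1 / (t * L) : ℝ) • χ' ((x - y) / (t * L))) * e t x +
        ψ t * χ ((x - y) / (t * L)) * (e t x * (-Complex.I * ((x - y) / (2 * t) : ℝ)))) x :=
    fun x => ((((hχ _).scomp x (hlx x)).const_mul (ψ t))).mul (hex x)
  have d3 : HasDerivAt (fun x =>
      (ψ t * ((1 / (t * L) : ℝ) • χ' ((x - y) / (t * L))) * e t x +
        ψ t * χ ((x - y) / (t * L)) * (e t x * (-Complex.I * ((x - y) / (2 * t) : ℝ)))))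
      ((ψ t * ((1 / (t * L) : ℝ) • ((1 / (t * L) : ℝ) • χ'' ((x - y) / (t * L)))) * e t x +
        ψ t * ((1 / (t * L) : ℝ) • χ' ((x - y) / (t * L))) *
          (e t x * (-Complex.I * ((x - y) / (2 * t) : ℝ)))) +
        (ψ t * ((1 / (t * L) : ℝ) • χ' ((x - y) / (t * L))) *
          (e t x * (-Complex.I * ((x - y) / (2 * t) : ℝ))) +
        ψ t * χ ((x - y) / (t * L)) *
          (e t x * (-Complex.I * ((x - y) / (2 * t) : ℝ)) * (-Complex.I * ((x - y) / (2 * t) : ℝ)) +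
            e t x * (-Complex.I * ((1 / (2 * t) : ℝ) : ℂ))))) x := by
    refine HasDerivAt.add ?_ ?_
    · exact ((((hχ' _).scomp x (hlx x)).const_smul (1 / (t * L) : ℝ)).const_mul (ψ t)).mul (hex x)
    · exact (((hχ _).scomp x (hlx x)).const_mul (ψ t)).mul
        ((hex x).mul ((hdx x).ofReal_comp.const_mul (-Complex.I)))
  rw [d1.deriv, iteratedDeriv_succ, iteratedDeriv_one, funext fun x => (d2 x).deriv, d3.deriv]
  change _ = e t x * _
  generalize e t x = E
  generalize χ ((x - y) / (t * L)) = X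
  generalize χ' ((x - y) / (t * L)) = X'
  generalize χ'' ((x - y) / (t * L)) = X''
  simp only [Complex.real_smul]
  push_cast
  field_simp
  ring

/-- In the variable z = (x - y)/(tL) the quadratic phases cancel. What remains is linear in z with
frequency L(y - v)/2, independent of t, and zero exactly for the wave centred at y. -/
theorem evolvedDirac_mul_probe {t : ℝ} (ht : 0 < t) (v z : ℝ) :
    evolvedDirac t v (t * L * z + y) *
      Complex.exp (-Complex.I * ((t * L * z + y - y) ^ 2 / (4 * t) : ℝ)) =
    ((4 * Real.pi * Complex.I * t : ℂ) ^ (1 / 2 : ℂ))⁻¹ *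
      Complex.exp (Complex.I * ((y - v) ^ 2 / (4 * t) : ℝ)) *
      Complex.exp (Complex.I * (L * z * (y - v) / 2 : ℝ)) := by
  have ht0 : (t : ℂ) ≠ 0 := by exact_mod_cast ht.ne'
  have h : Complex.exp (Complex.I * ((t * L * z + y - v) ^ 2 / (4 * t) : ℝ)) *
      Complex.exp (-Complex.I * ((t * L * z + y - y) ^ 2 / (4 * t) : ℝ)) =
      Complex.exp (Complex.I * ((y - v) ^ 2 / (4 * t) : ℝ)) *
        Complex.exp (Complex.I * (L * z * (y - v) / 2 : ℝ)) := by
    rw [← Complex.exp_add, ← Complex.exp_add]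
    congr 1
    push_cast
    field_simp
    ring
  rw [evolvedDirac]
  linear_combination ((4 * Real.pi * Complex.I * t : ℂ) ^ (1 / 2 : ℂ))⁻¹ * h

/-- The Riemann-Lebesgue lemma along the widths L = k + 1. -/
theorem tendsto_fourier_zero {f : ℝ → ℂ} {c : ℝ} (hc : c ≠ 0) :
    Tendsto (fun k : ℕ => ∫ z : ℝ, Complex.exp (Complex.I * (((k : ℝ) + 1) * z * c / 2 : ℝ)) * f z)
      atTop (𝓝 0) := by
  have h1 := Real.tendsto_integral_exp_smul_cocompact f
  have h2 : Tendsto (fun k : ℕ => ((k : ℝ) + 1) * (-c / (4 * Real.pi))) atTop (cocompact ℝ) := by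
    have h3 : Tendsto (fun k : ℕ => (k : ℝ) + 1) atTop atTop :=
      tendsto_atTop_add_const_right _ _ tendsto_natCast_atTop_atTop
    rw [cocompact_eq_atBot_atTop]
    have h4 : -c / (4 * Real.pi) ≠ 0 := div_ne_zero (neg_ne_zero.2 hc) (by positivity)
    rcases lt_or_gt_of_ne h4 with h | h
    · exact (h3.atTop_mul_const_of_neg h).mono_right le_sup_left
    · exact (h3.atTop_mul_const h).mono_right le_sup_right
  refine (h1.comp h2).congr fun k => ?_
  refine integral_congr_ae (Eventually.of_forall fun z => ?_)
  simp only [Circle.smul_def, Real.fourierChar_apply, smul_eq_mul]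
  congr 2
  have hπ : (Real.pi : ℂ) ≠ 0 := by exact_mod_cast Real.pi_ne_zero
  push_cast
  field_simp
  ring

end probe

/-- The integrand of the weak form of the equation. -/
def weakIntegrand (σ M : ℝ) (u : ℝ → ℝ → ℂ) (φ : ℝ × ℝ → ℂ) (p : ℝ × ℝ) : ℂ :=
  u p.1 p.2 *
    (-Complex.I * deriv (fun τ => φ (τ, p.2)) p.1 + iteratedDeriv 2 (fun y => φ (p.1, y)) p.2) +
    (σ / 2 : ℝ) * ((‖u p.1 p.2‖ ^ 2 - M / (2 * Real.pi * p.1) : ℝ) : ℂ) * u p.1 p.2 * φ p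

theorem weakIntegrand_eq_zero {σ M : ℝ} {u : ℝ → ℝ → ℂ} {φ : ℝ × ℝ → ℂ} (hφ : ContDiff ℝ ∞ φ)
    {p : ℝ × ℝ} (hp : p ∉ tsupport φ) : weakIntegrand σ M u φ p = 0 := by
  rw [weakIntegrand, deriv_slice hφ, iteratedDeriv_two_slice hφ]
  simp [partial_eq_zero hp, secondDeriv_eq_zero hp, image_eq_zero_of_notMem_tsupport hp]

theorem integrable_weakIntegrand {σ M T : ℝ} {u : ℝ → ℝ → ℂ} (hu : IsDistribSolution σ M T u)
    {φ : ℝ × ℝ → ℂ} (hφ : ContDiff ℝ ∞ φ) (hc : HasCompactSupport φ)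
    (hs : tsupport φ ⊆ strip T) : Integrable (weakIntegrand σ M u φ) := by
  set K := tsupport φ
  have hK : IsCompact K := hc.isCompact
  have h1 : IntegrableOn (fun p : ℝ × ℝ => u p.1 p.2) K := hu.1.integrableOn_compact_subset hs hK
  have h2 : IntegrableOn (fun p : ℝ × ℝ => ((‖u p.1 p.2‖ ^ 2 : ℝ) : ℂ) * u p.1 p.2) K :=
    hu.2.1.integrableOn_compact_subset hs hK
  have k1 : Continuous fun p => -Complex.I * fderiv ℝ φ p (1, 0) + secondDeriv φ p :=
    (continuous_const.mul (contDiff_partial hφ (1, 0)).continuous).add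
      (contDiff_partial (contDiff_partial hφ (0, 1)) (0, 1)).continuous
  have k2 : ContinuousOn (fun p : ℝ × ℝ =>
      (((σ / 2 : ℝ) : ℂ) * ((M / (2 * Real.pi * p.1) : ℝ) : ℂ)) * φ p) K := by
    refine (continuousOn_const.mul (Complex.continuous_ofReal.comp_continuousOn
      (ContinuousOn.div (by fun_prop) (by fun_prop) fun p hp => ?_))).mul hφ.continuous.continuousOn
    exact mul_ne_zero (by positivity) (hs hp).1.1.ne'
  have h3 := ((h1.mul_continuousOn k1.continuousOn hK).add
    (h2.mul_continuousOn (continuous_const.mul hφ.continuous :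
      Continuous fun p => ((σ / 2 : ℝ) : ℂ) * φ p).continuousOn hK)).sub
    (h1.mul_continuousOn k2 hK)
  refine (integrableOn_iff_integrable_of_support_subset (s := K) fun p hp => ?_).1
    (h3.congr (Eventually.of_forall fun p => ?_))
  · by_contra h
    exact hp (weakIntegrand_eq_zero hφ h)
  · simp only [weakIntegrand, deriv_slice hφ, iteratedDeriv_two_slice hφ, Pi.add_apply,
      Pi.sub_apply, Pi.mul_apply]
    push_cast
    ring

/-- The oscillating integral `∫ e^{i L d z / 2} f(z) dz`. -/
def oscillation (f : ℝ → ℂ) (L d : ℝ) : ℂ :=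
  ∫ z : ℝ, Complex.exp (Complex.I * (L * z * d / 2 : ℝ)) * f z

theorem norm_oscillation_le (f : ℝ → ℂ) (L d : ℝ) : ‖oscillation f L d‖ ≤ ∫ z, ‖f z‖ := by
  refine (norm_integral_le_integral_norm _).trans (le_of_eq ?_)
  refine integral_congr_ae (Eventually.of_forall fun z => ?_)
  simp only []
  rw [norm_mul, mul_comm Complex.I, Complex.norm_exp_ofReal_mul_I, one_mul]

/-! ### Testing the equation against an oscillating probe -/

section extraction

variable {a b σ M T y L t : ℝ} {ψ ψ' χ χ' χ'' : ℝ → ℂ} {A : Idx → ℂ} {u : ℝ → ℝ → ℂ}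

/-- The prefactor of the wave with index `n` in the tested equation. -/
def prefactor (a b y t : ℝ) (n : Idx) : ℂ := ((4 * Real.pi * Complex.I * t : ℂ) ^ (1 / 2 : ℂ))⁻¹ *
  Complex.exp (Complex.I * ((y - pt a b n) ^ 2 / (4 * t) : ℝ))

theorem norm_prefactor (a b y t : ℝ) (n : Idx) :
    ‖prefactor a b y t n‖ = 1 / Real.sqrt (4 * Real.pi * |t|) := by
  rw [prefactor, norm_mul, mul_comm Complex.I, Complex.norm_exp_ofReal_mul_I, mul_one, norm_inv,
    ← norm_root, Real.sqrt_sq (norm_nonneg _)]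
  exact (one_div _).symm

theorem weakIntegrand_probe (hL : 0 < L) (hψ : ∀ t, HasDerivAt ψ (ψ' t) t)
    (hχ : ∀ z, HasDerivAt χ (χ' z) z) (hχ' : ∀ z, HasDerivAt χ' (χ'' z) z) (ht : 0 < t)
    (hA : Summable fun n => ‖A n‖) (hu : ∀ x, u t x = wave a b A t x) (z : ℝ) :
    weakIntegrand σ M u (probe ψ χ y L) (t, t * L * z + y) =
      ∑' n, prefactor a b y t n *
        (-Complex.I * (A n * (ψ' t + ψ t / (2 * t)) + force a b σ M t A n * ψ t) *
          (Complex.exp (Complex.I * (L * z * (y - pt a b n) / 2 : ℝ)) * χ z) +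
        A n * (ψ t / (t * L) ^ 2) *
          (Complex.exp (Complex.I * (L * z * (y - pt a b n) / 2 : ℝ)) * χ'' z)) := by
  have hz : (t * L * z + y - y) / (t * L) = z := by
    have := ht.ne'; have := hL.ne'; field_simp; ring
  rw [weakIntegrand]
  simp only []
  rw [adjoint_probe hL hψ hχ hχ' ht, hu, nonlinearity_wave hA a b σ M ht, hz]
  have s1 := (summable_mul_evolvedDirac hA a b t (t * L * z + y)).of_norm
  have s2 := (summable_mul_evolvedDirac (summable_force hA a b σ M t) a b t
    (t * L * z + y)).of_norm
  simp only [wave]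
  rw [← tsum_mul_right, ← tsum_mul_left, ← tsum_mul_right,
    ← (s1.mul_right _).tsum_add ((s2.mul_left _).mul_right _)]
  refine tsum_congr fun n => ?_
  have h := evolvedDirac_mul_probe (y := y) (L := L) ht (pt a b n) z
  rw [← prefactor] at h
  simp only [probe, hz]
  linear_combination (A n * (-Complex.I * (ψ' t + ψ t / (2 * t)) * χ z +
    ψ t * χ'' z / (t * L) ^ 2) + -Complex.I * force a b σ M t A n * (ψ t * χ z)) * h

/-- The term with index `n` in the tested equation at time `t`. -/
def testedTerm (a b σ M y t L : ℝ) (ψ ψ' χ χ'' : ℝ → ℂ) (A : Idx → ℂ) (n : Idx) : ℂ :=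
  prefactor a b y t n *
    (-Complex.I * (A n * (ψ' t + ψ t / (2 * t)) + force a b σ M t A n * ψ t) *
      oscillation χ L (y - pt a b n) +
    A n * (ψ t / (t * L) ^ 2) * oscillation χ'' L (y - pt a b n))

/-- The change of variables x = tLz + y has Jacobian tL. Afterwards each wave contributes through
the oscillating integrals of χ and χ'' only, and absolute summability allows integration term by
term. -/
theorem integral_weakIntegrand_slice (hL : 0 < L) (hψ : ∀ t, HasDerivAt ψ (ψ' t) t)
    (hχ : ∀ z, HasDerivAt χ (χ' z) z) (hχ' : ∀ z, HasDerivAt χ' (χ'' z) z) (hχi : Integrable χ)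
    (hχi' : Integrable χ'') (ht : 0 < t) (hA : Summable fun n => ‖A n‖)
    (hu : ∀ x, u t x = wave a b A t x) :
    ∫ x, weakIntegrand σ M u (probe ψ χ y L) (t, x) =
      (t * L : ℝ) * ∑' n, testedTerm a b σ M y t L ψ ψ' χ χ'' A n := by
  have htL : 0 < t * L := mul_pos ht hL
  have h1 : ∫ x, weakIntegrand σ M u (probe ψ χ y L) (t, x) =
      (t * L : ℝ) * ∫ z, weakIntegrand σ M u (probe ψ χ y L) (t, t * L * z + y) := by
    rw [← integral_add_right_eq_self _ y]
    have h := Measure.integral_comp_mul_left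
      (fun x => weakIntegrand σ M u (probe ψ χ y L) (t, x + y)) (t * L)
    rw [h, abs_of_pos (inv_pos.2 htL), Complex.real_smul, Complex.ofReal_inv,
      mul_inv_cancel_left₀ (by exact_mod_cast htL.ne')]
  rw [h1]
  congr 1
  simp only [weakIntegrand_probe hL hψ hχ hχ' ht hA hu]
  have hexp : ∀ (f : ℝ → ℂ) (n : Idx), Integrable f → Integrable fun z : ℝ =>
      Complex.exp (Complex.I * (L * z * (y - pt a b n) / 2 : ℝ)) * f z := by
    intro f n hf
    refine hf.bdd_mul (c := 1) (by fun_prop) (Eventually.of_forall fun z => ?_)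
    rw [mul_comm Complex.I, Complex.norm_exp_ofReal_mul_I]
  have hexpn : ∀ (z : ℝ) (n : Idx),
      ‖Complex.exp (Complex.I * (L * z * (y - pt a b n) / 2 : ℝ))‖ = 1 := fun z n => by
    rw [mul_comm Complex.I, Complex.norm_exp_ofReal_mul_I]
  have hF := fun n => (((hexp χ n hχi).const_mul (-Complex.I *
    (A n * (ψ' t + ψ t / (2 * t)) + force a b σ M t A n * ψ t))).add
    ((hexp χ'' n hχi').const_mul (A n * (ψ t / (t * L) ^ 2)))).const_mul (prefactor a b y t n)
  simp only [Pi.add_apply] at hF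
  set R : ℝ := 1 / Real.sqrt (4 * Real.pi * |t|)
  have hR : 0 ≤ R := by positivity
  have hle : ∀ n, ∫ z, ‖prefactor a b y t n *
      (-Complex.I * (A n * (ψ' t + ψ t / (2 * t)) + force a b σ M t A n * ψ t) *
        (Complex.exp (Complex.I * (L * z * (y - pt a b n) / 2 : ℝ)) * χ z) +
      A n * (ψ t / (t * L) ^ 2) *
        (Complex.exp (Complex.I * (L * z * (y - pt a b n) / 2 : ℝ)) * χ'' z))‖ ≤
      R * ((‖A n‖ * ‖ψ' t + ψ t / (2 * t)‖ + ‖force a b σ M t A n‖ * ‖ψ t‖) * (∫ z, ‖χ z‖) +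
        ‖A n‖ * ‖ψ t / (t * L) ^ 2‖ * ∫ z, ‖χ'' z‖) := by
    intro n
    rw [← integral_const_mul, ← integral_const_mul, ← integral_add (hχi.norm.const_mul _)
      (hχi'.norm.const_mul _), ← integral_const_mul]
    refine integral_mono (hF n).norm (((hχi.norm.const_mul _).add
      (hχi'.norm.const_mul _)).const_mul _) fun z => ?_
    simp only []
    rw [norm_mul, norm_prefactor]
    refine mul_le_mul_of_nonneg_left ((norm_add_le _ _).trans (add_le_add ?_ ?_)) hR
    · rw [norm_mul, norm_mul, norm_mul, hexpn, one_mul, norm_neg, Complex.norm_I, one_mul]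
      refine mul_le_mul_of_nonneg_right ((norm_add_le _ _).trans ?_) (norm_nonneg _)
      rw [norm_mul, norm_mul]
    · rw [norm_mul, norm_mul, norm_mul, hexpn, one_mul]
  have hsum : Summable fun n => R * ((‖A n‖ * ‖ψ' t + ψ t / (2 * t)‖ +
      ‖force a b σ M t A n‖ * ‖ψ t‖) * (∫ z, ‖χ z‖) +
        ‖A n‖ * ‖ψ t / (t * L) ^ 2‖ * ∫ z, ‖χ'' z‖) :=
    ((((hA.mul_right _).add ((summable_force hA a b σ M t).mul_right _)).mul_right _).add
      ((hA.mul_right _).mul_right _)).mul_left _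
  rw [← (hasSum_integral_of_summable_integral_norm hF (Summable.of_nonneg_of_le
    (fun n => integral_nonneg fun z => norm_nonneg _) hle hsum)).tsum_eq]
  refine tsum_congr fun n => ?_
  rw [integral_const_mul, integral_add ((hexp χ n hχi).const_mul _)
    ((hexp χ'' n hχi').const_mul _), integral_const_mul, integral_const_mul]
  rfl

/-- A bound for the tested equation that is uniform in `L ≥ 1`. -/
theorem norm_testedTerm_le (hL : 1 ≤ L) (ht : 0 < t) (n : Idx) :
    ‖testedTerm a b σ M y t L ψ ψ' χ χ'' A n‖ ≤ 1 / Real.sqrt (4 * Real.pi * |t|) *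
      ((‖A n‖ * ‖ψ' t + ψ t / (2 * t)‖ + ‖force a b σ M t A n‖ * ‖ψ t‖) * (∫ z, ‖χ z‖) +
        ‖A n‖ * (‖ψ t‖ / t ^ 2) * ∫ z, ‖χ'' z‖) := by
  rw [testedTerm, norm_mul, norm_prefactor]
  refine mul_le_mul_of_nonneg_left ((norm_add_le _ _).trans (add_le_add ?_ ?_)) (by positivity)
  · rw [norm_mul, norm_mul, norm_neg, Complex.norm_I, one_mul]
    refine mul_le_mul ((norm_add_le _ _).trans ?_) (norm_oscillation_le _ _ _) (norm_nonneg _)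
      (by positivity)
    rw [norm_mul, norm_mul]
  · rw [norm_mul, norm_mul]
    refine mul_le_mul (mul_le_mul_of_nonneg_left ?_ (norm_nonneg _)) (norm_oscillation_le _ _ _)
      (norm_nonneg _) (by positivity)
    rw [norm_div]
    refine div_le_div_of_nonneg_left (norm_nonneg _) (by positivity) ?_
    rw [norm_pow, norm_mul, Complex.norm_real, Complex.norm_real, Real.norm_of_nonneg ht.le,
      Real.norm_of_nonneg (zero_le_one.trans hL)]
    have h : t ≤ t * L := le_mul_of_one_le_right ht.le hL
    gcongr

/-- The wave with index `m` has frequency zero and keeps ∫χ. The others vanish by Riemann-Lebesgue,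
their frequencies being nonzero by injectivity. The terms with χ'' carry L⁻², and dominated
convergence sums the limits. -/
theorem tendsto_testedTerm (hpt : Function.Injective (pt a b)) (m : Idx) (ht : 0 < t)
    (hA : Summable fun n => ‖A n‖) :
    Tendsto (fun k : ℕ => ∑' n, testedTerm a b σ M (pt a b m) t ((k : ℝ) + 1) ψ ψ' χ χ'' A n) atTop
      (𝓝 (prefactor a b (pt a b m) t m * (-Complex.I *
        (A m * (ψ' t + ψ t / (2 * t)) + force a b σ M t A m * ψ t) * ∫ z, χ z))) := by
  have hsum : Summable fun n => 1 / Real.sqrt (4 * Real.pi * |t|) * ((‖A n‖ *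
      ‖ψ' t + ψ t / (2 * t)‖ + ‖force a b σ M t A n‖ * ‖ψ t‖) * (∫ z, ‖χ z‖) +
        ‖A n‖ * (‖ψ t‖ / t ^ 2) * ∫ z, ‖χ'' z‖) :=
    ((((hA.mul_right _).add ((summable_force hA a b σ M t).mul_right _)).mul_right _).add
      ((hA.mul_right _).mul_right _)).mul_left _
  set g : Idx → ℂ := fun n => if n = m then prefactor a b (pt a b m) t m * (-Complex.I *
        (A m * (ψ' t + ψ t / (2 * t)) + force a b σ M t A m * ψ t) * ∫ z, χ z) else 0 with hg
  have key : ∀ n, Tendsto (fun k : ℕ =>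
      testedTerm a b σ M (pt a b m) t ((k : ℝ) + 1) ψ ψ' χ χ'' A n) atTop (𝓝 (g n)) := by
    intro n
    have h2 : Tendsto (fun k : ℕ => A n * (ψ t / (t * ((k : ℝ) + 1 : ℝ)) ^ 2) *
        oscillation χ'' ((k : ℝ) + 1) (pt a b m - pt a b n)) atTop (𝓝 0) := by
      refine squeeze_zero_norm (a := fun k : ℕ => ‖A n‖ * (‖ψ t‖ / t ^ 2) * (∫ z, ‖χ'' z‖) *
        (1 / ((k : ℝ) + 1))) (fun k => ?_) ?_
      · have hk : (1 : ℝ) ≤ (k : ℝ) + 1 := by linarith [(Nat.cast_nonneg k : (0 : ℝ) ≤ k)]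
        rw [norm_mul, norm_mul, norm_div, norm_pow, norm_mul, Complex.norm_real,
          Complex.norm_real, Real.norm_of_nonneg ht.le, Real.norm_of_nonneg (zero_le_one.trans hk)]
        have h3 : ‖ψ t‖ / (t * ((k : ℝ) + 1)) ^ 2 ≤ ‖ψ t‖ / t ^ 2 * (1 / ((k : ℝ) + 1)) := by
          rw [mul_pow, ← div_div, div_eq_mul_one_div (‖ψ t‖ / t ^ 2)]
          refine mul_le_mul_of_nonneg_left ?_ (by positivity)
          exact one_div_le_one_div_of_le (by positivity) (le_self_pow₀ hk two_ne_zero)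
        calc _ ≤ ‖A n‖ * (‖ψ t‖ / t ^ 2 * (1 / ((k : ℝ) + 1))) * ∫ z, ‖χ'' z‖ :=
              mul_le_mul (mul_le_mul_of_nonneg_left h3 (norm_nonneg _))
                (norm_oscillation_le _ _ _) (norm_nonneg _) (by positivity)
          _ = _ := by ring
      · simpa using tendsto_one_div_add_atTop_nhds_zero_nat.const_mul
          (‖A n‖ * (‖ψ t‖ / t ^ 2) * ∫ z, ‖χ'' z‖)
    by_cases hn : n = m
    · subst hn
      have h1 : ∀ k : ℕ, oscillation χ ((k : ℝ) + 1) (pt a b n - pt a b n) = ∫ z, χ z := by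
        intro k; simp [oscillation]
      have h := (h2.const_add (-Complex.I * (A n * (ψ' t + ψ t / (2 * t)) +
        force a b σ M t A n * ψ t) * ∫ z, χ z)).const_mul (prefactor a b (pt a b n) t n)
      simp only [hg, if_true, add_zero] at h ⊢
      refine h.congr fun k => ?_
      rw [testedTerm, h1]
    · have hd : pt a b m - pt a b n ≠ 0 := sub_ne_zero.2 fun e => hn (hpt e).symm
      have h1 : Tendsto (fun k : ℕ => oscillation χ ((k : ℝ) + 1) (pt a b m - pt a b n)) atTop
          (𝓝 0) := tendsto_fourier_zero hd
      have h := ((h1.const_mul (-Complex.I * (A n * (ψ' t + ψ t / (2 * t)) +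
        force a b σ M t A n * ψ t))).add h2).const_mul (prefactor a b (pt a b m) t n)
      simp only [hg, if_neg hn, mul_zero, add_zero] at h ⊢
      exact h
  have h := tendsto_tsum_of_dominated_convergence hsum key (Eventually.of_forall fun k n =>
    norm_testedTerm_le (by linarith [(Nat.cast_nonneg k : (0 : ℝ) ≤ k)]) ht n)
  rwa [hg, tsum_ite_eq] at h

end extraction

/-! ### The coefficients of a distributional solution -/

theorem integrable_of_continuousOn_strip {T : ℝ} {K : Set ℝ} (hK : IsCompact K) (hKT : K ⊆ Ioo 0 T)
    {E : Type*} [NormedAddCommGroup E] {g : ℝ → E} (hg : ContinuousOn g (Ioo 0 T))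
    (h : ∀ t ∉ K, g t = 0) : Integrable g :=
  (continuous_of_eq_zero_off isOpen_Ioo hg hK.isClosed hKT h).integrable_of_hasCompactSupport
    (HasCompactSupport.intro hK h)

theorem deriv_eq_zero_of_notMem_tsupport {ψ : ℝ → ℂ} {t : ℝ} (ht : t ∉ tsupport ψ) :
    deriv ψ t = 0 := by
  by_contra h
  exact ht (support_deriv_subset h)

theorem exists_unit_bump : ∃ χ : ℝ → ℂ, ContDiff ℝ ∞ χ ∧ HasCompactSupport χ ∧ ∫ z, χ z ≠ 0 := by
  let f : ContDiffBump (0 : ℝ) := ⟨1, 2, one_pos, one_lt_two⟩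
  refine ⟨fun z => (f z : ℂ), Complex.ofRealCLM.contDiff.comp f.contDiff,
    f.hasCompactSupport.comp_left (g := fun x : ℝ => (x : ℂ)) Complex.ofReal_zero, ?_⟩
  rw [integral_complex_ofReal]
  exact_mod_cast (f.integral_pos (μ := volume)).ne'

/-- Only the single coefficients are known to be continuous, not the sequence in ℓ¹. Hence the cubic
series is only shown measurable, as a limit of continuous partial sums. -/
theorem aestronglyMeasurable_force {a b σ M : ℝ} {S : Set ℝ} (hS : MeasurableSet S)
    (hS0 : ∀ t ∈ S, t ≠ 0) {A : ℝ → Idx → ℂ} (hA : ∀ t ∈ S, Summable fun n => ‖A t n‖)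
    (hAc : ∀ n, ContinuousOn (fun t => A t n) S) (n : Idx) :
    AEStronglyMeasurable (fun t => force a b σ M t (A t) n) (volume.restrict S) := by
  have h1 : AEStronglyMeasurable (fun t => cubic a b (1 / t) (A t) n) (volume.restrict S) := by
    refine aestronglyMeasurable_tsum (fun p => ContinuousOn.aestronglyMeasurable ?_ hS) ?_
    · refine ContinuousOn.mul ?_ (((hAc _).mul ?_).mul (hAc _))
      · unfold phase
        refine Complex.continuous_exp.comp_continuousOn (continuousOn_const.mul
          (Complex.continuous_ofReal.comp_continuousOn (ContinuousOn.mul ?_ continuousOn_const)))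
        exact continuousOn_const.div continuousOn_id hS0
      · exact continuous_star.comp_continuousOn (hAc _)
    · filter_upwards [ae_restrict_mem hS] with t ht
      exact (summable_triple_inner (norm_phase_le a b (1 / t)) (hA t ht) (hA t ht) (hA t ht)
        n).of_norm
  refine AEStronglyMeasurable.mul (ContinuousOn.aestronglyMeasurable ?_ hS)
    (h1.sub ((hAc n).aestronglyMeasurable hS |>.const_mul _))
  refine continuousOn_const.mul (Complex.continuous_ofReal.comp_continuousOn
    (continuousOn_const.div (by fun_prop) fun t ht => ?_))
  have := abs_pos.2 (hS0 t ht)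
  positivity

theorem norm_force_le_bound {a b σ M C : ℝ} (hσ : σ = 1 ∨ σ = -1) (hM : 0 ≤ M) (t : ℝ)
    {A : Idx → ℂ} (hA : Summable fun n => ‖A n‖) (hAb : ∑' n, ‖A n‖ ≤ C) (n : Idx) :
    ‖force a b σ M t A n‖ ≤ (3 * C ^ 2 + 2 * M) * C / (8 * Real.pi * |t|) :=
  ((summable_force hA a b σ M t).le_tsum n fun _ _ => norm_nonneg _).trans
    (tsum_norm_force_le hσ a b t hA hAb hM)

/-- The Gaussian factor that is left over when a single coefficient is extracted. -/
def leftover (y t : ℝ) : ℂ := t * evolvedDirac t y y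

/-- At x = y the Gaussian phase is 1, so the factor is a constant times √t, with logarithmic
derivative 1/(2t). This is what turns the term ψ/(2t) of the adjoint equation into part of an exact
derivative. -/
theorem hasDerivAt_leftover {t : ℝ} (ht : 0 < t) (y : ℝ) :
    HasDerivAt (leftover y) (leftover y t / (2 * t)) t := by
  have h := (Complex.ofRealCLM.hasDerivAt (x := t)).mul (hasDerivAt_evolvedDirac_left ht y y)
  refine h.congr_deriv ?_
  have : (t : ℂ) ≠ 0 := by exact_mod_cast ht.ne'
  simp only [leftover, Complex.ofRealCLM_apply, sub_self]
  push_cast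
  field_simp
  ring

theorem leftover_ne_zero {t : ℝ} (ht : 0 < t) (y : ℝ) : leftover y t ≠ 0 := by
  have : (t : ℂ) ≠ 0 := by exact_mod_cast ht.ne'
  refine mul_ne_zero this (div_ne_zero (Complex.exp_ne_zero _) (root_ne_zero ht.ne'))

section

variable {a b σ M T C : ℝ} {A : ℝ → Idx → ℂ} {u : ℝ → ℝ → ℂ}

/-- The limit L → ∞ of the weak equation tested against the probe centred at x_m. Only the m-th
coefficient survives, in a weak form of its equation multiplied by `leftover`. -/
theorem integral_extracted (hpt : Function.Injective (pt a b)) (hσ : σ = 1 ∨ σ = -1) (hM : 0 ≤ M)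
    (hC : 0 ≤ C) (hA : ∀ t ∈ Ioo 0 T, Summable fun n => ‖A t n‖)
    (hAb : ∀ t ∈ Ioo 0 T, ∑' n, ‖A t n‖ ≤ C) (hu : ∀ t ∈ Ioo 0 T, ∀ x, u t x = wave a b (A t) t x)
    (hsol : IsDistribSolution σ M T u) {ψ : ℝ → ℂ} (hψ : ContDiff ℝ ∞ ψ)
    (hψc : HasCompactSupport ψ) (hψT : tsupport ψ ⊆ Ioo 0 T) (m : Idx) :
    ∫ t, leftover (pt a b m) t *
      (A t m * (deriv ψ t + ψ t / (2 * t)) + force a b σ M t (A t) m * ψ t) = 0 := by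
  obtain ⟨χ, hχ, hχc, hχ0⟩ := exists_unit_bump
  have hψ1 : ∀ t, HasDerivAt ψ (deriv ψ t) t := fun t =>
    (hψ.differentiable (by simp) t).hasDerivAt
  have hψ'c : Continuous (deriv ψ) := hψ.continuous_deriv (by simp)
  have hχ' : ContDiff ℝ ∞ (deriv χ) := (contDiff_infty_iff_deriv.1 hχ).2
  have hχ'' : ContDiff ℝ ∞ (deriv (deriv χ)) := (contDiff_infty_iff_deriv.1 hχ').2
  have hχ1 : ∀ z, HasDerivAt χ (deriv χ z) z := fun t =>
    (hχ.differentiable (by simp) t).hasDerivAt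
  have hχ2 : ∀ z, HasDerivAt (deriv χ) (deriv (deriv χ) z) z := fun t =>
    (hχ'.differentiable (by simp) t).hasDerivAt
  have hχi : Integrable χ := hχ.continuous.integrable_of_hasCompactSupport hχc
  have hχi' : Integrable (deriv (deriv χ)) :=
    hχ''.continuous.integrable_of_hasCompactSupport hχc.deriv.deriv
  set y := pt a b m with hy
  set L : ℕ → ℝ := fun k => (k : ℝ) + 1 with hL
  have hL1 : ∀ k, 1 ≤ L k := fun k => by simp [hL]
  have hL0 : ∀ k, 0 < L k := fun k => zero_lt_one.trans_le (hL1 k)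
  -- Dividing by L removes the growing part of the Jacobian tL.
  set H : ℕ → ℝ → ℂ := fun k t =>
    ((L k : ℝ) : ℂ)⁻¹ * ∫ x, weakIntegrand σ M u (probe ψ χ y (L k)) (t, x) with hH
  have hprobe := fun k => exists_compact_probe (T := T) (y := y) (hL0 k) hψc hψT hχc
  have hsm := fun k => contDiff_probe (y := y) (hL0 k) hψ hψT hχ
  have hst : ∀ k, tsupport (probe ψ χ y (L k)) ⊆ strip T := fun k =>
    (hprobe k).2.trans (prod_mono_left hψT)
  have hint := fun k => integrable_weakIntegrand hsol (hsm k) (hprobe k).1 (hst k)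
  have hHmeas : ∀ k, AEStronglyMeasurable (H k) volume := fun k =>
    ((hint k).integral_prod_left.aestronglyMeasurable).const_mul _
  have hHint : ∀ k, ∫ t, H k t = 0 := by
    intro k
    rw [integral_const_mul, ← integral_prod _ (hint k)]
    have h := hsol.2.2 _ (hsm k) (hprobe k).1 (hst k)
    rw [Measure.volume_eq_prod] at h
    exact mul_eq_zero_of_right _ h
  have hHoff : ∀ k, ∀ t ∉ tsupport ψ, H k t = 0 := by
    intro k t ht
    have h : ∀ x, weakIntegrand σ M u (probe ψ χ y (L k)) (t, x) = 0 := fun x =>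
      weakIntegrand_eq_zero (hsm k) fun hx => ht ((hprobe k).2 hx).1
    simp [hH, h]
  have hHon : ∀ k, ∀ t ∈ tsupport ψ, H k t = t * ∑' n,
      testedTerm a b σ M y t (L k) ψ (deriv ψ) χ (deriv (deriv χ)) (A t) n := by
    intro k t ht
    have htT := hψT ht
    have h0 : ((L k : ℝ) : ℂ) ≠ 0 := by exact_mod_cast (hL0 k).ne'
    simp only [hH]
    rw [integral_weakIntegrand_slice (hL0 k) hψ1 hχ1 hχ2 hχi hχi' htT.1 (hA t htT) (hu t htT)]
    push_cast
    field_simp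
  set I₁ := ∫ z, ‖χ z‖
  set I₂ := ∫ z, ‖deriv (deriv χ) z‖
  set g : ℝ → ℝ := fun t => t * (1 / Real.sqrt (4 * Real.pi * |t|) *
      ((C * ‖deriv ψ t + ψ t / (2 * t)‖ + (3 * C ^ 2 + 2 * M) * C / (8 * Real.pi * |t|) * ‖ψ t‖) *
        I₁ + C * (‖ψ t‖ / t ^ 2) * I₂)) with hg
  have hI₁ : 0 ≤ I₁ := integral_nonneg fun _ => norm_nonneg _
  have hI₂ : 0 ≤ I₂ := integral_nonneg fun _ => norm_nonneg _
  have hgi : Integrable g := by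
    refine integrable_of_continuousOn_strip hψc.isCompact hψT ?_ fun t ht => ?_
    · have c1 : ContinuousOn (fun t : ℝ => ψ t / (2 * t)) (Ioo 0 T) :=
        hψ.continuous.continuousOn.div (by fun_prop) fun t ht => by
          have := ht.1.ne'; simpa using this
      have c2 : ContinuousOn (fun t : ℝ => (3 * C ^ 2 + 2 * M) * C / (8 * Real.pi * |t|))
          (Ioo 0 T) := continuousOn_const.div (by fun_prop) fun t ht => by
            have := ht.1; positivity
      have c3 : ContinuousOn (fun t : ℝ => 1 / Real.sqrt (4 * Real.pi * |t|)) (Ioo 0 T) :=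
        continuousOn_const.div (by fun_prop) fun t ht =>
          (Real.sqrt_pos.2 (by have := ht.1; positivity)).ne'
      have c4 : ContinuousOn (fun t : ℝ => ‖ψ t‖ / t ^ 2) (Ioo 0 T) :=
        hψ.continuous.norm.continuousOn.div (by fun_prop) fun t ht => by
            have := pow_pos ht.1 2; exact this.ne'
      exact continuousOn_id.mul (c3.mul ((((continuousOn_const.mul
        (hψ'c.continuousOn.add c1).norm).add (c2.mul hψ.continuous.norm.continuousOn)).mul
        continuousOn_const).add ((continuousOn_const.mul c4).mul continuousOn_const)))
    · simp [hg, image_eq_zero_of_notMem_tsupport ht, deriv_eq_zero_of_notMem_tsupport ht]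
  have hHle : ∀ k t, ‖H k t‖ ≤ g t := by
    intro k t
    by_cases ht : t ∈ tsupport ψ
    · have htT := hψT ht
      have hAt := hA t htT
      have hs1 := (hAt.mul_right ‖deriv ψ t + ψ t / (2 * t)‖).add
        ((summable_force hAt a b σ M t).mul_right ‖ψ t‖)
      have hs2 := ((hs1.mul_right I₁).add ((hAt.mul_right (‖ψ t‖ / t ^ 2)).mul_right I₂)).mul_left
        (1 / Real.sqrt (4 * Real.pi * |t|))
      rw [hHon k t ht, norm_mul, Complex.norm_real, Real.norm_of_nonneg htT.1.le]
      refine mul_le_mul_of_nonneg_left ?_ htT.1.le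
      refine (tsum_of_norm_bounded hs2.hasSum fun n =>
        norm_testedTerm_le (hL1 k) htT.1 n).trans ?_
      rw [tsum_mul_left, (hs1.mul_right I₁).tsum_add ((hAt.mul_right _).mul_right I₂),
        tsum_mul_right, tsum_mul_right, tsum_mul_right, (hAt.mul_right _).tsum_add
        ((summable_force hAt a b σ M t).mul_right _), tsum_mul_right, tsum_mul_right]
      have h1 := hAb t htT
      have h2 := tsum_norm_force_le hσ a b t hAt h1 hM
      gcongr
    · rw [hHoff k t ht, norm_zero]
      simp [hg, image_eq_zero_of_notMem_tsupport ht, deriv_eq_zero_of_notMem_tsupport ht]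
  have hlim : ∀ t, Tendsto (fun k => H k t) atTop (𝓝 (leftover y t *
      (A t m * (deriv ψ t + ψ t / (2 * t)) + force a b σ M t (A t) m * ψ t) *
        (-Complex.I * ∫ z, χ z))) := by
    intro t
    by_cases ht : t ∈ tsupport ψ
    · have htT := hψT ht
      have h := (tendsto_testedTerm (σ := σ) (M := M) (ψ := ψ) (ψ' := deriv ψ) (χ := χ)
        (χ'' := deriv (deriv χ)) hpt m htT.1 (hA t htT)).const_mul (t : ℂ)
      have e : prefactor a b (pt a b m) t m = evolvedDirac t y y := by
        rw [prefactor, evolvedDirac, div_eq_mul_inv (Complex.exp _)]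
        exact mul_comm _ _
      rw [e] at h
      refine (h.congr fun k => (hHon k t ht).symm).trans (le_of_eq ?_)
      rw [leftover]
      congr 1
      ring
    · simp [hHoff _ t ht, image_eq_zero_of_notMem_tsupport ht, deriv_eq_zero_of_notMem_tsupport ht]
  have h := tendsto_integral_of_dominated_convergence g hHmeas hgi
    (fun k => Eventually.of_forall fun t => hHle k t) (Eventually.of_forall hlim)
  simp only [hHint] at h
  have h2 := tendsto_nhds_unique h tendsto_const_nhds
  rw [integral_mul_const] at h2
  exact (mul_eq_zero.1 h2).resolve_right (mul_ne_zero (by simp) hχ0)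

/-- The coefficients of a distributional solution satisfy the integrated system. -/
theorem integral_force_of_isDistribSolution (hpt : Function.Injective (pt a b))
    (hσ : σ = 1 ∨ σ = -1) (hM : 0 ≤ M)
    (hC : 0 ≤ C) (hA : ∀ t ∈ Ioo 0 T, Summable fun n => ‖A t n‖)
    (hAb : ∀ t ∈ Ioo 0 T, ∑' n, ‖A t n‖ ≤ C) (hu : ∀ t ∈ Ioo 0 T, ∀ x, u t x = wave a b (A t) t x)
    (hsol : IsDistribSolution σ M T u) {A' : ℝ → Idx → ℂ}
    (hd : ∀ t ∈ Ioo 0 T, ∀ n, HasDerivAt (fun τ => A τ n) (A' t n) t)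
    (hdc : ∀ n, ContinuousOn (fun t => A' t n) (Ioo 0 T)) :
    ∀ t' ∈ Ioo 0 T, ∀ t ∈ Ioo 0 T, t' ≤ t → ∀ m,
      IntervalIntegrable (fun τ => force a b σ M τ (A τ) m) volume t' t ∧
      A t m - A t' m = ∫ τ in t'..t, force a b σ M τ (A τ) m := by
  have hAc : ∀ n, ContinuousOn (fun t => A t n) (Ioo 0 T) := fun n t ht =>
    (hd t ht n).continuousAt.continuousWithinAt
  -- The derivative of the coefficient is continuous, so equality almost everywhere with the force
  -- already gives the integrated equation.
  suffices h : ∀ m, ∀ᵐ t, t ∈ Ioo 0 T → force a b σ M t (A t) m = A' t m by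
    intro t' ht' t ht htt m
    have hsub : Icc t' t ⊆ Ioo 0 T := fun τ hτ => ⟨ht'.1.trans_le hτ.1, hτ.2.trans_lt ht.2⟩
    have hi : IntervalIntegrable (fun τ => A' τ m) volume t' t :=
      ((hdc m).mono (by rwa [uIcc_of_le htt])).intervalIntegrable
    have he : ∀ᵐ τ, τ ∈ uIoc t' t → A' τ m = force a b σ M τ (A τ) m := by
      filter_upwards [h m] with τ hτ hτm
      rw [uIoc_of_le htt] at hτm
      exact (hτ (hsub (Ioc_subset_Icc_self hτm))).symm
    refine ⟨hi.congr_ae ((ae_restrict_iff' measurableSet_uIoc).2 he), ?_⟩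
    rw [← intervalIntegral.integral_congr_ae he]
    refine (intervalIntegral.integral_eq_sub_of_hasDerivAt (f := fun τ => A τ m)
      (fun τ hτ => ?_) hi).symm
    rw [uIcc_of_le htt] at hτ
    exact hd τ (hsub hτ) m
  intro m
  set y := pt a b m
  set q := leftover y
  have hq : ∀ t ∈ Ioo 0 T, HasDerivAt q (q t / (2 * t)) t := fun t ht => hasDerivAt_leftover ht.1 y
  have hqc : ContinuousOn q (Ioo 0 T) := fun t ht => (hq t ht).continuousAt.continuousWithinAt
  have hFm := aestronglyMeasurable_force (a := a) (b := b) (σ := σ) (M := M)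
    (measurableSet_Ioo (a := 0) (b := T)) (fun t ht => ht.1.ne') hA hAc m
  have hFl : LocallyIntegrableOn (fun t => force a b σ M t (A t) m) (Ioo 0 T) := by
    intro t ht
    have ht2 : t / 2 < t := half_lt_self ht.1
    refine ⟨Ioo (t / 2) T, mem_nhdsWithin_of_mem_nhds (Ioo_mem_nhds ht2 ht.2), ?_⟩
    have hsub : Ioo (t / 2) T ⊆ Ioo 0 T := Ioo_subset_Ioo_left (half_pos ht.1).le
    have : IsFiniteMeasure (volume.restrict (Ioo (t / 2) T)) := ⟨by simp⟩
    refine Integrable.of_bound (hFm.mono_set hsub)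
      ((3 * C ^ 2 + 2 * M) * C / (8 * Real.pi * (t / 2))) ?_
    filter_upwards [ae_restrict_mem measurableSet_Ioo] with τ hτ
    refine (norm_force_le_bound hσ hM τ (hA τ (hsub hτ)) (hAb τ (hsub hτ)) m).trans ?_
    have h0 := half_pos ht.1
    refine div_le_div_of_nonneg_left (by positivity) (by positivity) ?_
    have : t / 2 ≤ |τ| := hτ.1.le.trans (le_abs_self τ)
    gcongr
  have hdiff : LocallyIntegrableOn (fun t => q t * (force a b σ M t (A t) m - A' t m))
      (Ioo 0 T) := by
    have h1 : LocallyIntegrableOn (fun t => force a b σ M t (A t) m - A' t m) (Ioo 0 T) :=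
      hFl.sub ((hdc m).locallyIntegrableOn measurableSet_Ioo)
    exact h1.continuousOn_mul hqc isOpen_Ioo.isLocallyClosed
  -- The fundamental lemma of the calculus of variations; the factor `q` has no zeros at positive
  -- times and can be divided out.
  have key := isOpen_Ioo.ae_eq_zero_of_integral_contDiff_smul_eq_zero hdiff ?_
  · filter_upwards [key] with t ht htT
    exact sub_eq_zero.1 ((mul_eq_zero.1 (ht htT)).resolve_left (leftover_ne_zero htT.1 y))
  intro ψr hψr hψrc hψrT
  set ψ : ℝ → ℂ := fun t => (ψr t : ℂ) with hψdef
  have hψ : ContDiff ℝ ∞ ψ := Complex.ofRealCLM.contDiff.comp hψr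
  have hsup : tsupport ψ ⊆ tsupport ψr := tsupport_comp_subset Complex.ofReal_zero ψr
  have hψT : tsupport ψ ⊆ Ioo 0 T := hsup.trans hψrT
  have hψc : HasCompactSupport ψ := hψrc.comp_left (g := fun x : ℝ => (x : ℂ)) Complex.ofReal_zero
  have hψ1 : ∀ t, HasDerivAt ψ (deriv ψ t) t := fun t =>
    (hψ.differentiable (by simp) t).hasDerivAt
  have hψ'c : Continuous (deriv ψ) := hψ.continuous_deriv (by simp)
  have h1 := integral_extracted hpt hσ hM hC hA hAb hu hsol hψ hψc hψT m
  -- This is the derivative of q A_m ψ, so its integral is zero. Subtracting it from the tested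
  -- equation leaves ψ q times the difference between the force and the derivative of the
  -- coefficient.
  set Y : ℝ → ℂ := fun t => q t * (A t m * (deriv ψ t + ψ t / (2 * t)) + A' t m * ψ t) with hY
  have hYi : Integrable Y := by
    refine integrable_of_continuousOn_strip hψc.isCompact hψT ?_ fun t ht => ?_
    · refine hqc.mul (((hAc m).mul (hψ'c.continuousOn.add (hψ.continuous.continuousOn.div
        (by fun_prop) fun t ht => ?_))).add ((hdc m).mul hψ.continuous.continuousOn))
      have := ht.1.ne'
      simpa using this
    · simp [hY, image_eq_zero_of_notMem_tsupport ht, deriv_eq_zero_of_notMem_tsupport ht]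
  have hZoff : ∀ t ∉ tsupport ψ, q t * A t m * ψ t = 0 := fun t ht => by
    simp [image_eq_zero_of_notMem_tsupport ht]
  have hYint : ∫ t, Y t = 0 := by
    refine integral_eq_zero_of_hasDerivAt_of_integrable (f := fun t => q t * A t m * ψ t)
      (fun t => ?_) hYi ?_
    · by_cases ht : t ∈ tsupport ψ
      · have htT := hψT ht
        refine (((hq t htT).mul (hd t htT m)).mul (hψ1 t)).congr_deriv ?_
        simp only [hY, Pi.mul_apply]
        ring
      · have hz : Y t = 0 := by
          simp [hY, image_eq_zero_of_notMem_tsupport ht, deriv_eq_zero_of_notMem_tsupport ht]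
        rw [hz]
        refine (hasDerivAt_const t (0 : ℂ)).congr_of_eventuallyEq ?_
        filter_upwards [(isClosed_tsupport ψ).isOpen_compl.mem_nhds ht] with τ hτ using hZoff τ hτ
    · exact integrable_of_continuousOn_strip hψc.isCompact hψT
        ((hqc.mul (hAc m)).mul hψ.continuous.continuousOn) hZoff
  have hsub : ∀ t, ψr t • (q t * (force a b σ M t (A t) m - A' t m)) =
      q t * (A t m * (deriv ψ t + ψ t / (2 * t)) + force a b σ M t (A t) m * ψ t) - Y t := by
    intro t
    simp only [hY, Complex.real_smul, hψdef]
    ring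
  simp only [hsub]
  have hXi : Integrable fun t =>
      q t * (A t m * (deriv ψ t + ψ t / (2 * t)) + force a b σ M t (A t) m * ψ t) := by
    have h2 : Integrable fun t => ψ t * (q t * (force a b σ M t (A t) m - A' t m)) := by
      refine (integrableOn_iff_integrable_of_support_subset (s := tsupport ψ) fun t ht => ?_).1
        (((hdiff.integrableOn_compact_subset hψT hψc.isCompact).continuousOn_mul
          hψ.continuous.continuousOn hψc.isCompact))
      by_contra h
      exact ht (by simp [image_eq_zero_of_notMem_tsupport h])
    refine (h2.add hYi).congr (Eventually.of_forall fun t => ?_)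
    simp only [hY, Pi.add_apply]
    ring
  rw [integral_sub hXi hYi, h1, hYint, sub_zero]

end

/-! ### Regularity in weighted `ℓ²` spaces -/

theorem hasDerivAt_lp_apply {p : ENNReal} [Fact (1 ≤ p)] {W : ℝ → lp (fun _ : Idx => ℂ) p}
    {W' : lp (fun _ : Idx => ℂ) p} {t : ℝ} (h : HasDerivAt W W' t) (n : Idx) :
    HasDerivAt (fun t => W t n) (W' n) t :=
  (lp.evalCLM ℝ (fun _ : Idx => ℂ) p n).hasFDerivAt.comp_hasDerivAt t h

theorem continuousOn_lp_apply {p : ENNReal} [Fact (1 ≤ p)] {W : ℝ → lp (fun _ : Idx => ℂ) p}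
    {I : Set ℝ} (h : ContinuousOn W I) (n : Idx) : ContinuousOn (fun t => W t n) I :=
  (lp.evalCLM ℝ (fun _ : Idx => ℂ) p n).continuous.comp_continuousOn h

theorem weight_ne_zero (s : ℝ) (n : Idx) : ((wt n ^ s : ℝ) : ℂ) ≠ 0 := by
  exact_mod_cast (Real.rpow_pos_of_pos (wt_pos n) s).ne'

theorem normL2s_eq_norm {s : ℝ} {W : Ell2} {c : Idx → ℂ} (h : ∀ n, W n = weighted s c n) :
    normL2s s c = ‖W‖ := by
  rw [normL2s, lp.norm_eq_tsum_rpow (by simp), ENNReal.toReal_ofNat, ← Real.sqrt_eq_rpow]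
  congr 1
  refine tsum_congr fun n => ?_
  rw [h, weighted, norm_mul, Complex.norm_real,
    Real.norm_of_nonneg (Real.rpow_nonneg (wt_pos n).le _), Real.rpow_ofNat]

theorem ContDiffL2s.exists_deriv {s : ℝ} {I : Set ℝ} (hI : IsOpen I) {c : ℝ → Idx → ℂ}
    (h : ContDiffL2s 1 s I c) : ∃ c' : ℝ → Idx → ℂ,
      (∀ t ∈ I, ∀ n, HasDerivAt (fun τ => c τ n) (c' t n) t) ∧
      ∀ n, ContinuousOn (fun t => c' t n) I := by
  obtain ⟨W, hW, hWd⟩ := h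
  have hWd1 : ContDiffOn ℝ 1 W I := by simpa using hWd
  have hd : ∀ t ∈ I, HasDerivAt W (deriv W t) t := fun t ht =>
    ((hWd1.differentiableOn one_ne_zero).differentiableAt (hI.mem_nhds ht)).hasDerivAt
  have hc : ContinuousOn (deriv W) I := hWd1.continuousOn_deriv_of_isOpen hI le_rfl
  refine ⟨fun t n => ((wt n ^ s : ℝ) : ℂ)⁻¹ * deriv W t n, fun t ht n => ?_, fun n =>
    continuousOn_const.mul (continuousOn_lp_apply hc n)⟩
  refine ((hasDerivAt_lp_apply (hd t ht) n).const_mul _).congr_of_eventuallyEq ?_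
  filter_upwards [hI.mem_nhds ht] with τ hτ
  rw [hW τ hτ, weighted, inv_mul_cancel_left₀ (weight_ne_zero s n)]

theorem contDiffL2s_one {s : ℝ} {I : Set ℝ} (hI : IsOpen I) {c : ℝ → Idx → ℂ} {W W' : ℝ → Ell2}
    (hW : ∀ t ∈ I, ∀ n, W t n = weighted s (c t) n) (hd : ∀ t ∈ I, HasDerivAt W (W' t) t)
    (hc : ContinuousOn W' I) : ContDiffL2s 1 s I c := by
  refine ⟨W, hW, ?_⟩
  rw [Nat.cast_one, contDiffOn_one_iff_derivWithin hI.uniqueDiffOn]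
  refine ⟨fun t ht => (hd t ht).differentiableAt.differentiableWithinAt, hc.congr fun t ht => ?_⟩
  rw [derivWithin_of_isOpen hI ht, (hd t ht).deriv]

theorem tsum_norm_finsupp (α : Idx →₀ ℂ) : (Summable fun n => ‖α n‖) ∧
    ∑' n, ‖α n‖ = ∑ n ∈ α.support, ‖α n‖ := by
  have h : ∀ n ∉ α.support, ‖α n‖ = 0 := fun n hn => by
    rw [Finsupp.notMem_support_iff.1 hn, norm_zero]
  exact ⟨summable_of_ne_finset_zero h, tsum_eq_sum h⟩

theorem sum_sq_le {α : Idx →₀ ℂ} (hα : ∑ n ∈ α.support, ‖α n‖ ≤ 1 / 2) :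
    ∑ n ∈ α.support, ‖α n‖ ^ 2 ≤ 1 / 4 := by
  have h := Finset.sum_sq_le_sq_sum_of_nonneg (s := α.support) (f := fun n => ‖α n‖)
    fun n _ => norm_nonneg _
  have h0 : 0 ≤ ∑ n ∈ α.support, ‖α n‖ := Finset.sum_nonneg fun n _ => norm_nonneg _
  nlinarith

theorem norm_sq_le {α : Idx →₀ ℂ} (hα : ∑ n ∈ α.support, ‖α n‖ ≤ 1 / 2) (n : Idx) :
    ‖α n‖ ^ 2 ≤ 1 / 4 := by
  have h : ‖α n‖ ≤ 1 / 2 := ((tsum_norm_finsupp α).1.le_tsum n fun _ _ => norm_nonneg _).trans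
    ((tsum_norm_finsupp α).2.trans_le hα)
  nlinarith [norm_nonneg (α n)]

/-! ### Solutions with rotating coefficients -/

/-- The coefficients with profile `B`, for the rotation speeds `θ`. -/
def rotate (θ : Idx → ℝ) (t : ℝ) (B : Idx → ℂ) (n : Idx) : ℂ :=
  Complex.exp (-Complex.I * (θ n * Real.log t : ℝ)) * B n

theorem norm_rotate (θ : Idx → ℝ) (t : ℝ) (B : Idx → ℂ) (n : Idx) : ‖rotate θ t B n‖ = ‖B n‖ := by
  rw [rotate, norm_mul, show -Complex.I * (θ n * Real.log t : ℝ) =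
    ((-(θ n * Real.log t) : ℝ) : ℂ) * Complex.I by push_cast; ring,
    Complex.norm_exp_ofReal_mul_I, one_mul]

theorem norm_rotate_sub (θ : Idx → ℝ) (t : ℝ) (B B' : Idx → ℂ) (n : Idx) :
    ‖rotate θ t B n - rotate θ t B' n‖ = ‖B n - B' n‖ := by
  rw [← norm_rotate θ t (fun n => B n - B' n), rotate, rotate, rotate, mul_sub]

/-- The rotation speeds `±|α_n|² / (8π)`. -/
def speed (σ : ℝ) (α : Idx →₀ ℂ) (n : Idx) : ℝ := σ * ‖α n‖ ^ 2 / (8 * Real.pi)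

theorem speed_mul_log (σ : ℝ) (α : Idx →₀ ℂ) (n : Idx) {t : ℝ} (ht : 0 < t) :
    σ * (‖α n‖ ^ 2 / (4 * Real.pi) * Real.log (Real.sqrt t)) = speed σ α n * Real.log t := by
  rw [Real.log_sqrt ht.le, speed]
  have := Real.pi_ne_zero
  field_simp
  ring

theorem hasDerivAt_rotate (θ : Idx → ℝ) {B : ℝ → Idx → ℂ} {B' : ℂ} {t : ℝ} (ht : 0 < t) (n : Idx)
    (hB : HasDerivAt (fun τ => B τ n) B' t) : HasDerivAt (fun τ => rotate θ τ (B τ) n)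
      (Complex.exp (-Complex.I * (θ n * Real.log t : ℝ)) *
        (-Complex.I * (θ n * t⁻¹ : ℝ) * B t n + B')) t := by
  refine ((hasDerivAt_rotation (θ n) ht).mul hB).congr_deriv ?_
  ring

theorem continuousOn_deriv_rotate (θ : Idx → ℝ) {B B' : ℝ → Idx → ℂ} {T : ℝ} (n : Idx)
    (hB : ContinuousOn (fun t => B t n) (Ioo 0 T)) (hB' : ContinuousOn (fun t => B' t n) (Ioo 0 T)) :
    ContinuousOn (fun t => Complex.exp (-Complex.I * (θ n * Real.log t : ℝ)) *
        (-Complex.I * (θ n * t⁻¹ : ℝ) * B t n + B' t n)) (Ioo 0 T) := by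
  have h0 : ∀ t ∈ Ioo 0 T, t ≠ 0 := fun t ht => ht.1.ne'
  have h1 : ContinuousOn Real.log (Ioo 0 T) := Real.continuousOn_log.mono fun t ht => h0 t ht
  have h2 : ContinuousOn (fun t : ℝ => t⁻¹) (Ioo 0 T) := continuousOn_id.inv₀ h0
  refine ContinuousOn.mul ?_ (ContinuousOn.add (ContinuousOn.mul ?_ hB) hB')
  · exact Complex.continuous_exp.comp_continuousOn (continuousOn_const.mul
      (Complex.continuous_ofReal.comp_continuousOn (continuousOn_const.mul h1)))
  · exact continuousOn_const.mul (Complex.continuous_ofReal.comp_continuousOn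
      (continuousOn_const.mul h2))

/-- What the ansatz says about the coefficients. -/
theorem HasAnsatz.exists_coefficients {s γ a b σ T : ℝ} {α : Idx →₀ ℂ} {u : ℝ → ℝ → ℂ}
    (h : HasAnsatz s γ a b σ T α u) : ∃ (R A' : ℝ → Idx → ℂ) (C : ℝ), 0 ≤ C ∧
      (∀ t ∈ Ioo 0 T, (Summable fun n => ‖R t n‖) ∧ ∑' n, ‖R t n‖ ≤ C * t ^ γ) ∧
      (∀ t ∈ Ioo 0 T, ∀ x, u t x = wave a b (rotate (speed σ α) t fun n => α n + R t n) t x) ∧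
      (∀ t ∈ Ioo 0 T, ∀ n, HasDerivAt
        (fun τ => rotate (speed σ α) τ (fun n => α n + R τ n) n) (A' t n) t) ∧
      ∀ n, ContinuousOn (fun t => A' t n) (Ioo 0 T) := by
  obtain ⟨R, ⟨hR, hRs, C, hC⟩, hu⟩ := h
  obtain ⟨R', hR', hR'c⟩ := hR.exists_deriv isOpen_Ioo
  have hRc : ∀ n, ContinuousOn (fun t => α n + R t n) (Ioo 0 T) := fun n t ht =>
    ((hR' t ht n).continuousAt.const_add _).continuousWithinAt
  refine ⟨R, _, max C 0, le_max_right _ _, fun t ht => ⟨hRs t ht, (hC t ht).2.trans ?_⟩,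
    fun t ht x => ?_, fun t ht n => hasDerivAt_rotate (speed σ α) ht.1 n
      ((hR' t ht n).const_add (α n)), fun n => continuousOn_deriv_rotate (speed σ α)
      (B := fun t n => α n + R t n) (B' := R') n (hRc n) (hR'c n)⟩
  · exact mul_le_mul_of_nonneg_right (le_max_left _ _) (Real.rpow_nonneg ht.1.le _)
  · rw [hu t ht, wave]
    refine tsum_congr fun n => ?_
    rw [speed_mul_log σ α n ht.1, rotate]

theorem tsum_norm_rotate_le {θ : Idx → ℝ} {t : ℝ} {α : Idx →₀ ℂ} {R : Idx → ℂ}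
    (hR : Summable fun n => ‖R n‖) : (Summable fun n => ‖rotate θ t (fun n => α n + R n) n‖) ∧
    ∑' n, ‖rotate θ t (fun n => α n + R n) n‖ ≤ ∑ n ∈ α.support, ‖α n‖ + ∑' n, ‖R n‖ := by
  simp only [norm_rotate]
  have h := (tsum_norm_finsupp α).1.add hR
  have h1 : Summable fun n => ‖α n + R n‖ :=
    Summable.of_nonneg_of_le (fun _ => norm_nonneg _) (fun _ => norm_add_le _ _) h
  refine ⟨h1, (h1.tsum_le_tsum (fun _ => norm_add_le _ _) h).trans (le_of_eq ?_)⟩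
  rw [(tsum_norm_finsupp α).1.tsum_add hR, (tsum_norm_finsupp α).2]

/-- The wave with the given coefficients is determined by the ansatz. -/
theorem ansatz_unique {s γ a b σ T : ℝ} (hγ : 1 / 2 < γ) (hσ : σ = 1 ∨ σ = -1)
    (hpt : Function.Injective (pt a b)) {α : Idx →₀ ℂ} (hα : ∑ n ∈ α.support, ‖α n‖ ≤ 1 / 2)
    {M : ℝ} (hM : 0 ≤ M) (hM' : M ≤ 1) {u v : ℝ → ℝ → ℂ}
    (hu : IsDistribSolution σ M T u) (hua : HasAnsatz s γ a b σ T α u)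
    (hv : IsDistribSolution σ M T v) (hva : HasAnsatz s γ a b σ T α v) :
    ∀ t ∈ Ioo 0 T, ∀ x, v t x = u t x := by
  obtain ⟨R, A', C, hC, hR, huR, hA, hA'⟩ := hua.exists_coefficients
  obtain ⟨S, B', D, hD, hS, hvS, hB, hB'⟩ := hva.exists_coefficients
  set c := ∑ n ∈ α.support, ‖α n‖ with hc
  have hc0 : 0 ≤ c := Finset.sum_nonneg fun _ _ => norm_nonneg _
  have hγ0 : 0 ≤ γ := by linarith
  -- The factor 1 in front of the time matches the sign ς = 1 of `eq_of_force`.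
  have key : ∀ {R : ℝ → Idx → ℂ} {C : ℝ} {w : ℝ → ℝ → ℂ} {A' : ℝ → Idx → ℂ}, 0 ≤ C →
      (∀ t ∈ Ioo 0 T, (Summable fun n => ‖R t n‖) ∧ ∑' n, ‖R t n‖ ≤ C * t ^ γ) →
      (∀ t ∈ Ioo 0 T, ∀ x, w t x = wave a b (rotate (speed σ α) t fun n => α n + R t n) t x) →
      (∀ t ∈ Ioo 0 T, ∀ n, HasDerivAt
        (fun τ => rotate (speed σ α) τ (fun n => α n + R τ n) n) (A' t n) t) →
      (∀ n, ContinuousOn (fun t => A' t n) (Ioo 0 T)) → IsDistribSolution σ M T w →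
      ∀ t' ∈ Ioo 0 T, ∀ t ∈ Ioo 0 T, t' ≤ t → ∀ n, IntervalIntegrable (fun τ => force a b σ M (1 * τ)
        (rotate (speed σ α) τ fun n => α n + R τ n) n) volume t' t ∧
        rotate (speed σ α) t (fun n => α n + R t n) n -
          rotate (speed σ α) t' (fun n => α n + R t' n) n = ∫ τ in t'..t, force a b σ M (1 * τ)
        (rotate (speed σ α) τ fun n => α n + R τ n) n := by
    intro R C w A' hC hR hw hA hA' hsol t' ht'
    simp only [one_mul]
    have hT0 : 0 ≤ T ^ γ := Real.rpow_nonneg (ht'.1.trans ht'.2).le _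
    refine integral_force_of_isDistribSolution hpt hσ hM (C := c + C * T ^ γ) (by positivity)
      (fun t ht => (tsum_norm_rotate_le (hR t ht).1).1) (fun t ht => ?_) hw hsol hA hA' t' ht'
    refine (tsum_norm_rotate_le (hR t ht).1).2.trans
      (add_le_add_right ((hR t ht).2.trans (mul_le_mul_of_nonneg_left ?_ hC)) _)
    exact Real.rpow_le_rpow ht.1.le ht.2.le hγ0
  have heq := eq_of_force (C := C + D) (a := a) (b := b) (M := M) hγ hσ (Or.inl rfl) hM hM' hc0 hα
    (add_nonneg hC hD) (A := fun t => rotate (speed σ α) t fun n => α n + S t n)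
    (B := fun t => rotate (speed σ α) t fun n => α n + R t n)
    (fun t ht => (tsum_norm_rotate_le (hS t ht).1).1)
    (fun t ht => (tsum_norm_rotate_le (hR t ht).1).1) (fun t ht => ?_) (fun t ht => ?_)
    (fun t ht => ?_) (key hD hS hvS hB hB' hv) (key hC hR huR hA hA' hu)
  · intro t ht x
    rw [hvS t ht, huR t ht, wave, wave]
    exact tsum_congr fun n => by rw [heq t ht n]
  · have h0 := Real.rpow_nonneg ht.1.le γ
    refine (tsum_norm_rotate_le (hS t ht).1).2.trans (add_le_add_right ((hS t ht).2.trans ?_) _)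
    nlinarith
  · have h0 := Real.rpow_nonneg ht.1.le γ
    refine (tsum_norm_rotate_le (hR t ht).1).2.trans (add_le_add_right ((hR t ht).2.trans ?_) _)
    nlinarith
  · simp only [norm_rotate_sub, add_sub_add_left_eq_sub]
    have hsum := (hS t ht).1.add (hR t ht).1
    refine ((Summable.of_nonneg_of_le (fun _ => norm_nonneg _) (fun _ => norm_sub_le _ _)
      hsum).tsum_le_tsum (fun _ => norm_sub_le _ _) hsum).trans ?_
    rw [(hS t ht).1.tsum_add (hR t ht).1]
    have := (hS t ht).2
    have := (hR t ht).2
    linarith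

/-- The distributional solution with logarithmically rotating coefficients. -/
theorem exists_unique_ansatz {s γ a b σ : ℝ} (hs : 0 < s) (hγ : 1 / 2 < γ) (hγ' : γ < 1)
    (hσ : σ = 1 ∨ σ = -1) (hpt : Function.Injective (pt a b)) (α : Idx →₀ ℂ)
    (hα : ∑ n ∈ α.support, ‖α n‖ ≤ 1 / 2) :
    ∃ T : ℝ, 0 < T ∧ ∃ u : ℝ → ℝ → ℂ,
      (IsDistribSolution σ (∑ n ∈ α.support, ‖α n‖ ^ 2) T u ∧ HasAnsatz s γ a b σ T α u) ∧
      ∀ v : ℝ → ℝ → ℂ, IsDistribSolution σ (∑ n ∈ α.support, ‖α n‖ ^ 2) T v →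
        HasAnsatz s γ a b σ T α v → ∀ t ∈ Ioo 0 T, ∀ x, v t x = u t x := by
  set M := ∑ n ∈ α.support, ‖α n‖ ^ 2 with hM
  have hM0 : 0 ≤ M := Finset.sum_nonneg fun n _ => by positivity
  have hM1 : M ≤ 1 / 4 := sum_sq_le hα
  -- Positive times, with the rotation speeds of the ansatz; since M is the full mass, `lam` is the
  -- resonant coefficient by definition.
  obtain ⟨T, hT, V, V', W, W', hV, hode⟩ := exists_profile hs hγ hγ' hσ hpt (ς := 1) one_ne_zero
    (speed σ α) (fun n => 2 * M - ‖α n‖ ^ 2) α hα (fun n => by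
      have := norm_sq_le hα n
      rw [abs_le]
      constructor <;> nlinarith [norm_nonneg (α n)]) (fun n _ => rfl)
  have hlam : ∀ n, 2 * M - ‖α n‖ ^ 2 = 2 * M - 8 * Real.pi * σ * speed σ α n := by
    intro n
    have := Real.pi_ne_zero
    rw [speed]
    field_simp
    rcases hσ with rfl | rfl <;> norm_num
  set A : ℝ → Idx → ℂ := fun t => rotate (speed σ α) t fun n => α n + V t n with hA
  have hd : ∀ t ∈ Ioo 0 T, ∀ n, HasDerivAt (fun τ => A τ n) (force a b σ M t (A t) n) t := by
    intro t ht n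
    have h := hasDerivAt_coefficient hσ (Or.inl rfl) hlam α ht.1 (hV.hasDerivAt t ht) (hode t ht) n
    rw [one_mul] at h
    exact h
  have hVd : ∀ t ∈ Ioo 0 T, ∀ n, HasDerivAt (fun τ => α n + V τ n) (V' t n) t := fun t ht n =>
    (hasDerivAt_lp_apply (hV.hasDerivAt t ht) n).const_add _
  have hTγ : ∀ t ∈ Ioo 0 T, t ^ γ ≤ T ^ γ := fun t ht =>
    Real.rpow_le_rpow ht.1.le ht.2.le (by linarith)
  set u : ℝ → ℝ → ℂ := fun t x => wave a b (A t) t x with hu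
  have hsol : IsDistribSolution σ M T u := by
    refine isDistribSolution_of_hasDerivAt (C := ∑ n ∈ α.support, ‖α n‖ + T ^ γ) hσ hM0
      (fun t ht => (tsum_norm_rotate_le (V t).summable).1) (fun t ht => ?_) hd (fun n => ?_)
      fun t _ x => rfl
    · refine (tsum_norm_rotate_le (V t).summable).2.trans (add_le_add_right ?_ _)
      rw [← Ell1.norm_eq]
      exact (hV.norm_le t ht).trans (hTγ t ht)
    -- Continuity of the force is read off from its being the derivative of a rotated coefficient,
    -- which the profile computes in a second way.
    · refine (continuousOn_deriv_rotate (speed σ α) (B := fun t n => α n + V t n)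
        (B' := fun t => V' t) n (fun t ht => (hVd t ht n).continuousAt.continuousWithinAt)
        (continuousOn_lp_apply hV.continuousOn n)).congr fun t ht => ?_
      exact (hd t ht n).unique (hasDerivAt_rotate (speed σ α) ht.1 n (hVd t ht n))
  have hans : HasAnsatz s γ a b σ T α u := by
    refine ⟨fun t => V t, ⟨contDiffL2s_one isOpen_Ioo (fun t _ n => hV.weighted_eq t n)
      hV.hasDerivAt₂ hV.continuousOn₂, fun t _ => (V t).summable, ?_⟩, fun t ht x => ?_⟩
    · obtain ⟨C, hC⟩ := hV.norm₂_le
      refine ⟨max (C + C) 1, fun t ht => ⟨?_, ?_⟩⟩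
      · have e : (fun n => deriv (fun τ => V τ n) t) = V' t := funext fun n =>
          (hasDerivAt_lp_apply (hV.hasDerivAt t ht) n).deriv
        rw [e, normL2s_eq_norm (hV.weighted_eq t), normL2s_eq_norm (hV.weighted_eq' t)]
        refine le_trans (add_le_add ?_ (hC t ht).2) (le_max_left _ _)
        have h0 : 0 < t ^ γ := Real.rpow_pos_of_pos ht.1 γ
        rw [Real.rpow_neg ht.1.le, inv_mul_le_iff₀ h0, mul_comm]
        exact (hC t ht).1
      · rw [← Ell1.norm_eq]
        refine (hV.norm_le t ht).trans ?_
        exact le_mul_of_one_le_left (Real.rpow_nonneg ht.1.le _) (le_max_right _ _)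
    · simp only [hu, wave]
      refine tsum_congr fun n => ?_
      rw [speed_mul_log σ α n ht.1]
      rfl
  exact ⟨T, hT, u, ⟨hsol, hans⟩, fun v hv hva =>
    ansatz_unique hγ hσ hpt hα hM0 (by linarith) hsol hans hv hva⟩

/-! ### The free evolution of Dirac masses -/

open FourierTransform in
/-- The free evolution of a Schwartz function, transposed to `schrodinger t`. -/
def propagate (t : ℝ) (φ : 𝓢(ℝ, ℂ)) : 𝓢(ℝ, ℂ) :=
  𝓕 (SchwartzMap.smulLeftCLM ℂ (schrodingerSymbol t) (𝓕⁻ φ))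

theorem schrodinger_apply (t : ℝ) (Λ : 𝓢'(ℝ, ℂ)) (φ : 𝓢(ℝ, ℂ)) :
    schrodinger t Λ φ = Λ (propagate t φ) := rfl

theorem schrodinger_schrodinger_neg (t : ℝ) (Λ : 𝓢'(ℝ, ℂ)) :
    schrodinger t (schrodinger (-t) Λ) = Λ := by
  rw [schrodinger, schrodinger, TemperedDistribution.fourierMultiplierCLM_fourierMultiplierCLM_apply
    (hasTemperateGrowth_schrodingerSymbol _) (hasTemperateGrowth_schrodingerSymbol _)]
  have h : schrodingerSymbol (-t) * schrodingerSymbol t = fun _ => 1 := by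
    funext ξ
    rw [Pi.mul_apply, schrodingerSymbol, schrodingerSymbol, ← Complex.exp_add]
    rw [show -Complex.I * ((-t * (2 * Real.pi * ξ) ^ 2 : ℝ) : ℂ) +
      -Complex.I * ((t * (2 * Real.pi * ξ) ^ 2 : ℝ) : ℂ) = 0 by push_cast; ring, Complex.exp_zero]
  rw [h, TemperedDistribution.fourierMultiplierCLM_const, one_smul]
  rfl

theorem schrodinger_neg_schrodinger (t : ℝ) (Λ : 𝓢'(ℝ, ℂ)) :
    schrodinger (-t) (schrodinger t Λ) = Λ := by
  have h := schrodinger_schrodinger_neg (-t) Λ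
  rwa [neg_neg] at h

open FourierTransform in
theorem propagate_apply (t : ℝ) (φ : 𝓢(ℝ, ℂ)) (y : ℝ) :
    propagate t φ y = ∫ ξ : ℝ, Complex.exp ((-2 * Real.pi * ξ * y : ℝ) * Complex.I) *
      (schrodingerSymbol t ξ * (𝓕⁻ φ : 𝓢(ℝ, ℂ)) ξ) := by
  rw [propagate, SchwartzMap.fourier_coe, Real.fourier_real_eq_integral_exp_smul]
  refine integral_congr_ae (Eventually.of_forall fun ξ => ?_)
  simp only []
  rw [SchwartzMap.smulLeftCLM_apply_apply (hasTemperateGrowth_schrodingerSymbol t), smul_eq_mul,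
    smul_eq_mul]

open FourierTransform in
theorem fourierInv_apply_eq_integral (φ : 𝓢(ℝ, ℂ)) (ξ : ℝ) :
    (𝓕⁻ φ : 𝓢(ℝ, ℂ)) ξ = ∫ x : ℝ, Complex.exp ((2 * Real.pi * ξ * x : ℝ) * Complex.I) * φ x := by
  rw [SchwartzMap.fourierInv_coe, Real.fourierInv_eq']
  refine integral_congr_ae (Eventually.of_forall fun x => ?_)
  simp only [smul_eq_mul]
  congr 3
  simp only [RCLike.inner_apply, conj_trivial]
  push_cast
  ring

/-- The kernel of the free evolution in the complexified time `ε + it`. -/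
def complexKernel (ζ : ℂ) (z : ℝ) : ℂ :=
  (1 / (4 * Real.pi * ζ)) ^ (1 / 2 : ℂ) * Complex.exp (-(z : ℂ) ^ 2 / (4 * ζ))

theorem integral_gaussian_eq {ζ : ℂ} (hζ : 0 < ζ.re) (x y : ℝ) :
    ∫ ξ : ℝ, Complex.exp (-(4 * Real.pi ^ 2 * ζ) * ξ ^ 2 +
      (2 * Real.pi * Complex.I * (x - y)) * ξ + 0) = complexKernel ζ (x - y) := by
  have hζ0 : ζ ≠ 0 := by rintro rfl; simp at hζ
  have hπ : (Real.pi : ℂ) ≠ 0 := by exact_mod_cast Real.pi_ne_zero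
  have hb : (-(4 * Real.pi ^ 2 * ζ) : ℂ).re < 0 := by
    have : (-(4 * Real.pi ^ 2 * ζ) : ℂ).re = -(4 * Real.pi ^ 2 * ζ.re) := by
      rw [show (4 * (Real.pi : ℂ) ^ 2 * ζ) = ((4 * Real.pi ^ 2 : ℝ) : ℂ) * ζ by push_cast; ring,
        Complex.neg_re, Complex.re_ofReal_mul]
    rw [this]
    have := Real.pi_pos
    exact neg_neg_of_pos (by positivity)
  rw [integral_cexp_quadratic hb, complexKernel]
  congr 2
  · rw [neg_neg]
    field_simp
  · push_cast
    field_simp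
    rw [Complex.I_sq]
    ring

theorem norm_cexp_gaussian (ζ : ℂ) (z ξ : ℝ) :
    ‖Complex.exp (-(4 * Real.pi ^ 2 * ζ) * ξ ^ 2 + (z : ℂ) * Complex.I)‖ =
      Real.exp (-(4 * Real.pi ^ 2 * ζ.re) * ξ ^ 2) := by
  rw [Complex.norm_exp]
  congr 1
  rw [show (-(4 * (Real.pi : ℂ) ^ 2 * ζ) * (ξ : ℂ) ^ 2) =
    ((-(4 * Real.pi ^ 2) * ξ ^ 2 : ℝ) : ℂ) * ζ by push_cast; ring, Complex.add_re,
    Complex.re_ofReal_mul, Complex.re_ofReal_mul, Complex.I_re]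
  ring

open FourierTransform in
-- With Re ζ > 0 the Gaussian makes the double integral absolutely convergent, so Fubini applies;
-- for purely imaginary ζ it would not.
theorem integral_regularised {ζ : ℂ} (hζ : 0 < ζ.re) (φ : 𝓢(ℝ, ℂ)) (y : ℝ) :
    ∫ ξ : ℝ, Complex.exp (-(4 * Real.pi ^ 2 * ζ) * ξ ^ 2 + (-2 * Real.pi * ξ * y : ℝ) * Complex.I) *
      (𝓕⁻ φ : 𝓢(ℝ, ℂ)) ξ = ∫ x : ℝ, complexKernel ζ (x - y) * φ x := by
  have hg : Integrable fun ξ : ℝ => Complex.exp (-(4 * Real.pi ^ 2 * ζ) * ξ ^ 2 +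
      (-2 * Real.pi * ξ * y : ℝ) * Complex.I) := by
    have hb : (-(4 * Real.pi ^ 2 * ζ) : ℂ).re < 0 := by
      rw [show (4 * (Real.pi : ℂ) ^ 2 * ζ) = ((4 * Real.pi ^ 2 : ℝ) : ℂ) * ζ by push_cast; ring,
        Complex.neg_re, Complex.re_ofReal_mul]
      have := Real.pi_pos
      exact neg_neg_of_pos (by positivity)
    refine (integrable_cexp_quadratic' hb (-2 * Real.pi * y * Complex.I) 0).congr
      (Eventually.of_forall fun ξ => ?_)
    simp only []
    congr 1
    push_cast
    ring
  have hp : Integrable (fun p : ℝ × ℝ => Complex.exp (-(4 * Real.pi ^ 2 * ζ) * p.1 ^ 2 +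
      (-2 * Real.pi * p.1 * y : ℝ) * Complex.I) *
        (Complex.exp ((2 * Real.pi * p.1 * p.2 : ℝ) * Complex.I) * φ p.2))
      (volume.prod volume) := by
    have h1 := hg.mul_prod (φ.integrable (μ := volume))
    have h2 := h1.bdd_mul (c := 1) (f := fun p : ℝ × ℝ =>
      Complex.exp ((2 * Real.pi * p.1 * p.2 : ℝ) * Complex.I)) (by fun_prop)
      (Eventually.of_forall fun p => by rw [Complex.norm_exp_ofReal_mul_I])
    refine h2.congr (Eventually.of_forall fun p => ?_)
    simp only []
    ring
  simp only [fourierInv_apply_eq_integral, ← integral_const_mul]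
  rw [integral_integral_swap hp]
  refine integral_congr_ae (Eventually.of_forall fun x => ?_)
  simp only []
  rw [← integral_gaussian_eq hζ, ← integral_mul_const]
  refine integral_congr_ae (Eventually.of_forall fun ξ => ?_)
  simp only []
  rw [← mul_assoc, ← Complex.exp_add]
  congr 2
  push_cast
  ring

/-- A domination uniform in ε: |ε + it| ≥ |t| controls the root, and the exponent has nonpositive
real part. -/
theorem norm_complexKernel_le {ε t : ℝ} (hε : 0 < ε) (ht : t ≠ 0) (z : ℝ) :
    ‖complexKernel (ε + Complex.I * t) z‖ ≤ (1 / (4 * Real.pi * |t|)) ^ (1 / 2 : ℝ) := by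
  have hre : (ε + Complex.I * t : ℂ).re = ε := by simp
  have him : (ε + Complex.I * t : ℂ).im = t := by simp
  have h0 : (ε + Complex.I * t : ℂ) ≠ 0 := fun h => hε.ne' (by rw [← hre, h, Complex.zero_re])
  have h1 : ‖(1 / (4 * Real.pi * (ε + Complex.I * t)) : ℂ) ^ (1 / 2 : ℂ)‖ =
      (1 / (4 * Real.pi * ‖(ε + Complex.I * t : ℂ)‖)) ^ (1 / 2 : ℝ) := by
    have e : (1 / 2 : ℂ) = ((1 / 2 : ℝ) : ℂ) := by push_cast; rfl
    rw [e, Complex.norm_cpow_real]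
    congr 1
    rw [norm_div, norm_mul, norm_mul, norm_one, Complex.norm_real,
      Real.norm_of_nonneg Real.pi_pos.le]
    simp
  have h2 : ‖Complex.exp (-(z : ℂ) ^ 2 / (4 * (ε + Complex.I * t)))‖ ≤ 1 := by
    rw [Complex.norm_exp, Real.exp_le_one_iff]
    have e : (-(z : ℂ) ^ 2 / (4 * (ε + Complex.I * t))) =
        ((-(z ^ 2 / 4) : ℝ) : ℂ) * (ε + Complex.I * t : ℂ)⁻¹ := by
      push_cast
      field_simp
    rw [e, Complex.re_ofReal_mul, Complex.inv_re, hre]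
    have : 0 ≤ ε / Complex.normSq (ε + Complex.I * t) := div_nonneg hε.le (Complex.normSq_nonneg _)
    nlinarith [sq_nonneg z]
  rw [complexKernel, norm_mul, h1]
  have hp : 0 ≤ (1 / (4 * Real.pi * ‖(ε + Complex.I * t : ℂ)‖)) ^ (1 / 2 : ℝ) := by positivity
  refine (mul_le_of_le_one_right hp h2).trans ?_
  refine Real.rpow_le_rpow (by positivity) ?_ (by norm_num)
  have hπ := Real.pi_pos
  have : |t| ≤ ‖(ε + Complex.I * t : ℂ)‖ := by
    have := Complex.abs_im_le_norm (ε + Complex.I * t)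
    rwa [him] at this
  have ht' := abs_pos.2 ht
  exact one_div_le_one_div_of_le (by positivity) (by gcongr)

/-- The delicate point is the branch. For either sign of t the argument of 4πit is ±π/2, so the
principal root commutes with inversion and is continuous there. -/
theorem tendsto_complexKernel {t : ℝ} (ht : t ≠ 0) (x y : ℝ) :
    Tendsto (fun ε : ℝ => complexKernel (ε + Complex.I * t) (x - y)) (𝓝[>] 0)
      (𝓝 (evolvedDirac t y x)) := by
  have htc : (t : ℂ) ≠ 0 := by exact_mod_cast ht
  have hπ : (Real.pi : ℂ) ≠ 0 := by exact_mod_cast Real.pi_ne_zero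
  have hI := Complex.I_ne_zero
  have hz : Tendsto (fun ε : ℝ => (ε : ℂ) + Complex.I * t) (𝓝[>] 0) (𝓝 (Complex.I * t)) := by
    have h : Continuous fun ε : ℝ => (ε : ℂ) + Complex.I * t := by fun_prop
    have h2 := h.tendsto 0
    simp only [Complex.ofReal_zero, zero_add] at h2
    exact h2.mono_left nhdsWithin_le_nhds
  have hne : Complex.I * (t : ℂ) ≠ 0 := mul_ne_zero hI htc
  have e : evolvedDirac t y x = complexKernel (Complex.I * t) (x - y) := by
    have e1 : (1 / (4 * Real.pi * (Complex.I * t)) : ℂ) = (4 * Real.pi * Complex.I * t : ℂ)⁻¹ := by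
      rw [one_div, mul_assoc (4 * (Real.pi : ℂ))]
    have harg : (4 * Real.pi * Complex.I * t : ℂ).arg ≠ Real.pi := by
      intro h
      rw [Complex.arg_eq_pi_iff] at h
      have : (4 * Real.pi * Complex.I * t : ℂ).im = 4 * Real.pi * t := by simp
      rw [this] at h
      exact mul_ne_zero (mul_ne_zero four_ne_zero Real.pi_ne_zero) ht h.2
    rw [evolvedDirac, complexKernel, e1, Complex.inv_cpow _ _ harg, div_eq_inv_mul]
    congr 2
    push_cast
    field_simp
    rw [Complex.I_sq]
    ring
  rw [e]
  unfold complexKernel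
  refine Tendsto.mul ?_ ((Complex.continuous_exp.tendsto _).comp ?_)
  · refine Tendsto.cpow ?_ tendsto_const_nhds ?_
    · exact tendsto_const_nhds.div (tendsto_const_nhds.mul hz)
        (by simp [htc, Real.pi_ne_zero])
    · right
      rw [show (1 / (4 * Real.pi * (Complex.I * t)) : ℂ) = ((-(1 / (4 * Real.pi * t)) : ℝ) : ℂ) *
        Complex.I by push_cast; field_simp; rw [Complex.I_sq]; ring]
      simp [Real.pi_ne_zero, ht]
  · exact tendsto_const_nhds.div (tendsto_const_nhds.mul hz) (by simp [htc])

open FourierTransform in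
/-- The free evolution of a Dirac mass, tested against a Schwartz function. -/
theorem propagate_eq_integral {t : ℝ} (ht : t ≠ 0) (φ : 𝓢(ℝ, ℂ)) (y : ℝ) :
    propagate t φ y = ∫ x : ℝ, evolvedDirac t y x * φ x := by
  have hφ := φ.integrable (μ := volume)
  have h1 : Tendsto (fun ε : ℝ => ∫ x : ℝ, complexKernel (ε + Complex.I * t) (x - y) * φ x)
      (𝓝[>] 0) (𝓝 (∫ x : ℝ, evolvedDirac t y x * φ x)) := by
    refine tendsto_integral_filter_of_dominated_convergence
      (fun x => (1 / (4 * Real.pi * |t|)) ^ (1 / 2 : ℝ) * ‖φ x‖) ?_ ?_ (hφ.norm.const_mul _) ?_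
    · refine Eventually.of_forall fun ε => Continuous.aestronglyMeasurable ?_
      have := φ.continuous
      unfold complexKernel
      fun_prop
    · filter_upwards [self_mem_nhdsWithin] with ε hε
      refine Eventually.of_forall fun x => ?_
      rw [norm_mul]
      exact mul_le_mul_of_nonneg_right (norm_complexKernel_le hε ht _) (norm_nonneg _)
    · exact Eventually.of_forall fun x => (tendsto_complexKernel ht x y).mul_const _
  have h2 : Tendsto (fun ε : ℝ => ∫ ξ : ℝ, Complex.exp (-(4 * Real.pi ^ 2 * (ε + Complex.I * t)) *
      ξ ^ 2 + (-2 * Real.pi * ξ * y : ℝ) * Complex.I) * (𝓕⁻ φ : 𝓢(ℝ, ℂ)) ξ) (𝓝[>] 0)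
      (𝓝 (propagate t φ y)) := by
    rw [propagate_apply]
    refine tendsto_integral_filter_of_dominated_convergence (fun ξ => ‖(𝓕⁻ φ : 𝓢(ℝ, ℂ)) ξ‖) ?_ ?_
      ((𝓕⁻ φ : 𝓢(ℝ, ℂ)).integrable (μ := volume)).norm ?_
    · refine Eventually.of_forall fun ε => Continuous.aestronglyMeasurable ?_
      have := (𝓕⁻ φ : 𝓢(ℝ, ℂ)).continuous
      fun_prop
    · filter_upwards [self_mem_nhdsWithin] with ε hε
      refine Eventually.of_forall fun ξ => ?_
      rw [norm_mul, norm_cexp_gaussian]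
      refine mul_le_of_le_one_left (norm_nonneg _) ?_
      rw [Real.exp_le_one_iff]
      have : (ε + Complex.I * t : ℂ).re = ε := by simp
      rw [this]
      have : 0 ≤ 4 * Real.pi ^ 2 * ε := by have : 0 < ε := hε; positivity
      nlinarith [sq_nonneg ξ]
    · refine Eventually.of_forall fun ξ => ?_
      rw [← mul_assoc]
      refine Tendsto.mul_const _ ?_
      rw [schrodingerSymbol, ← Complex.exp_add]
      have h : Continuous fun ε : ℝ => Complex.exp (-(4 * Real.pi ^ 2 * (ε + Complex.I * t)) *
        ξ ^ 2 + (-2 * Real.pi * ξ * y : ℝ) * Complex.I) := by fun_prop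
      have h3 := (h.tendsto 0).mono_left (nhdsWithin_le_nhds (s := Ioi 0))
      refine h3.trans (le_of_eq ?_)
      congr 2
      push_cast
      ring
  refine tendsto_nhds_unique (h2.congr' ?_) h1
  filter_upwards [self_mem_nhdsWithin] with ε hε
  exact integral_regularised (by simpa using hε) φ y

/-! ### Sums of Dirac masses as tempered distributions -/

theorem exists_schwartz_bound (φ : 𝓢(ℝ, ℂ)) : ∃ C, ∀ x, ‖φ x‖ ≤ C :=
  ⟨_, fun x => (SchwartzMap.toBoundedContinuousFunctionCLM ℂ ℝ ℂ φ).norm_coe_le_norm x⟩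

/-- The pairing of the masses at the points `ak + bk̃` with a bounded function. -/
def diracFunctional (a b : ℝ) (A : Ell1) : BoundedContinuousFunction ℝ ℂ →L[ℂ] ℂ :=
  LinearMap.mkContinuous
    { toFun := fun f => ∑' n, A n * f (pt a b n)
      map_add' := fun f g => by
        have h : ∀ f : BoundedContinuousFunction ℝ ℂ, Summable fun n => A n * f (pt a b n) :=
          fun f => Summable.of_norm_bounded (A.summable.mul_right ‖f‖) fun n => by
            rw [norm_mul]
            exact mul_le_mul_of_nonneg_left (f.norm_coe_le_norm _) (norm_nonneg _)
        rw [← (h f).tsum_add (h g)]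
        exact tsum_congr fun n => by rw [BoundedContinuousFunction.add_apply, mul_add]
      map_smul' := fun c f => by
        rw [RingHom.id_apply, smul_eq_mul, ← tsum_mul_left]
        exact tsum_congr fun n => by
          rw [BoundedContinuousFunction.smul_apply, smul_eq_mul]; ring }
    ‖A‖ fun f => by
      rw [Ell1.norm_eq, ← tsum_mul_right]
      refine tsum_of_norm_bounded (A.summable.mul_right ‖f‖).hasSum fun n => ?_
      rw [norm_mul]
      exact mul_le_mul_of_nonneg_left (f.norm_coe_le_norm _) (norm_nonneg _)

/-- The tempered distribution `∑ A_{k,k̃} δ_{ak + bk̃}`. -/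
def diracSum (a b : ℝ) (A : Ell1) : 𝓢'(ℝ, ℂ) :=
  ContinuousLinearMap.toPointwiseConvergenceCLM _ _ _ _
    ((diracFunctional a b A).comp (SchwartzMap.toBoundedContinuousFunctionCLM ℂ ℝ ℂ))

theorem diracSum_apply (a b : ℝ) (A : Ell1) (φ : 𝓢(ℝ, ℂ)) :
    diracSum a b A φ = ∑' n, A n * φ (pt a b n) := rfl

theorem isDiracSum_diracSum (a b : ℝ) (A : Ell1) : IsDiracSum a b A (diracSum a b A) :=
  ⟨A.summable, diracSum_apply a b A⟩

theorem IsDiracSum.eq_diracSum {a b : ℝ} {c : Idx → ℂ} {Λ : 𝓢'(ℝ, ℂ)} (h : IsDiracSum a b c Λ) :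
    Λ = diracSum a b (ofFun c) := by
  ext φ
  rw [h.2, diracSum_apply]
  exact tsum_congr fun n => by rw [ofFun_apply h.1]

/-- The sum of the Dirac masses, tested against a fixed function. -/
theorem exists_diracPair (a b : ℝ) (φ : 𝓢(ℝ, ℂ)) :
    ∃ P : Ell1 →L[ℂ] ℂ, ∀ A, P A = diracSum a b A φ := by
  obtain ⟨C, hC⟩ := exists_schwartz_bound φ
  refine ⟨pairCLM (fun n => φ (pt a b n)) C fun n => hC _, fun A => ?_⟩
  rw [pairCLM_apply, diracSum_apply]
  exact tsum_congr fun n => mul_comm _ _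

theorem diracSum_smul (a b : ℝ) (c : ℂ) (A : Ell1) : diracSum a b (c • A) =
    c • diracSum a b A := by
  ext φ
  obtain ⟨P, hP⟩ := exists_diracPair a b φ
  change diracSum a b (c • A) φ = c • diracSum a b A φ
  rw [← hP, ← hP, map_smul]

theorem diracDatum_eq (a b : ℝ) (α : Idx →₀ ℂ) : diracDatum a b α = diracSum a b (ofFun α) := by
  ext φ
  rw [diracSum_apply, tsum_eq_sum (s := α.support) fun n hn => by
    rw [ofFun_apply (tsum_norm_finsupp α).1, Finsupp.notMem_support_iff.1 hn, zero_mul], diracDatum]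
  have h : ∀ s : Finset Idx, (∑ n ∈ s, α n • TemperedDistribution.delta (pt a b n) : 𝓢'(ℝ, ℂ)) φ =
      ∑ n ∈ s, α n * φ (pt a b n) := by
    classical
    intro s
    induction s using Finset.induction_on with
    | empty => rfl
    | insert n s hn ih =>
      rw [Finset.sum_insert hn, Finset.sum_insert hn, ← ih]
      rfl
  rw [h]
  exact Finset.sum_congr rfl fun n _ => by rw [ofFun_apply (tsum_norm_finsupp α).1]

/-! ### Distributions given by functions -/

theorem IsRegularDistrib.locallyIntegrable {f : ℝ → ℂ} {Λ : 𝓢'(ℝ, ℂ)}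
    (h : IsRegularDistrib f Λ) : LocallyIntegrable f := by
  intro x
  let g : ContDiffBump x := ⟨1, 2, one_pos, one_lt_two⟩
  have hc : HasCompactSupport fun z => (g z : ℂ) :=
    g.hasCompactSupport.comp_left (g := fun x : ℝ => (x : ℂ)) Complex.ofReal_zero
  have hd : ContDiff ℝ ∞ fun z => (g z : ℂ) := Complex.ofRealCLM.contDiff.comp g.contDiff
  have h1 := (h (hc.toSchwartzMap hd)).1
  refine ⟨Metric.closedBall x 1, Metric.closedBall_mem_nhds x one_pos, ?_⟩
  refine (h1.integrableOn (s := Metric.closedBall x 1)).congr_fun (fun z hz => ?_)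
    Metric.isClosed_closedBall.measurableSet
  simp [g.one_of_mem_closedBall hz]

/-- A Duhamel solution comes with some function representing it, determined only up to null sets.
This lets its nonlinearity be computed from the series of waves. -/
theorem IsRegularDistrib.ae_eq {f g : ℝ → ℂ} {Λ : 𝓢'(ℝ, ℂ)} (hf : IsRegularDistrib f Λ)
    (hg : IsRegularDistrib g Λ) : f =ᵐ[volume] g := by
  refine ae_eq_of_integral_contDiff_smul_eq hf.locallyIntegrable hg.locallyIntegrable
    fun φ hφ hφc => ?_
  have hc : HasCompactSupport fun z => (φ z : ℂ) :=
    hφc.comp_left (g := fun x : ℝ => (x : ℂ)) Complex.ofReal_zero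
  have hd : ContDiff ℝ ∞ fun z => (φ z : ℂ) := Complex.ofRealCLM.contDiff.comp hφ
  have h1 := (hf (hc.toSchwartzMap hd)).2
  rw [(hg (hc.toSchwartzMap hd)).2] at h1
  simp only [HasCompactSupport.toSchwartzMap_toFun] at h1
  have e : ∀ f : ℝ → ℂ, ∫ x, φ x • f x = ∫ x, f x * (hc.toSchwartzMap hd) x := fun f =>
    integral_congr_ae (Eventually.of_forall fun x => by
      simp [mul_comm])
  rw [e, e]
  exact h1.symm

theorem IsRegularDistrib.eq_of_ae_eq {f g : ℝ → ℂ} {Λ Λ' : 𝓢'(ℝ, ℂ)} (hf : IsRegularDistrib f Λ)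
    (hg : IsRegularDistrib g Λ') (h : f =ᵐ[volume] g) : Λ = Λ' := by
  ext φ
  rw [(hf φ).2, (hg φ).2]
  refine integral_congr_ae ?_
  filter_upwards [h] with x hx
  rw [hx]

theorem continuous_evolvedDirac (t y : ℝ) : Continuous fun x => evolvedDirac t y x :=
  continuous_iff_continuousAt.2 fun x => (hasDerivAt_evolvedDirac_right t y x).continuousAt

/-- For fixed t ≠ 0 all evolved masses have the same constant modulus, so against a Schwartz
function the ℓ¹ series may be integrated term by term. -/
theorem isRegularDistrib_wave (a b : ℝ) {t : ℝ} (ht : t ≠ 0) (A : Ell1) :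
    IsRegularDistrib (wave a b A t) (schrodinger t (diracSum a b A)) := by
  intro φ
  set R := 1 / Real.sqrt (4 * Real.pi * |t|)
  have hφ := φ.integrable (μ := volume)
  have hi : ∀ n, Integrable fun x => A n * evolvedDirac t (pt a b n) x * φ x := by
    intro n
    refine hφ.bdd_mul (c := ‖A n‖ * R)
      ((continuous_evolvedDirac t _).const_mul _).aestronglyMeasurable
      (Eventually.of_forall fun x => ?_)
    rw [norm_mul, norm_evolvedDirac]
  have hle : ∀ n, ∫ x, ‖A n * evolvedDirac t (pt a b n) x * φ x‖ = ‖A n‖ * (R * ∫ x, ‖φ x‖) := by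
    intro n
    rw [← integral_const_mul, ← integral_const_mul]
    refine integral_congr_ae (Eventually.of_forall fun x => ?_)
    simp only []
    rw [norm_mul, norm_mul, norm_evolvedDirac]
    ring
  have hs : Summable fun n => ∫ x, ‖A n * evolvedDirac t (pt a b n) x * φ x‖ := by
    simp only [hle]
    exact A.summable.mul_right _
  have hw : ∀ x, wave a b A t x * φ x = ∑' n, A n * evolvedDirac t (pt a b n) x * φ x :=
    fun x => tsum_mul_right.symm
  have h := hasSum_integral_of_summable_integral_norm hi hs
  have hm : AEStronglyMeasurable (wave a b A t) volume :=
    aestronglyMeasurable_tsum (fun n => ((continuous_evolvedDirac t _).const_mul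
      _).aestronglyMeasurable) (Eventually.of_forall fun x =>
        (summable_mul_evolvedDirac A.summable a b t x).of_norm)
  refine ⟨hφ.bdd_mul hm (Eventually.of_forall fun x => norm_wave_le A.summable a b t x), ?_⟩
  rw [schrodinger_apply, diracSum_apply]
  simp only [hw]
  rw [← h.tsum_eq]
  refine tsum_congr fun n => ?_
  rw [propagate_eq_integral ht, ← integral_const_mul]
  refine integral_congr_ae (Eventually.of_forall fun x => ?_)
  simp only []
  ring

/-- The nonlinearity, expanded in evolved Dirac masses, for both signs of the time. -/
theorem nonlinearity_eq_wave {σ : ℝ} (hσ : σ = 1 ∨ σ = -1) {A : Idx → ℂ}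
    (hA : Summable fun n => ‖A n‖) (a b M : ℝ) {t : ℝ} (ht : t ≠ 0) (x : ℝ) :
    ((‖wave a b A t x‖ ^ 2 - M / (2 * Real.pi * |t|) : ℝ) : ℂ) * wave a b A t x =
      wave a b (fun n => -(2 * Complex.I * σ) * force a b σ M t A n) t x := by
  have h := cubic_wave hA a b t x
  have ht' : ((|t| : ℝ) : ℂ) ≠ 0 := by
    have := abs_pos.2 ht
    exact_mod_cast this.ne'
  have hπ : (Real.pi : ℂ) ≠ 0 := by exact_mod_cast Real.pi_ne_zero
  have hσ2 : (σ : ℂ) * σ = 1 := by rcases hσ with rfl | rfl <;> simp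
  have e : wave a b (fun n => -(2 * Complex.I * σ) * force a b σ M t A n) t x =
      ((1 / (4 * Real.pi * |t|) : ℝ) : ℂ) * wave a b (cubic a b (1 / t) A) t x -
        ((M / (2 * Real.pi * |t|) : ℝ) : ℂ) * wave a b A t x := by
    simp only [wave]
    rw [← tsum_mul_left, ← tsum_mul_left,
      ← ((summable_mul_evolvedDirac (summable_cubic hA a b (1 / t)) a b t x).of_norm.mul_left
        _).tsum_sub ((summable_mul_evolvedDirac hA a b t x).of_norm.mul_left _)]
    refine tsum_congr fun n => ?_
    rw [force]
    push_cast
    field_simp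
    rw [Complex.I_sq]
    linear_combination (cubic a b (1 / t) A n - 2 * M * A n) * hσ2 * 16 *
      evolvedDirac t (pt a b n) x
  rw [e, ← h]
  push_cast
  ring

/-- Transported back by the free group, the nonlinearity is again a sum of Dirac masses at the same
points. The constant -2iσ is the inverse of the factor iσ/2 in Duhamel's formula. -/
theorem isRegularDistrib_nonlinearity {σ : ℝ} (hσ : σ = 1 ∨ σ = -1) (a b M : ℝ) {t : ℝ}
    (ht : t ≠ 0) (A : Ell1) : IsRegularDistrib
      (fun x => ((‖wave a b A t x‖ ^ 2 - M / (2 * Real.pi * |t|) : ℝ) : ℂ) * wave a b A t x)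
      (schrodinger t (-(2 * Complex.I * σ) • diracSum a b (ofFun (force a b σ M t A)))) := by
  have h := isRegularDistrib_wave a b ht (-(2 * Complex.I * (σ : ℂ)) • ofFun (force a b σ M t A))
  rw [diracSum_smul] at h
  convert h using 2 with x
  rw [nonlinearity_eq_wave hσ A.summable a b M ht]
  simp only [wave]
  refine tsum_congr fun n => ?_
  rw [lp.coeFn_smul, Pi.smul_apply, ofFun_apply (summable_force A.summable a b σ M t), smul_eq_mul]

/-! ### Fourier coefficients of the lift to the plane -/

theorem integral_period {a : ℝ} (ha : a ≠ 0) (j : ℤ) :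
    ∫ ξ in Ioo 0 (2 * Real.pi / |a|), Complex.exp (Complex.I * (ξ * (a * j) : ℝ)) =
      if j = 0 then ((2 * Real.pi / |a| : ℝ) : ℂ) else 0 := by
  have ha' := abs_pos.2 ha
  have hp : 0 ≤ 2 * Real.pi / |a| := by have := Real.pi_pos; positivity
  rw [← integral_Ioc_eq_integral_Ioo, ← intervalIntegral.integral_of_le hp]
  split_ifs with hj
  · subst hj
    simp
  · have hjc : (j : ℂ) ≠ 0 := by exact_mod_cast hj
    have hac : (a : ℂ) ≠ 0 := by exact_mod_cast ha
    have hc : Complex.I * (a * j) ≠ 0 := mul_ne_zero Complex.I_ne_zero (mul_ne_zero hac hjc)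
    have e : ∀ ξ : ℝ, Complex.exp (Complex.I * (ξ * (a * j) : ℝ)) =
        Complex.exp (Complex.I * (a * j) * ξ) := fun ξ => by
      congr 1; push_cast; ring
    simp only [e]
    rw [integral_exp_mul_complex hc]
    have h1 : Complex.exp (Complex.I * (a * j) * ((2 * Real.pi / |a| : ℝ) : ℂ)) = 1 := by
      rw [Complex.exp_eq_one_iff]
      rcases abs_choice a with h | h
      · refine ⟨j, ?_⟩
        rw [h]
        push_cast
        field_simp
      · refine ⟨-j, ?_⟩
        rw [h]
        push_cast
        field_simp
    rw [h1]
    simp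

section lift

variable {a b : ℝ} {c : Idx → ℂ}

theorem norm_liftHat_term (a b : ℝ) (c : Idx → ℂ) (ξ : ℝ × ℝ) (n : Idx) :
    ‖c n * Complex.exp (-Complex.I * (ξ.1 * (a * n.1) + ξ.2 * (b * n.2) : ℝ))‖ = ‖c n‖ := by
  rw [norm_mul, show -Complex.I * (ξ.1 * (a * n.1) + ξ.2 * (b * n.2) : ℝ) =
    ((-(ξ.1 * (a * n.1) + ξ.2 * (b * n.2)) : ℝ) : ℂ) * Complex.I by push_cast; ring,
    Complex.norm_exp_ofReal_mul_I, mul_one]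

theorem volume_cell_lt_top (a b : ℝ) : volume (cell a b) < ⊤ := by
  rw [cell, Measure.volume_eq_prod, Measure.prod_prod]
  exact ENNReal.mul_lt_top measure_Ioo_lt_top measure_Ioo_lt_top

theorem memLp_liftHat (hc : Summable fun n => ‖c n‖) :
    MemLp (liftHat a b c) 2 (volume.restrict (cell a b)) := by
  have : IsFiniteMeasure (volume.restrict (cell a b)) := ⟨by
    rw [Measure.restrict_apply_univ]; exact volume_cell_lt_top a b⟩
  refine MemLp.of_bound (aestronglyMeasurable_tsum (fun n => ?_)
    (Eventually.of_forall fun ξ => ?_)) (∑' n, ‖c n‖) (Eventually.of_forall fun ξ => ?_)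
  · exact Continuous.aestronglyMeasurable (by fun_prop)
  · refine Summable.of_norm ?_
    simpa only [norm_liftHat_term] using hc
  · exact tsum_of_norm_bounded hc.hasSum fun n => (norm_liftHat_term a b c ξ n).le

/-- Orthogonality of the exponentials on the period cell. It identifies the norm of H^s, and
regularity with values in it, with those of l^{2,s}. -/
theorem cellCoeff_liftHat (ha : a ≠ 0) (hb : b ≠ 0) (hc : Summable fun n => ‖c n‖) :
    cellCoeff a b (liftHat a b c) = c := by
  funext n
  have hfin : IsFiniteMeasure (volume.restrict (cell a b)) := ⟨by
    rw [Measure.restrict_apply_univ]; exact volume_cell_lt_top a b⟩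
  have ha' := abs_pos.2 ha
  have hb' := abs_pos.2 hb
  have hπ := Real.pi_pos
  set e : Idx → ℝ × ℝ → ℂ := fun m ξ =>
    c m * Complex.exp (-Complex.I * (ξ.1 * (a * m.1) + ξ.2 * (b * m.2) : ℝ)) *
      Complex.exp (Complex.I * (ξ.1 * (a * n.1) + ξ.2 * (b * n.2) : ℝ)) with he
  have hnorm : ∀ m ξ, ‖e m ξ‖ = ‖c m‖ := fun m ξ => by
    rw [he, norm_mul, norm_liftHat_term, mul_comm Complex.I, Complex.norm_exp_ofReal_mul_I, mul_one]
  have hint : ∀ m, Integrable (e m) (volume.restrict (cell a b)) := fun m =>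
    Integrable.of_bound (Continuous.aestronglyMeasurable (by fun_prop)) ‖c m‖
      (Eventually.of_forall fun ξ => (hnorm m ξ).le)
  have hs : Summable fun m => ∫ ξ in cell a b, ‖e m ξ‖ := by
    simp only [hnorm, integral_const, smul_eq_mul]
    exact hc.mul_left _
  have hval : ∀ m, ∫ ξ in cell a b, e m ξ =
      if m = n then c n * (((2 * Real.pi) ^ 2 / (|a| * |b|) : ℝ) : ℂ) else 0 := by
    intro m
    have h1 : ∀ ξ, e m ξ = c m * (Complex.exp (Complex.I * (ξ.1 * (a * (n.1 - m.1 : ℤ)) : ℝ)) *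
        Complex.exp (Complex.I * (ξ.2 * (b * (n.2 - m.2 : ℤ)) : ℝ))) := by
      intro ξ
      simp only [he]
      rw [mul_assoc, ← Complex.exp_add, ← Complex.exp_add]
      congr 2
      push_cast
      ring
    simp only [h1]
    rw [integral_const_mul, cell, Measure.volume_eq_prod,
      setIntegral_prod_mul (fun ξ : ℝ => Complex.exp (Complex.I * (ξ * (a * (n.1 - m.1 : ℤ)) : ℝ)))
        (fun ξ : ℝ => Complex.exp (Complex.I * (ξ * (b * (n.2 - m.2 : ℤ)) : ℝ))),
      integral_period ha, integral_period hb]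
    by_cases hm : m = n
    · subst hm
      simp only [sub_self, if_true]
      congr 1
      rw [← Complex.ofReal_mul]
      congr 1
      field_simp
    · rw [if_neg hm]
      by_cases h1 : n.1 - m.1 = 0
      · have h2 : n.2 - m.2 ≠ 0 := fun h2 => hm (Prod.ext (by linarith) (by linarith))
        rw [if_neg h2, mul_zero, mul_zero]
      · rw [if_neg h1, zero_mul, mul_zero]
  have h2 : ∀ ξ : ℝ × ℝ, liftHat a b c ξ *
      Complex.exp (Complex.I * (ξ.1 * (a * n.1) + ξ.2 * (b * n.2) : ℝ)) = ∑' m, e m ξ := fun ξ => by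
    rw [liftHat, ← tsum_mul_right]
  rw [cellCoeff]
  simp only [h2]
  rw [← (hasSum_integral_of_summable_integral_norm hint hs).tsum_eq]
  simp only [hval, tsum_ite_eq]
  rw [mul_left_comm, ← Complex.ofReal_mul]
  rw [show |a| * |b| / (2 * Real.pi) ^ 2 * ((2 * Real.pi) ^ 2 / (|a| * |b|)) = 1 by field_simp]
  simp

theorem ContDiffL2s.congr {m : ℕ} {s : ℝ} {I : Set ℝ} {c c' : ℝ → Idx → ℂ}
    (h : ContDiffL2s m s I c) (hc : ∀ t ∈ I, c' t = c t) : ContDiffL2s m s I c' := by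
  obtain ⟨W, hW, hWd⟩ := h
  exact ⟨W, fun t ht n => by rw [hW t ht, hc t ht], hWd⟩

theorem contDiffHs_liftHat (ha : a ≠ 0) (hb : b ≠ 0) {m : ℕ} {s : ℝ} {I : Set ℝ}
    {c : ℝ → Idx → ℂ} (hc : ∀ t ∈ I, Summable fun n => ‖c t n‖) (h : ContDiffL2s m s I c) :
    ContDiffHs m s a b I fun t => liftHat a b (c t) :=
  ⟨fun t ht => memLp_liftHat (hc t ht), h.congr fun t ht => cellCoeff_liftHat ha hb (hc t ht)⟩

end lift

/-! ### Profiles for both signs of the time -/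

/-- Reflecting time changes the sign of a derivative, and this is absorbed in σ. Negative times are
thus reduced to positive ones. -/
theorem force_neg (a b σ M t : ℝ) (A : Idx → ℂ) (n : Idx) :
    force a b (-σ) M t A n = -force a b σ M t A n := by
  rw [force, force]
  push_cast
  ring

/-- The case without rotation: `hres` says that the resonances at α equal 2Mα_n, so the term of the
equation that contains M cancels them and the speeds can be zero. -/
theorem exists_half_profile {s γ a b σ ς M : ℝ} (hs : 0 < s) (hγ : 1 / 2 < γ) (hγ' : γ < 1)
    (hσ : σ = 1 ∨ σ = -1) (hς : ς = 1 ∨ ς = -1) (hpt : Function.Injective (pt a b)) (α : Idx →₀ ℂ)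
    (hα : ∑ n ∈ α.support, ‖α n‖ ≤ 1 / 2) (hM : 0 ≤ M) (hM1 : M ≤ 1)
    (hres : ∀ n ∈ α.support, 2 * ∑ j ∈ α.support, ‖α j‖ ^ 2 - ‖α n‖ ^ 2 = 2 * M) :
    ∃ T > 0, ∃ (V V' : ℝ → Ell1) (W W' : ℝ → Ell2), IsStrongRemainder s γ T V V' W W' ∧
      ∀ t ∈ Ioo 0 T, ∀ n, V' t n = force a b σ M (ς * t) (fun n => α n + V t n) n := by
  have hς0 : ς ≠ 0 := by rcases hς with rfl | rfl <;> norm_num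
  obtain ⟨T, hT, V, V', W, W', hV, hode⟩ := exists_profile hs hγ hγ' hσ hpt hς0
    (fun _ => 0) (fun _ => 2 * M) α hα (fun _ => by rw [abs_le]; constructor <;> linarith) hres
  refine ⟨T, hT, V, V', W, W', hV, fun t ht n => ?_⟩
  have h := hasDerivAt_coefficient (M := M) hσ hς (θ := fun _ => 0) (lam := fun _ => 2 * M)
    (fun _ => by ring) α ht.1 (hV.hasDerivAt t ht) (hode t ht) n
  simp only [zero_mul, Complex.ofReal_zero, mul_zero, Complex.exp_zero, one_mul] at h
  exact ((hasDerivAt_lp_apply (hV.hasDerivAt t ht) n).const_add (α n)).unique h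

section glue

variable {E : Type*} [NormedAddCommGroup E] {f g : ℝ → E} {t : ℝ}

/-- The function that is `f` for positive times and the reflection of `g` for negative ones. -/
def glue (f g : ℝ → E) (t : ℝ) : E := if 0 < t then f t else if t < 0 then g (-t) else 0

theorem glue_of_pos (f g : ℝ → E) (ht : 0 < t) : glue f g t = f t := if_pos ht

theorem glue_of_neg (f g : ℝ → E) (ht : t < 0) : glue f g t = g (-t) := by
  rw [glue, if_neg ht.le.not_gt, if_pos ht]

theorem glue_zero (f g : ℝ → E) : glue f g 0 = 0 := by simp [glue]

theorem hasDerivAt_glue [NormedSpace ℝ E] {T : ℝ} {f' g' : ℝ → E} (hf : ∀ t ∈ Ioo 0 T, HasDerivAt f (f' t) t)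
    (hg : ∀ t ∈ Ioo 0 T, HasDerivAt g (g' t) t) (ht : t ∈ Ioo (-T) T \ {0}) :
    HasDerivAt (glue f g) (glue f' (fun t => -g' t) t) t := by
  rcases lt_or_gt_of_ne (show t ≠ 0 from ht.2) with h | h
  · rw [glue_of_neg _ _ h]
    have h1 := (hg (-t) ⟨by linarith, by linarith [ht.1.1]⟩).scomp t (hasDerivAt_neg t)
    rw [neg_smul, one_smul] at h1
    refine h1.congr_of_eventuallyEq ?_
    filter_upwards [Iio_mem_nhds h] with τ hτ using glue_of_neg f g hτ
  · rw [glue_of_pos _ _ h]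
    refine (hf t ⟨h, ht.1.2⟩).congr_of_eventuallyEq ?_
    filter_upwards [Ioi_mem_nhds h] with τ hτ using glue_of_pos f g hτ

theorem continuousOn_glue {T : ℝ} (hf : ContinuousOn f (Ioo 0 T)) (hg : ContinuousOn g (Ioo 0 T)) :
    ContinuousOn (glue f g) (Ioo (-T) T \ {0}) := by
  intro t ht
  refine ContinuousAt.continuousWithinAt ?_
  rcases lt_or_gt_of_ne (show t ≠ 0 from ht.2) with h | h
  · have h1 : ContinuousAt g (-t) :=
      hg.continuousAt (Ioo_mem_nhds (by linarith) (by linarith [ht.1.1]))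
    refine (ContinuousAt.comp (f := fun t : ℝ => -t) h1 continuousAt_neg).congr ?_
    filter_upwards [Iio_mem_nhds h] with τ hτ using (glue_of_neg f g hτ).symm
  · refine (hf.continuousAt (Ioo_mem_nhds h ht.1.2)).congr ?_
    filter_upwards [Ioi_mem_nhds h] with τ hτ using (glue_of_pos f g hτ).symm

theorem norm_glue_le {T C D γ : ℝ} (hγ : 0 < γ) (hf : ∀ t ∈ Ioo 0 T, ‖f t‖ ≤ C * t ^ γ)
    (hg : ∀ t ∈ Ioo 0 T, ‖g t‖ ≤ D * t ^ γ) (ht : t ∈ Ioo (-T) T) :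
    ‖glue f g t‖ ≤ max C D * |t| ^ γ := by
  rcases lt_trichotomy t 0 with h | h | h
  · rw [glue_of_neg _ _ h, abs_of_neg h]
    have h' : -t ∈ Ioo 0 T := ⟨by linarith, by linarith [ht.1]⟩
    exact (hg _ h').trans (mul_le_mul_of_nonneg_right (le_max_right _ _)
      (Real.rpow_nonneg h'.1.le _))
  · rw [h, glue_zero, abs_zero, Real.zero_rpow hγ.ne', mul_zero, norm_zero]
  · rw [glue_of_pos _ _ h, abs_of_pos h]
    exact (hf _ ⟨h, ht.2⟩).trans (mul_le_mul_of_nonneg_right (le_max_left _ _)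
      (Real.rpow_nonneg h.le _))

end glue

/-- A remainder on `(-T,T)` that is of class `C¹` away from `0` in `ℓ¹` and in `l^{2,s}` and whose
coefficients solve the system. -/
structure IsTwoSidedProfile (s γ a b σ M T : ℝ) (α : Idx →₀ ℂ) (V V' : ℝ → Ell1)
    (W W' : ℝ → Ell2) : Prop where
  hasDerivAt : ∀ t ∈ Ioo (-T) T \ {0}, HasDerivAt V (V' t) t
  continuousOn : ContinuousOn V' (Ioo (-T) T \ {0})
  norm_le : ∀ t ∈ Ioo (-T) T, ‖V t‖ ≤ |t| ^ γ
  weighted_eq : ∀ t n, W t n = weighted s (V t) n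
  hasDerivAt₂ : ∀ t ∈ Ioo (-T) T \ {0}, HasDerivAt W (W' t) t
  continuousOn₂ : ContinuousOn W' (Ioo (-T) T \ {0})
  norm₂_le : ∃ C, ∀ t ∈ Ioo (-T) T, ‖W t‖ ≤ C * |t| ^ γ
  eq_force : ∀ t ∈ Ioo (-T) T \ {0}, ∀ n, V' t n = force a b σ M t (ofFun α + V t : Ell1) n

theorem ofFun_add_apply (α : Idx →₀ ℂ) (V : Ell1) (n : Idx) :
    (ofFun α + V : Ell1) n = α n + V n := by
  rw [lp.coeFn_add, Pi.add_apply, ofFun_apply (tsum_norm_finsupp α).1]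

theorem IsStrongRemainder.mono {s γ T T' : ℝ} {V V' : ℝ → Ell1} {W W' : ℝ → Ell2}
    (h : IsStrongRemainder s γ T V V' W W') (hT : T' ≤ T) : IsStrongRemainder s γ T' V V' W W' := by
  have hsub : Ioo 0 T' ⊆ Ioo 0 T := Ioo_subset_Ioo_right hT
  obtain ⟨C, hC⟩ := h.norm₂_le
  exact ⟨fun t ht => h.hasDerivAt t (hsub ht), h.continuousOn.mono hsub,
    fun t ht => h.norm_le t (hsub ht), h.weighted_eq, h.weighted_eq',
    fun t ht => h.hasDerivAt₂ t (hsub ht), h.continuousOn₂.mono hsub, C, fun t ht => hC t (hsub ht)⟩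

theorem exists_twoSidedProfile {s γ a b σ M : ℝ} (hs : 0 < s) (hγ : 1 / 2 < γ) (hγ' : γ < 1)
    (hσ : σ = 1 ∨ σ = -1) (hpt : Function.Injective (pt a b)) (α : Idx →₀ ℂ)
    (hα : ∑ n ∈ α.support, ‖α n‖ ≤ 1 / 2) (hM : 0 ≤ M) (hM1 : M ≤ 1)
    (hres : ∀ n ∈ α.support, 2 * ∑ j ∈ α.support, ‖α j‖ ^ 2 - ‖α n‖ ^ 2 = 2 * M) :
    ∃ T > 0, ∃ (V V' : ℝ → Ell1) (W W' : ℝ → Ell2),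
      IsTwoSidedProfile s γ a b σ M T α V V' W W' := by
  have hγ0 : 0 < γ := by linarith
  have hσ' : -σ = 1 ∨ -σ = -1 := by rcases hσ with rfl | rfl <;> simp
  obtain ⟨T₁, hT₁, V₁, V₁', W₁, W₁', h₁, e₁⟩ := exists_half_profile hs hγ hγ' hσ (Or.inl rfl) hpt α
    hα hM hM1 hres
  -- The negative half-line is treated as a positive one with both σ and the sign of the time
  -- reversed.
  obtain ⟨T₂, hT₂, V₂, V₂', W₂, W₂', h₂, e₂⟩ := exists_half_profile hs hγ hγ' hσ' (Or.inr rfl) hpt α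
    hα hM hM1 hres
  set T := min T₁ T₂
  have k₁ := h₁.mono (min_le_left T₁ T₂)
  have k₂ := h₂.mono (min_le_right T₁ T₂)
  obtain ⟨C₁, hC₁⟩ := k₁.norm₂_le
  obtain ⟨C₂, hC₂⟩ := k₂.norm₂_le
  refine ⟨T, lt_min hT₁ hT₂, glue V₁ V₂, glue V₁' fun t => -V₂' t, glue W₁ W₂,
    glue W₁' fun t => -W₂' t, fun t ht => hasDerivAt_glue k₁.hasDerivAt k₂.hasDerivAt ht,
    continuousOn_glue k₁.continuousOn k₂.continuousOn.neg, fun t ht => ?_, fun t n => ?_,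
    fun t ht => hasDerivAt_glue k₁.hasDerivAt₂ k₂.hasDerivAt₂ ht,
    continuousOn_glue k₁.continuousOn₂ k₂.continuousOn₂.neg, ⟨max C₁ C₂, fun t ht =>
    norm_glue_le hγ0 (fun t ht => (hC₁ t ht).1) (fun t ht => (hC₂ t ht).1) ht⟩, fun t ht n => ?_⟩
  · have h := norm_glue_le (C := 1) (D := 1) hγ0 (fun t ht => by simpa using k₁.norm_le t ht)
      (fun t ht => by simpa using k₂.norm_le t ht) ht
    simpa using h
  · rcases lt_trichotomy t 0 with h | h | h
    · rw [glue_of_neg _ _ h, glue_of_neg _ _ h, k₂.weighted_eq]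
    · rw [h, glue_zero, glue_zero]
      simp [weighted]
    · rw [glue_of_pos _ _ h, glue_of_pos _ _ h, k₁.weighted_eq]
  · have e : ∀ V : Ell1, ((ofFun α + V : Ell1) : Idx → ℂ) = fun n => α n + V n := fun V =>
      funext fun n => ofFun_add_apply α V n
    rw [e]
    rcases lt_or_gt_of_ne (show t ≠ 0 from ht.2) with h | h
    · rw [glue_of_neg _ _ h, glue_of_neg _ _ h, lp.coeFn_neg, Pi.neg_apply,
        e₂ (-t) ⟨by linarith, by linarith [ht.1.1, min_le_right T₁ T₂]⟩, force_neg, neg_neg]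
      rw [show (-1 : ℝ) * -t = t by ring]
    · rw [glue_of_pos _ _ h, glue_of_pos _ _ h, e₁ t ⟨h, ht.1.2.trans_le (min_le_left _ _)⟩,
        one_mul]

/-! ### The Duhamel solution -/

theorem diracSum_add (a b : ℝ) (A B : Ell1) : diracSum a b (A + B) = diracSum a b A +
    diracSum a b B := by
  ext φ
  obtain ⟨P, hP⟩ := exists_diracPair a b φ
  change diracSum a b (A + B) φ = diracSum a b A φ + diracSum a b B φ
  rw [← hP, ← hP, ← hP, map_add]

/-- Writing the second endpoint as η t with 0 < η ≤ 1 handles both signs of t at once and keeps the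
segment away from the singular time 0. -/
theorem uIcc_scaled_subset {T t η : ℝ} (ht : t ∈ Ioo (-T) T) (ht0 : t ≠ 0) (hη : η ∈ Ioc (0 : ℝ) 1) :
    uIcc (η * t) t ⊆ Ioo (-T) T \ {0} := by
  intro τ hτ
  rcases lt_or_gt_of_ne ht0 with h | h
  · have h1 : t ≤ η * t := by nlinarith [hη.2]
    rw [uIcc_of_ge h1] at hτ
    have h2 : η * t < 0 := mul_neg_of_pos_of_neg hη.1 h
    exact ⟨⟨ht.1.trans_le hτ.1, by linarith [hτ.2, ht.1]⟩, (hτ.2.trans_lt h2).ne⟩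
  · have h1 : η * t ≤ t := by nlinarith [hη.2]
    rw [uIcc_of_le h1] at hτ
    have h2 : 0 < η * t := mul_pos hη.1 h
    exact ⟨⟨by linarith [hτ.1, ht.2], hτ.2.trans_lt ht.2⟩, (h2.trans_le hτ.1).ne'⟩

theorem tendsto_abs_rpow_zero {γ : ℝ} (hγ : 0 < γ) : Tendsto (fun t : ℝ => |t| ^ γ) (𝓝 0) (𝓝 0) := by
  have h : Tendsto (fun t : ℝ => |t|) (𝓝 0) (𝓝 0) := by simpa using (continuous_abs.tendsto (0 : ℝ))
  simpa [Real.zero_rpow hγ.ne'] using h.rpow_const (Or.inr hγ.le)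

section duhamel

variable {s γ a b σ M T : ℝ} {α : Idx →₀ ℂ} {V V' : ℝ → Ell1} {W W' : ℝ → Ell2}

/-- Pulled back by the free group, the nonlinearity is k times the Dirac sum of V'. By the
fundamental theorem its integral from ηt to t is k times that of V(t) - V(ηt), and V(ηt) → 0, so the
improper integral converges although V' need not be integrable in norm. -/
theorem IsTwoSidedProfile.isDuhamelSolution (hγ : 0 < γ) (hσ : σ = 1 ∨ σ = -1)
    (hV : IsTwoSidedProfile s γ a b σ M T α V V' W W') : IsDuhamelSolution σ M T
      (diracDatum a b α) fun t => schrodinger t (diracSum a b (ofFun α + V t)) := by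
  set k : ℂ := -(2 * Complex.I * σ) with hk
  have hk1 : Complex.I * ((σ / 2 : ℝ) : ℂ) * k = 1 := by
    have hσ2 : (σ : ℂ) * σ = 1 := by rcases hσ with rfl | rfl <;> simp
    rw [hk]
    push_cast
    linear_combination hσ2 - (σ : ℂ) * σ * Complex.I_sq
  refine ⟨fun t => wave a b (ofFun α + V t : Ell1) t, fun t => schrodinger t
    (k • diracSum a b (ofFun (force a b σ M t (ofFun α + V t : Ell1)))),
    fun t => k • diracSum a b (V t), fun τ _ hτ => isRegularDistrib_wave a b hτ _,
    fun τ _ hτ => isRegularDistrib_nonlinearity hσ a b M hτ _, fun t ht φ => ?_, fun t ht => ?_⟩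
  · obtain ⟨P, hP⟩ := exists_diracPair a b φ
    have hint : ∀ τ ∈ Ioo (-T) T \ {0}, schrodinger (-τ) (schrodinger τ
        (k • diracSum a b (ofFun (force a b σ M τ (ofFun α + V τ : Ell1))))) φ =
        k * P (V' τ) := by
      intro τ hτ
      have e : ofFun (force a b σ M τ (ofFun α + V τ : Ell1)) = V' τ := by
        rw [← ofFun_coe (V' τ)]
        exact congrArg ofFun (funext fun n => (hV.eq_force τ hτ n).symm)
      rw [schrodinger_neg_schrodinger, e, hP]
      rfl
    have hc : ContinuousOn (fun τ => k * P (V' τ)) (Ioo (-T) T \ {0}) :=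
      continuousOn_const.mul (P.continuous.comp_continuousOn hV.continuousOn)
    have hd : ∀ τ ∈ Ioo (-T) T \ {0}, HasDerivAt (fun τ => k * P (V τ)) (k * P (V' τ)) τ :=
      fun τ hτ => ((P.restrictScalars ℝ).hasFDerivAt.comp_hasDerivAt τ
        (hV.hasDerivAt τ hτ)).const_mul k
    have hJ : (k • diracSum a b (V t)) φ = k * P (V t) := by rw [hP]; rfl
    rw [hJ]
    by_cases ht0 : t = 0
    · subst ht0
      have hV0 : V 0 = 0 := by
        have h := hV.norm_le 0 ht
        rw [abs_zero, Real.zero_rpow hγ.ne'] at h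
        exact norm_le_zero_iff.1 h
      simp [hV0]
    · have hii : ∀ η ∈ Ioc (0 : ℝ) 1, IntervalIntegrable (fun τ => k * P (V' τ)) volume (η * t) t :=
        fun η hη => (hc.mono (uIcc_scaled_subset ht ht0 hη)).intervalIntegrable
      refine ⟨fun η hη => (hii η hη).congr fun τ hτ =>
        (hint τ (uIcc_scaled_subset ht ht0 hη (uIoc_subset_uIcc hτ))).symm, ?_⟩
      have h1 : Tendsto (fun η : ℝ => k * P (V t) - k * P (V (η * t))) (𝓝[>] 0)
          (𝓝 (k * P (V t) - k * P 0)) := by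
        have h2 : Tendsto (fun η : ℝ => V (η * t)) (𝓝[>] 0) (𝓝 0) := by
          have h3 : Tendsto (fun η : ℝ => η * t) (𝓝[>] 0) (𝓝 0) := by
            have := (continuous_id.mul (continuous_const (y := t))).tendsto (0 : ℝ)
            rw [Pi.mul_apply, id, zero_mul] at this
            exact this.mono_left nhdsWithin_le_nhds
          refine squeeze_zero_norm' ?_ ((tendsto_abs_rpow_zero hγ).comp h3)
          filter_upwards [Ioc_mem_nhdsGT (one_pos : (0 : ℝ) < 1)] with η hη
          exact hV.norm_le _ (uIcc_scaled_subset ht ht0 hη left_mem_uIcc).1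
        exact (((P.continuous.tendsto _).comp h2).const_mul k).const_sub _
      rw [map_zero, mul_zero, sub_zero] at h1
      refine h1.congr' ?_
      filter_upwards [Ioc_mem_nhdsGT (one_pos : (0 : ℝ) < 1)] with η hη
      have hsub := uIcc_scaled_subset ht ht0 hη
      rw [← intervalIntegral.integral_eq_sub_of_hasDerivAt (fun τ hτ => hd τ (hsub hτ)) (hii η hη)]
      exact intervalIntegral.integral_congr fun τ hτ => (hint τ (hsub hτ)).symm
  · simp only []
    rw [diracDatum_eq, diracSum_add, map_add, map_smul, smul_smul, hk1, one_smul]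

theorem exists_weighted_finsupp (s : ℝ) (α : Idx →₀ ℂ) :
    ∃ W : Ell2, ∀ n, W n = weighted s α n := by
  refine ⟨⟨weighted s α, memℓp_gen (summable_of_ne_finset_zero (s := α.support) fun n hn => ?_)⟩,
    fun n => rfl⟩
  rw [weighted, Finsupp.notMem_support_iff.1 hn]
  simp

theorem IsTwoSidedProfile.hasDiagProfile (ha : a ≠ 0) (hb : b ≠ 0) (hγ : 0 < γ)
    (hV : IsTwoSidedProfile s γ a b σ M T α V V' W W') :
    HasDiagProfile s γ a b T α fun t => schrodinger t (diracSum a b (ofFun α + V t)) := by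
  obtain ⟨Wα, hWα⟩ := exists_weighted_finsupp s α
  obtain ⟨C, hC⟩ := hV.norm₂_le
  have hw : ∀ t n, (Wα + W t) n = weighted s (ofFun α + V t : Ell1) n := fun t n => by
    rw [lp.coeFn_add, Pi.add_apply, hWα, hV.weighted_eq, weighted, weighted, weighted,
      ofFun_add_apply, mul_add]
  have hsub : ∀ t n, (ofFun α + V t : Ell1) n - α n = V t n := fun t n => by
    rw [ofFun_add_apply, add_sub_cancel_left]
  -- Away from 0 the family is differentiable; at 0 continuity comes from the bound C|t|^γ, which
  -- also forces the value there to be 0.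
  have hW0 : ContinuousOn W (Ioo (-T) T) := by
    intro t ht
    by_cases ht0 : t = 0
    · subst ht0
      have hz : W 0 = 0 := by
        have h := hC 0 ht
        rw [abs_zero, Real.zero_rpow hγ.ne', mul_zero] at h
        exact norm_le_zero_iff.1 h
      refine ContinuousAt.continuousWithinAt ?_
      rw [ContinuousAt, hz]
      refine squeeze_zero_norm' ?_ (by simpa using (tendsto_abs_rpow_zero hγ).const_mul C)
      filter_upwards [Ioo_mem_nhds ht.1 ht.2] with τ hτ using hC τ hτ
    · exact (hV.hasDerivAt₂ t ⟨ht, ht0⟩).continuousAt.continuousWithinAt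
  refine ⟨fun t => (ofFun α + V t : Ell1), fun t _ => ?_, contDiffHs_liftHat ha hb
    (fun t _ => (ofFun α + V t : Ell1).summable) ⟨fun t => Wα + W t, fun t _ => hw t, ?_⟩,
    contDiffHs_liftHat ha hb (fun t _ => (ofFun α + V t : Ell1).summable)
    (contDiffL2s_one (W := fun t => Wα + W t) (W' := W') (isOpen_Ioo.sdiff isClosed_singleton)
      (fun t _ => hw t) (fun t ht => (hV.hasDerivAt₂ t ht).const_add _) hV.continuousOn₂),
    max C 1, fun t ht => ?_⟩
  · rw [schrodinger_neg_schrodinger]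
    exact isDiracSum_diracSum a b _
  · rw [Nat.cast_zero, contDiffOn_zero]
    exact continuousOn_const.add hW0
  · simp only [hsub]
    have h0 : 0 ≤ |t| ^ γ := by positivity
    rw [normHs, cellCoeff_liftHat ha hb (V t).summable, normL2s_eq_norm (hV.weighted_eq t),
      ← Ell1.norm_eq]
    exact ⟨(hC t ht).trans (mul_le_mul_of_nonneg_right (le_max_left _ _) h0),
      (hV.norm_le t ht).trans (le_mul_of_one_le_left h0 (le_max_right _ _))⟩

end duhamel

/-! ### The coefficients of a Duhamel solution -/

/-- The points ak + bk̃ may be dense, so no fixed test function isolates one of them. Shrinking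
bumps bounded by 1 do so in the limit, by dominated convergence in ℓ¹. -/
theorem exists_narrow_bumps (x : ℝ) : ∃ φ : ℕ → 𝓢(ℝ, ℂ), (∀ k, φ k x = 1) ∧
    (∀ k y, ‖φ k y‖ ≤ 1) ∧ ∀ y ≠ x, Tendsto (fun k => φ k y) atTop (𝓝 0) := by
  let g : ℕ → ContDiffBump x := fun k =>
    ⟨1 / ((k : ℝ) + 1) / 2, 1 / ((k : ℝ) + 1), by positivity, half_lt_self (by positivity)⟩
  have hc : ∀ k, HasCompactSupport fun z => (g k z : ℂ) := fun k =>
    (g k).hasCompactSupport.comp_left (g := fun x : ℝ => (x : ℂ)) Complex.ofReal_zero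
  have hd : ∀ k, ContDiff ℝ ∞ fun z => (g k z : ℂ) := fun k =>
    Complex.ofRealCLM.contDiff.comp (g k).contDiff
  refine ⟨fun k => (hc k).toSchwartzMap (hd k), fun k => ?_, fun k y => ?_, fun y hy => ?_⟩
  · simp [(g k).one_of_mem_closedBall (Metric.mem_closedBall_self (g k).rIn_pos.le)]
  · rw [HasCompactSupport.toSchwartzMap_toFun, Complex.norm_real, Real.norm_of_nonneg (g k).nonneg]
    exact (g k).le_one
  · have h : ∀ᶠ k : ℕ in atTop, 1 / ((k : ℝ) + 1) < dist y x :=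
      tendsto_one_div_add_atTop_nhds_zero_nat.eventually_lt_const (dist_pos.2 hy)
    refine tendsto_const_nhds.congr' ?_
    filter_upwards [h] with k hk
    rw [HasCompactSupport.toSchwartzMap_toFun, (g k).zero_of_le_dist hk.le, Complex.ofReal_zero]

theorem tendsto_tsum_bumps {a b : ℝ} (hpt : Function.Injective (pt a b)) {m : Idx}
    {φ : ℕ → 𝓢(ℝ, ℂ)} (h1 : ∀ k, φ k (pt a b m) = 1) (h2 : ∀ k y, ‖φ k y‖ ≤ 1)
    (h3 : ∀ y ≠ pt a b m, Tendsto (fun k => φ k y) atTop (𝓝 0)) (A : Ell1) :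
    Tendsto (fun k => diracSum a b A (φ k)) atTop (𝓝 (A m)) := by
  have h := tendsto_tsum_of_dominated_convergence (f := fun k n => A n * φ k (pt a b n))
    (g := fun n => if n = m then A m else 0) (𝓕 := atTop) (bound := fun n => ‖A n‖) A.summable
    (fun n => ?_) (Eventually.of_forall fun k n => ?_)
  · rwa [tsum_ite_eq] at h
  · by_cases hn : n = m
    · subst hn
      simp [h1]
    · rw [if_neg hn]
      simpa using (h3 _ fun e => hn (hpt e)).const_mul (A n)
  · rw [norm_mul]
    exact mul_le_of_le_one_right (norm_nonneg _) (h2 _ _)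

section extraction

variable {a b σ M T C : ℝ} {α : Idx →₀ ℂ} {v : ℝ → 𝓢'(ℝ, ℂ)} {c : ℝ → Idx → ℂ}

/-- Duhamel's formula pulled back by the free group is an identity between Dirac sums tested against
φ. Taking φ to be shrinking bumps at x_m turns it into the integrated equation for one coefficient,
and no derivative of the coefficients is used. -/
theorem integral_force_of_isDuhamelSolution (hpt : Function.Injective (pt a b))
    (hσ : σ = 1 ∨ σ = -1) (hM : 0 ≤ M) (hC : 0 ≤ C)
    (hsol : IsDuhamelSolution σ M T (diracDatum a b α) v)
    (hc : ∀ t ∈ Ioo (-T) T, IsDiracSum a b (c t) (schrodinger (-t) (v t)))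
    (hcb : ∀ t ∈ Ioo (-T) T, ∑' n, ‖c t n‖ ≤ C) {t η : ℝ} (ht : t ∈ Ioo (-T) T) (ht0 : t ≠ 0)
    (hη : η ∈ Ioc (0 : ℝ) 1) (m : Idx) :
    IntervalIntegrable (fun τ => force a b σ M τ (c τ) m) volume (η * t) t ∧
      c t m - c (η * t) m = ∫ τ in (η * t)..t, force a b σ M τ (c τ) m := by
  obtain ⟨w, G, J, hw, hG, hJ, hv⟩ := hsol
  set k : ℂ := -(2 * Complex.I * σ) with hk
  set κ : ℂ := Complex.I * ((σ / 2 : ℝ) : ℂ) with hκ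
  have hk1 : κ * k = 1 := by
    have hσ2 : (σ : ℂ) * σ = 1 := by rcases hσ with rfl | rfl <;> simp
    rw [hk, hκ]
    push_cast
    linear_combination hσ2 - (σ : ℂ) * σ * Complex.I_sq
  have hsub := uIcc_scaled_subset ht ht0 hη
  set D : ℝ → Ell1 := fun t => ofFun (c t) with hD
  have hDc : ∀ t ∈ Ioo (-T) T, (D t : Idx → ℂ) = c t := fun t ht =>
    funext fun n => ofFun_apply (hc t ht).1 n
  have hvD : ∀ t ∈ Ioo (-T) T, v t = schrodinger t (diracSum a b (D t)) := fun t ht => by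
    rw [hD, ← (hc t ht).eq_diracSum, schrodinger_schrodinger_neg]
  -- The representing function agrees almost everywhere with the wave, hence so do the two
  -- nonlinearities, and a distribution only sees them almost everywhere.
  have hGeq : ∀ τ ∈ Ioo (-T) T, τ ≠ 0 →
      G τ = schrodinger τ (k • diracSum a b (ofFun (force a b σ M τ (c τ)))) := by
    intro τ hτ hτ0
    have h1 := hw τ hτ hτ0
    rw [hvD τ hτ] at h1
    have h2 := h1.ae_eq (isRegularDistrib_wave a b hτ0 (D τ))
    rw [← hDc τ hτ]
    refine (hG τ hτ hτ0).eq_of_ae_eq (isRegularDistrib_nonlinearity hσ a b M hτ0 (D τ)) ?_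
    filter_upwards [h2] with x hx
    rw [hx]
  have hF : ∀ φ : 𝓢(ℝ, ℂ), ∀ τ ∈ Ioo (-T) T, τ ≠ 0 → κ * schrodinger (-τ) (G τ) φ =
      diracSum a b (ofFun (force a b σ M τ (c τ))) φ := by
    intro φ τ hτ hτ0
    rw [hGeq τ hτ hτ0, schrodinger_neg_schrodinger]
    change κ * (k * _) = _
    rw [← mul_assoc, hk1, one_mul]
    rfl
  have hDJ : ∀ t ∈ Ioo (-T) T, ∀ φ : 𝓢(ℝ, ℂ), diracSum a b (D t) φ =
      diracDatum a b α φ + κ * J t φ := by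
    intro t ht φ
    have h := congrArg (schrodinger (-t)) (hv t ht)
    rw [hvD t ht, map_add, map_smul, schrodinger_neg_schrodinger, schrodinger_neg_schrodinger,
      schrodinger_neg_schrodinger] at h
    rw [h]
    rfl
  have hηt : η * t ∈ Ioo (-T) T := (hsub left_mem_uIcc).1
  have hincr : ∀ φ : 𝓢(ℝ, ℂ), diracSum a b (D t) φ - diracSum a b (D (η * t)) φ =
      ∫ τ in (η * t)..t, κ * schrodinger (-τ) (G τ) φ := by
    intro φ
    rw [hDJ t ht, hDJ _ hηt, intervalIntegral.integral_const_mul, add_sub_add_left_eq_sub, ← mul_sub]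
    congr 1
    obtain ⟨hi, hl⟩ := hJ t ht φ
    obtain ⟨hi', hl'⟩ := hJ _ hηt φ
    -- The improper integrals at t and at ηt are truncated at different points. Replacing ε by εη in
    -- the first makes the lower limits coincide, and the difference is then a proper integral.
    have hsc : Tendsto (fun ε : ℝ => ε * η) (𝓝[>] 0) (𝓝[>] 0) := by
      refine tendsto_nhdsWithin_iff.2 ⟨?_, ?_⟩
      · have h : Tendsto (fun ε : ℝ => ε * η) (𝓝 0) (𝓝 (0 * η)) :=
          (continuous_id.mul continuous_const).tendsto 0
        rw [zero_mul] at h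
        exact h.mono_left nhdsWithin_le_nhds
      · filter_upwards [self_mem_nhdsWithin] with ε hε
        exact mul_pos hε hη.1
    have h1 := hl.comp hsc
    have h2 := hl'.add_const (∫ τ in (η * t)..t, schrodinger (-τ) (G τ) φ)
    have h3 := tendsto_nhds_unique (h1.congr' ?_) h2
    · rw [h3]
      ring
    · filter_upwards [Ioc_mem_nhdsGT (one_pos : (0 : ℝ) < 1)] with ε hε
      simp only [Function.comp_apply]
      rw [intervalIntegral.integral_add_adjacent_intervals (hi' ε hε) (hi η hη), mul_assoc]
  obtain ⟨φ, p1, p2, p3⟩ := exists_narrow_bumps (pt a b m)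
  have hlim := fun A => tendsto_tsum_bumps hpt p1 p2 p3 A
  have hsum : ∀ τ ∈ Ioo (-T) T, Summable fun n => ‖force a b σ M τ (c τ) n‖ := fun τ hτ =>
    summable_force (hc τ hτ).1 a b σ M τ
  set g : ℝ → ℝ := fun τ => (3 * C ^ 2 + 2 * M) * C / (8 * Real.pi * |τ|) with hg
  have hgi : IntervalIntegrable g volume (η * t) t := by
    refine ContinuousOn.intervalIntegrable (continuousOn_const.div (by fun_prop) fun τ hτ => ?_)
    have := abs_pos.2 (show τ ≠ 0 from (hsub hτ).2)
    positivity
  have hFm : ∀ j, AEStronglyMeasurable (fun τ => κ * schrodinger (-τ) (G τ) (φ j))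
      (volume.restrict (uIoc (η * t) t)) := fun j =>
    (intervalIntegrable_iff.1 ((hJ t ht (φ j)).1 η hη)).aestronglyMeasurable.const_mul κ
  have hFl : ∀ τ ∈ uIoc (η * t) t, Tendsto (fun j => κ * schrodinger (-τ) (G τ) (φ j)) atTop
      (𝓝 (force a b σ M τ (c τ) m)) := by
    intro τ hτ
    have hτ' := hsub (uIoc_subset_uIcc hτ)
    have h := hlim (ofFun (force a b σ M τ (c τ)))
    rw [ofFun_apply (hsum τ hτ'.1)] at h
    exact h.congr fun j => (hF (φ j) τ hτ'.1 hτ'.2).symm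
  have hFb : ∀ j, ∀ τ ∈ uIoc (η * t) t, ‖κ * schrodinger (-τ) (G τ) (φ j)‖ ≤ g τ := by
    intro j τ hτ
    have hτ' := hsub (uIoc_subset_uIcc hτ)
    rw [hF (φ j) τ hτ'.1 hτ'.2, diracSum_apply]
    refine (tsum_of_norm_bounded (hsum τ hτ'.1).hasSum fun n => ?_).trans
      (tsum_norm_force_le hσ a b τ (hc τ hτ'.1).1 (hcb τ hτ'.1) hM)
    rw [norm_mul, ofFun_apply (hsum τ hτ'.1)]
    exact mul_le_of_le_one_right (norm_nonneg _) (p2 _ _)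
  have hlm : AEStronglyMeasurable (fun τ => force a b σ M τ (c τ) m)
      (volume.restrict (uIoc (η * t) t)) :=
    aestronglyMeasurable_of_tendsto_ae atTop hFm
      ((ae_restrict_iff' measurableSet_uIoc).2 (Eventually.of_forall hFl))
  refine ⟨hgi.mono_fun' hlm ((ae_restrict_iff' measurableSet_uIoc).2 (Eventually.of_forall
    fun τ hτ => ?_)), ?_⟩
  · have hτ' := hsub (uIoc_subset_uIcc hτ)
    exact norm_force_le_bound hσ hM τ (hc τ hτ'.1).1 (hcb τ hτ'.1) m
  · have h1 := intervalIntegral.tendsto_integral_filter_of_dominated_convergence (l := atTop) g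
      (Eventually.of_forall hFm)
      (Eventually.of_forall fun j => Eventually.of_forall fun τ hτ => hFb j τ hτ) hgi
      (Eventually.of_forall hFl)
    have h2 := ((hlim (D t)).sub (hlim (D (η * t)))).congr fun j => hincr (φ j)
    have h3 := tendsto_nhds_unique h2 h1
    rwa [hDc t ht, hDc _ hηt] at h3

end extraction

/-! ### Uniqueness of the Duhamel solution -/

/-- Both coefficient families solve the integrated system and are O(|t|^γ) apart, so `eq_of_force`
applies on each side of 0; at t = 0 the bound itself forces equality. The free group then recovers
the solution from its profile. -/
theorem eq_of_isDuhamelSolution {s γ a b σ M T : ℝ} (hγ : 1 / 2 < γ) (hσ : σ = 1 ∨ σ = -1)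
    (hpt : Function.Injective (pt a b)) {α : Idx →₀ ℂ} (hα : ∑ n ∈ α.support, ‖α n‖ ≤ 1 / 2)
    (hM : 0 ≤ M) (hM1 : M ≤ 1) {u v : ℝ → 𝓢'(ℝ, ℂ)}
    (hu : IsDuhamelSolution σ M T (diracDatum a b α) u) (hup : HasDiagProfile s γ a b T α u)
    (hv : IsDuhamelSolution σ M T (diracDatum a b α) v) (hvp : HasDiagProfile s γ a b T α v) :
    ∀ t ∈ Ioo (-T) T, v t = u t := by
  obtain ⟨c, hc, -, -, C, hC⟩ := hup
  obtain ⟨d, hd, -, -, D, hD⟩ := hvp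
  have hγ0 : 0 < γ := by linarith
  have hσ' : -σ = 1 ∨ -σ = -1 := by rcases hσ with rfl | rfl <;> simp
  set q := ∑ n ∈ α.support, ‖α n‖ with hq
  have hq0 : 0 ≤ q := Finset.sum_nonneg fun _ _ => norm_nonneg _
  set K := max C 0 + max D 0 with hK
  have hK0 : 0 ≤ K := add_nonneg (le_max_right _ _) (le_max_right _ _)
  have hrem : ∀ {e : ℝ → Idx → ℂ} {w : ℝ → 𝓢'(ℝ, ℂ)} {B : ℝ}, max B 0 ≤ K →
      (∀ t ∈ Ioo (-T) T, IsDiracSum a b (e t) (schrodinger (-t) (w t))) →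
      (∀ t ∈ Ioo (-T) T, ∑' n, ‖e t n - α n‖ ≤ B * |t| ^ γ) → ∀ t ∈ Ioo (-T) T,
      ∑' n, ‖e t n‖ ≤ q + K * |t| ^ γ := by
    intro e w B hB he heB t ht
    have h0 : 0 ≤ |t| ^ γ := by positivity
    have h1 : Summable fun n => ‖e t n - α n‖ := Summable.of_nonneg_of_le (fun _ => norm_nonneg _)
      (fun _ => norm_sub_le _ _) ((he t ht).1.add (tsum_norm_finsupp α).1)
    have h2 : ∀ n, ‖e t n‖ ≤ ‖α n‖ + ‖e t n - α n‖ := fun n => by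
      have := norm_add_le (α n) (e t n - α n)
      rwa [add_sub_cancel] at this
    refine ((he t ht).1.tsum_le_tsum h2 ((tsum_norm_finsupp α).1.add h1)).trans ?_
    rw [(tsum_norm_finsupp α).1.tsum_add h1, (tsum_norm_finsupp α).2]
    refine add_le_add_right ((heB t ht).trans (mul_le_mul_of_nonneg_right ?_ h0)) _
    exact (le_max_left _ _).trans hB
  have hcK := hrem (le_add_of_nonneg_right (le_max_right D 0)) hc fun t ht => (hC t ht).2
  have hdK := hrem (le_add_of_nonneg_left (le_max_right C 0)) hd fun t ht => (hD t ht).2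
  have hdc : ∀ t ∈ Ioo (-T) T, ∑' n, ‖d t n - c t n‖ ≤ K * |t| ^ γ := by
    intro t ht
    have h0 : 0 ≤ |t| ^ γ := by positivity
    have h1 : Summable fun n => ‖c t n - α n‖ := Summable.of_nonneg_of_le (fun _ => norm_nonneg _)
      (fun _ => norm_sub_le _ _) ((hc t ht).1.add (tsum_norm_finsupp α).1)
    have h2 : Summable fun n => ‖d t n - α n‖ := Summable.of_nonneg_of_le (fun _ => norm_nonneg _)
      (fun _ => norm_sub_le _ _) ((hd t ht).1.add (tsum_norm_finsupp α).1)
    have h3 : ∀ n, ‖d t n - c t n‖ ≤ ‖c t n - α n‖ + ‖d t n - α n‖ := fun n => by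
      have := norm_sub_le (d t n - α n) (c t n - α n)
      rw [sub_sub_sub_cancel_right] at this
      linarith
    have h4 := h1.add h2
    refine ((Summable.of_nonneg_of_le (fun _ => norm_nonneg _) h3 h4).tsum_le_tsum h3 h4).trans ?_
    rw [h1.tsum_add h2, hK, add_mul]
    exact add_le_add ((hC t ht).2.trans (mul_le_mul_of_nonneg_right (le_max_left _ _) h0))
      ((hD t ht).2.trans (mul_le_mul_of_nonneg_right (le_max_left _ _) h0))
  have hbd : ∀ {e : ℝ → Idx → ℂ}, (∀ t ∈ Ioo (-T) T, ∑' n, ‖e t n‖ ≤ q + K * |t| ^ γ) →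
      ∀ t ∈ Ioo (-T) T, ∑' n, ‖e t n‖ ≤ q + K * T ^ γ := by
    intro e he t ht
    refine (he t ht).trans (add_le_add_right (mul_le_mul_of_nonneg_left ?_ hK0) _)
    exact Real.rpow_le_rpow (abs_nonneg _) (abs_lt.2 ht).le hγ0.le
  have hpos : ∀ {e : ℝ → Idx → ℂ} {w : ℝ → 𝓢'(ℝ, ℂ)},
      IsDuhamelSolution σ M T (diracDatum a b α) w →
      (∀ t ∈ Ioo (-T) T, IsDiracSum a b (e t) (schrodinger (-t) (w t))) →
      (∀ t ∈ Ioo (-T) T, ∑' n, ‖e t n‖ ≤ q + K * |t| ^ γ) →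
      ∀ t' ∈ Ioo 0 T, ∀ t ∈ Ioo 0 T, t' ≤ t → ∀ n,
        IntervalIntegrable (fun τ => force a b σ M (1 * τ) (e τ) n) volume t' t ∧
        e t n - e t' n = ∫ τ in t'..t, force a b σ M (1 * τ) (e τ) n := by
    intro e w hw he heb t' ht' t ht htt n
    have hT : 0 ≤ T ^ γ := Real.rpow_nonneg (ht.1.trans ht.2).le _
    have h := integral_force_of_isDuhamelSolution hpt hσ hM (C := q + K * T ^ γ) (by positivity)
      hw he (hbd heb) (t := t) (η := t' / t) ⟨by linarith [ht.1, ht.2], ht.2⟩ ht.1.ne'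
      ⟨div_pos ht'.1 ht.1, (div_le_one ht.1).2 htt⟩ n
    rw [div_mul_cancel₀ _ ht.1.ne'] at h
    simpa only [one_mul] using h
  -- Substituting -τ in the integrals turns the system on (-T, 0) into one on (0, T) with σ replaced
  -- by -σ and ς = -1.
  have hneg : ∀ {e : ℝ → Idx → ℂ} {w : ℝ → 𝓢'(ℝ, ℂ)},
      IsDuhamelSolution σ M T (diracDatum a b α) w →
      (∀ t ∈ Ioo (-T) T, IsDiracSum a b (e t) (schrodinger (-t) (w t))) →
      (∀ t ∈ Ioo (-T) T, ∑' n, ‖e t n‖ ≤ q + K * |t| ^ γ) →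
      ∀ t' ∈ Ioo 0 T, ∀ t ∈ Ioo 0 T, t' ≤ t → ∀ n,
        IntervalIntegrable (fun τ => force a b (-σ) M (-1 * τ) (e (-τ)) n) volume t' t ∧
        e (-t) n - e (-t') n = ∫ τ in t'..t, force a b (-σ) M (-1 * τ) (e (-τ)) n := by
    intro e w hw he heb t' ht' t ht htt n
    have hT : 0 ≤ T ^ γ := Real.rpow_nonneg (ht.1.trans ht.2).le _
    have h := integral_force_of_isDuhamelSolution hpt hσ hM (C := q + K * T ^ γ) (by positivity)
      hw he (hbd heb) (t := -t) (η := t' / t) ⟨by linarith [ht.1, ht.2], by linarith [ht.1, ht.2]⟩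
      (neg_ne_zero.2 ht.1.ne') ⟨div_pos ht'.1 ht.1, (div_le_one ht.1).2 htt⟩ n
    rw [mul_neg, div_mul_cancel₀ _ ht.1.ne'] at h
    simp only [force_neg, neg_one_mul]
    refine ⟨?_, ?_⟩
    · have h1 := ((IntervalIntegrable.iff_comp_neg enorm_ne_top).1 h.1).neg
      rw [neg_neg, neg_neg] at h1
      exact h1
    · rw [h.2, intervalIntegral.integral_neg,
        intervalIntegral.integral_comp_neg (fun τ => force a b σ M τ (e τ) n),
        intervalIntegral.integral_symm]
  have hIp : ∀ t ∈ Ioo 0 T, t ∈ Ioo (-T) T := fun t ht => ⟨by linarith [ht.1, ht.2], ht.2⟩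
  have hIn : ∀ t ∈ Ioo 0 T, -t ∈ Ioo (-T) T := fun t ht =>
    ⟨by linarith [ht.2], by linarith [ht.1, ht.2]⟩
  have ep := eq_of_force (a := a) (b := b) (M := M) (A := d) (B := c) hγ hσ (Or.inl rfl) hM hM1 hq0
    hα hK0 (fun t ht => (hd t (hIp t ht)).1) (fun t ht => (hc t (hIp t ht)).1)
    (fun t ht => by simpa only [abs_of_pos ht.1] using hdK t (hIp t ht))
    (fun t ht => by simpa only [abs_of_pos ht.1] using hcK t (hIp t ht))
    (fun t ht => by simpa only [abs_of_pos ht.1] using hdc t (hIp t ht))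
    (hpos hv hd hdK) (hpos hu hc hcK)
  have en := eq_of_force (a := a) (b := b) (M := M) (A := fun t => d (-t)) (B := fun t => c (-t)) hγ
    hσ' (Or.inr rfl) hM hM1 hq0 hα hK0 (fun t ht => (hd _ (hIn t ht)).1)
    (fun t ht => (hc _ (hIn t ht)).1)
    (fun t ht => by simpa only [abs_neg, abs_of_pos ht.1] using hdK _ (hIn t ht))
    (fun t ht => by simpa only [abs_neg, abs_of_pos ht.1] using hcK _ (hIn t ht))
    (fun t ht => by simpa only [abs_neg, abs_of_pos ht.1] using hdc _ (hIn t ht))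
    (hneg hv hd hdK) (hneg hu hc hcK)
  intro t ht
  have heq : d t = c t := by
    funext n
    rcases lt_trichotomy t 0 with h | h | h
    · simpa using en (-t) ⟨by linarith, by linarith [ht.1]⟩ n
    · subst h
      have h1 := hdc 0 ht
      rw [abs_zero, Real.zero_rpow hγ0.ne', mul_zero] at h1
      have h2 : Summable fun n => ‖d 0 n - c 0 n‖ := Summable.of_nonneg_of_le
        (fun _ => norm_nonneg _) (fun _ => norm_sub_le _ _) ((hd 0 ht).1.add (hc 0 ht).1)
      have h3 := (h2.le_tsum n fun _ _ => norm_nonneg _).trans h1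
      exact sub_eq_zero.1 (norm_le_zero_iff.1 h3)
    · exact ep t ⟨h, ht.2⟩ n
  rw [← schrodinger_schrodinger_neg t (v t), ← schrodinger_schrodinger_neg t (u t),
    (hd t ht).eq_diracSum, (hc t ht).eq_diracSum, heq]

/-! ### From weighted `ℓ²` to `ℓ¹` -/

theorem summable_one_add_abs_rpow {s : ℝ} (hs : 1 < s) :
    Summable fun k : ℤ => (1 + |(k : ℝ)|) ^ (-s) := by
  refine Summable.of_norm_bounded_eventually (Real.summable_abs_int_rpow hs) ?_
  filter_upwards [(Set.finite_singleton (0 : ℤ)).compl_mem_cofinite] with k hk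
  have hk' : 0 < |(k : ℝ)| := abs_pos.2 (by exact_mod_cast hk)
  rw [Real.norm_of_nonneg (by positivity)]
  exact Real.rpow_le_rpow_of_nonpos hk' (by linarith) (by linarith)

/-- As wt² ≥ (1 + |k|)(1 + |k̃|), the double series is dominated by a product of two one-dimensional
series, which converge for exponents above 1. -/
theorem summable_wt_rpow {s : ℝ} (hs : 1 < s) : Summable fun n => (wt n ^ (-s)) ^ 2 := by
  have h0 : ∀ k : ℤ, 0 < 1 + |(k : ℝ)| := fun k => by positivity
  have h := (summable_one_add_abs_rpow hs).mul_of_nonneg (summable_one_add_abs_rpow hs)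
    (fun k => Real.rpow_nonneg (h0 k).le _) fun k => Real.rpow_nonneg (h0 k).le _
  refine Summable.of_nonneg_of_le (fun n => by positivity) (fun n => ?_) h
  rw [← Real.mul_rpow (h0 _).le (h0 _).le, ← Real.rpow_natCast, ← Real.rpow_mul (wt_pos n).le,
    mul_comm, Real.rpow_mul (wt_pos n).le, Real.rpow_natCast]
  refine Real.rpow_le_rpow_of_nonpos (mul_pos (h0 _) (h0 _)) ?_ (by linarith)
  have h1 := abs_nonneg (n.1 : ℝ)
  have h2 := abs_nonneg (n.2 : ℝ)
  simp only [wt]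
  nlinarith

/-- Cauchy-Schwarz with the weight and its inverse. -/
theorem sum_norm_le_normL2s (s : ℝ) (α : Idx →₀ ℂ) {K : ℝ}
    (hK : ∑ n ∈ α.support, (wt n ^ (-s)) ^ 2 ≤ K) :
    ∑ n ∈ α.support, ‖α n‖ ≤ Real.sqrt K * normL2s s α := by
  have h1 : ∀ n, ‖α n‖ = wt n ^ (-s) * (wt n ^ s * ‖α n‖) := fun n => by
    rw [← mul_assoc, ← Real.rpow_add (wt_pos n), neg_add_cancel, Real.rpow_zero, one_mul]
  have h2 : normL2s s α = Real.sqrt (∑ n ∈ α.support, (wt n ^ s * ‖α n‖) ^ 2) := by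
    rw [normL2s, tsum_eq_sum fun n hn => ?_]
    rw [Finsupp.notMem_support_iff.1 hn]
    simp
  rw [h2]
  calc ∑ n ∈ α.support, ‖α n‖ = ∑ n ∈ α.support, wt n ^ (-s) * (wt n ^ s * ‖α n‖) :=
        Finset.sum_congr rfl fun n _ => h1 n
    _ ≤ Real.sqrt (∑ n ∈ α.support, (wt n ^ (-s)) ^ 2) *
        Real.sqrt (∑ n ∈ α.support, (wt n ^ s * ‖α n‖) ^ 2) :=
        Real.sum_mul_le_sqrt_mul_sqrt _ _ _
    _ ≤ _ := mul_le_mul_of_nonneg_right (Real.sqrt_le_sqrt hK) (Real.sqrt_nonneg _)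

/-- The threshold for the norm in `l^{2,s}`, depending on the number of terms only if `s ≤ 1`. -/
theorem exists_threshold {s : ℝ} (hs : 0 < s) : ∃ ε₀ : ℕ → ℝ, (∀ N, 0 < ε₀ N) ∧
    (1 < s → ∀ N, ε₀ N = ε₀ 0) ∧ ∀ α : Idx →₀ ℂ, normL2s s α ≤ ε₀ α.support.card →
      ∑ n ∈ α.support, ‖α n‖ ≤ 1 / 2 := by
  obtain ⟨K, hK0, hK1, hK⟩ : ∃ K : ℕ → ℝ, (∀ N, 0 < K N) ∧ (1 < s → ∀ N, K N = K 0) ∧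
      ∀ α : Idx →₀ ℂ, ∑ n ∈ α.support, (wt n ^ (-s)) ^ 2 ≤ K α.support.card := by
    by_cases h : 1 < s
    · have hsum := summable_wt_rpow h
      refine ⟨fun _ => ∑' n, (wt n ^ (-s)) ^ 2, fun _ => ?_, fun _ _ => rfl, fun α =>
        hsum.sum_le_tsum _ fun _ _ => by positivity⟩
      exact hsum.tsum_pos (fun _ => by positivity) 0
        (pow_pos (Real.rpow_pos_of_pos (wt_pos 0) _) 2)
    -- Without summability, each term is at most 1 and their number is N; the added 1 keeps the
    -- bound positive when N = 0.
    · refine ⟨fun N => (N : ℝ) + 1, fun N => by positivity, fun h' => absurd h' h, fun α => ?_⟩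
      have h1 : ∀ n ∈ α.support, (wt n ^ (-s)) ^ 2 ≤ 1 := fun n _ =>
        pow_le_one₀ (Real.rpow_nonneg (wt_pos n).le _)
          (Real.rpow_le_one_of_one_le_of_nonpos (one_le_wt n) (by linarith))
      have h2 := Finset.sum_le_card_nsmul _ _ _ h1
      rw [nsmul_eq_mul, mul_one] at h2
      linarith
  have hpos : ∀ N, 0 < Real.sqrt (K N) := fun N => Real.sqrt_pos.2 (hK0 N)
  refine ⟨fun N => 1 / (2 * Real.sqrt (K N)), fun N => by have := hpos N; positivity,
    fun h N => by simp only [hK1 h N], fun α hα => (sum_norm_le_normL2s s α (hK α)).trans ?_⟩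
  refine (mul_le_mul_of_nonneg_left hα (Real.sqrt_nonneg _)).trans (le_of_eq ?_)
  have := (hpos α.support.card).ne'
  field_simp

/-- With equal moduli every resonant coefficient is 2N r² - r² = 2M, which is the cancellation
required by the profile without rotation. As N ≥ 1, M is nonnegative, and it is at most N r² ≤ 1/4.
-/
theorem exists_unique_duhamel {s γ a b σ : ℝ} (hs : 0 < s) (hγ : 1 / 2 < γ) (hγ' : γ < 1)
    (ha : a ≠ 0) (hb : b ≠ 0) (hσ : σ = 1 ∨ σ = -1) (hpt : Function.Injective (pt a b))
    (α : Idx →₀ ℂ) (hα : ∑ n ∈ α.support, ‖α n‖ ≤ 1 / 2) {r M : ℝ} (h0 : α ≠ 0)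
    (hr : ∀ n ∈ α.support, ‖α n‖ = r) (hM : M = ((α.support.card : ℝ) - 1 / 2) * r ^ 2) :
    ∃ T : ℝ, 0 < T ∧ ∃ u : ℝ → 𝓢'(ℝ, ℂ),
      (IsDuhamelSolution σ M T (diracDatum a b α) u ∧ HasDiagProfile s γ a b T α u) ∧
      ∀ v : ℝ → 𝓢'(ℝ, ℂ), IsDuhamelSolution σ M T (diracDatum a b α) v →
        HasDiagProfile s γ a b T α v → ∀ t ∈ Ioo (-T) T, v t = u t := by
  have hγ0 : 0 < γ := by linarith
  have hsum : ∑ n ∈ α.support, ‖α n‖ ^ 2 = α.support.card * r ^ 2 := by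
    rw [Finset.sum_congr rfl fun n hn => by rw [hr n hn], Finset.sum_const, nsmul_eq_mul]
  have hsq := sum_sq_le hα
  have hcard : (1 : ℝ) ≤ α.support.card := by
    exact_mod_cast Finset.card_pos.2 (Finsupp.support_nonempty_iff.2 h0)
  have hM0 : 0 ≤ M := by
    rw [hM]
    exact mul_nonneg (by linarith) (sq_nonneg r)
  have hM1 : M ≤ 1 := by
    rw [hM]
    nlinarith [sq_nonneg r]
  obtain ⟨T, hT, V, V', W, W', hV⟩ := exists_twoSidedProfile hs hγ hγ' hσ hpt α hα hM0 hM1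
    fun n hn => by rw [hsum, hr n hn, hM]; ring
  have hu := hV.isDuhamelSolution hγ0 hσ
  have hup := hV.hasDiagProfile ha hb hγ0
  exact ⟨T, hT, _, ⟨hu, hup⟩, fun v hv hvp =>
    eq_of_isDuhamelSolution hγ hσ hpt hα hM0 hM1 hu hup hv hvp⟩

end DiracNLS

end

theorem theorem2p2 (s γ a b σ : ℝ) (hs : 1 / 2 < s) (hγ : 1 / 2 < γ) (hγ' : γ < 1)
    (ha : a ≠ 0) (hb : b ≠ 0) (hab : Irrational (a / b)) (hσ : σ = 1 ∨ σ = -1) :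
    ∃ ε₀ : ℕ → ℝ, (∀ N, 0 < ε₀ N) ∧ (1 < s → ∀ N, ε₀ N = ε₀ 0) ∧
      ∀ α : ℤ × ℤ →₀ ℂ, DiracNLS.normL2s s α ≤ ε₀ α.support.card →
        (∃ T : ℝ, 0 < T ∧ ∃ u : ℝ → ℝ → ℂ,
          (DiracNLS.IsDistribSolution σ (∑ n ∈ α.support, ‖α n‖ ^ 2) T u ∧
            DiracNLS.HasAnsatz s γ a b σ T α u) ∧
          ∀ v : ℝ → ℝ → ℂ,
            DiracNLS.IsDistribSolution σ (∑ n ∈ α.support, ‖α n‖ ^ 2) T v →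
            DiracNLS.HasAnsatz s γ a b σ T α v → ∀ t ∈ Set.Ioo 0 T, ∀ x, v t x = u t x) ∧
        ∀ r M : ℝ, α ≠ 0 → (∀ n ∈ α.support, ‖α n‖ = r) →
          M = ((α.support.card : ℝ) - 1 / 2) * r ^ 2 →
          ∃ T : ℝ, 0 < T ∧ ∃ u : ℝ → TemperedDistribution ℝ ℂ,
            (DiracNLS.IsDuhamelSolution σ M T (DiracNLS.diracDatum a b α) u ∧
              DiracNLS.HasDiagProfile s γ a b T α u) ∧
            ∀ v : ℝ → TemperedDistribution ℝ ℂ,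
              DiracNLS.IsDuhamelSolution σ M T (DiracNLS.diracDatum a b α) v →
              DiracNLS.HasDiagProfile s γ a b T α v → ∀ t ∈ Set.Ioo (-T) T, v t = u t := by
  have hs0 : 0 < s := by linarith
  have hpt := DiracNLS.pt_injective hb hab
  obtain ⟨ε₀, h1, h2, h3⟩ := DiracNLS.exists_threshold hs0
  exact ⟨ε₀, h1, h2, fun α hα =>
    ⟨DiracNLS.exists_unique_ansatz hs0 hγ hγ' hσ hpt α (h3 α hα), fun r M h0 hr hM =>
      DiracNLS.exists_unique_duhamel hs0 hγ hγ' ha hb hσ hpt α (h3 α hα) h0 hr hM⟩⟩
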